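/- Let $k$ be an algebraically closed field of characteristic zero, and let $\mathfrak g=\mathfrak g_{\bar 0}\oplus\mathfrak g_{\bar 1}$ be a Lie superalgebra over $k$ which is either basic classical (that is, finite dimensional and simple, with $\mathfrak g_{\bar 1}$ a completely reducible $\mathfrak g_{\bar 0}$-module, and admitting an even non-degenerate invariant bilinear form) or isomorphic to $\mathfrak{sl}(n,n)$ for some $n\ge 1$. Fix a Cartan subalgebra $\mathfrak h$ of $\mathfrak g_{\bar 0}$ and a distinguished $\mathbb Z$-grading $\mathfrak g=\bigoplus_{i}\mathfrak g_i$ (compatible with the bracket and with $\mathfrak g_i$ of parity $i \bmod 2$, with $\mathfrak h\subseteq\mathfrak g_0$, and with $\mathfrak g_i=0$ for $|i|>2$, and even for $|i|>1$ unless $\mathfrak g_{\bar 1}$ is an irreducible $\mathfrak g_{\bar 0}$-module). Let $\mathfrak g=\mathfrak n^-\oplus\mathfrak h\oplus\mathfrak n^+$ be a triangular decomposition given by a Borel subalgebra $\mathfrak b^+=\mathfrak h\oplus\mathfrak n^+$ containing $\mathfrak h$ and $\bigoplus_{i>0}\mathfrak g_i$; thus $\mathfrak n^{\pm}$ is the sum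 of $\bigoplus_{\pm i>0}\mathfrak g_i$ and the positive (resp. negative) root spaces of the reductive Lie algebra $\mathfrak g_0$, for some system of positive roots. Let $A$ be a commutative associative unital $k$-algebra, not necessarily finitely generated, and let $\mathfrak g\otimes A$ be the Lie superalgebra with bracket $[x\otimes a,y\otimes b]=[x,y]\otimes ab$. Let $\psi\in(\mathfrak h\otimes A)^*$, and let $V=V(\psi)$ be an irreducible highest weight $(\mathfrak g\otimes A)$-module of highest weight $\psi$: an irreducible ($\mathbb Z/2$-graded) module generated by a nonzero vector $v$ with $(\mathfrak n^+\otimes A)v=0$ and $uv=\psi(u)v$ for all $u\in\mathfrak h\otimes A$. Then the following conditions are equivalent: 1. $V$ is quasifinite, i.e. $V=\bigoplus_{\lambda\in\mathfrak h^*}V_\lambda$, where $V_\lambda=\{w\in V : (h\otimes 1)w=\lambda(h)w \text{ for all } h\in\mathfrak h\}$, and every $V_\lambda$ is finite dimensional. 2. There is an ideal $I$ of $A$ with $\dim_k A/I<\infty$ such that $(\mathfrak g\otimes I)V=0$. 3. There is an ideal $I$ of $A$ with $\dim_k A/I<\infty$ such that $\psi(\mathfrak h\otimes I)=0$. If $A$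 is a finitely generated $k$-algebra, these conditions are also equivalent to: 4. $V$ has finite support, i.e. only finitely many maximal ideals of $A$ contain $\operatorname{Ann}_A V$, the sum of all ideals $I$ of $A$ with $(\mathfrak g\otimes I)V=0$. -/

import Mathlib

open scoped TensorProduct

/-! ### Lie superalgebras and their modules -/

/-- The Koszul sign `(-1)^(i j)`. -/
def koszulSign (i j : ZMod 2) : ℤ := if i = 1 ∧ j = 1 then -1 else 1

/-- A Lie superalgebra over the field `k`: a `ℤ/2`-graded vector space
`L = L_0 ⊕ L_1` with an even bilinear bracket which is super-antisymmetric and satisfies the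
super Jacobi identity on homogeneous elements. -/
class LieSuperalgebra (k : Type*) (L : Type*) [Field k] [AddCommGroup L] [Module k L] where
  part : ZMod 2 → Submodule k L
  isCompl : IsCompl (part 0) (part 1)
  br : L →ₗ[k] L →ₗ[k] L
  br_mem : ∀ (i j : ZMod 2) (x y : L), x ∈ part i → y ∈ part j → br x y ∈ part (i + j)
  br_skew : ∀ (i j : ZMod 2) (x y : L), x ∈ part i → y ∈ part j →
    br x y = -(koszulSign i j • br y x)
  jacobi : ∀ (i j l : ZMod 2) (x y z : L), x ∈ part i → y ∈ part j → z ∈ part l →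
    br x (br y z) = br (br x y) z + koszulSign i j • br y (br x z)

/-- A (`ℤ/2`-graded) module `V = V_0 ⊕ V_1` over a Lie superalgebra. -/
class LieSupermodule (k : Type*) (L : Type*) (V : Type*) [Field k] [AddCommGroup L] [Module k L]
    [LieSuperalgebra k L] [AddCommGroup V] [Module k V] where
  part : ZMod 2 → Submodule k V
  isCompl : IsCompl (part 0) (part 1)
  act : L →ₗ[k] V →ₗ[k] V
  act_mem : ∀ (i j : ZMod 2) (x : L) (v : V), x ∈ LieSuperalgebra.part (k := k) i → v ∈ part j →
    act x v ∈ part (i + j)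
  act_br : ∀ (i j : ZMod 2) (x y : L) (v : V), x ∈ LieSuperalgebra.part (k := k) i →
    y ∈ LieSuperalgebra.part (k := k) j →
    act (LieSuperalgebra.br (k := k) x y) v = act x (act y v) - koszulSign i j • act y (act x v)

/-- A subspace `W` of `M = M_0 ⊕ M_1` is graded if `W = (W ∩ M_0) ⊕ (W ∩ M_1)`. -/
def IsGradedSubspace {k M : Type*} [Field k] [AddCommGroup M] [Module k M]
    (p : ZMod 2 → Submodule k M) (W : Submodule k M) : Prop :=
  W ≤ (W ⊓ p 0) ⊔ (W ⊓ p 1)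

namespace LieSuperalgebra

section EvenPart

variable (k g : Type*) [Field k] [AddCommGroup g] [Module k g] [LieSuperalgebra k g]

/-- The even part `g_0`. -/
def evenPart : Submodule k g := part 0

/-- The odd part `g_1`. -/
def oddPart : Submodule k g := part 1

variable {k g}

theorem br_even_even (x y : evenPart k g) : br (k := k) (x : g) (y : g) ∈ evenPart k g :=
  br_mem 0 0 _ _ x.2 y.2

theorem br_even_odd (x : evenPart k g) (y : oddPart k g) :
    br (k := k) (x : g) (y : g) ∈ oddPart k g := by
  have h := br_mem (k := k) 0 1 (x : g) (y : g) x.2 y.2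
  rwa [zero_add] at h

instance : Bracket (evenPart k g) (evenPart k g) := ⟨fun x y => ⟨br (x : g) (y : g), br_even_even x y⟩⟩

instance : Bracket (evenPart k g) (oddPart k g) := ⟨fun x y => ⟨br (x : g) (y : g), br_even_odd x y⟩⟩

@[simp] theorem coe_lie_even (x y : evenPart k g) :
    ((⁅x, y⁆ : evenPart k g) : g) = br (k := k) (x : g) (y : g) := rfl

@[simp] theorem coe_lie_odd (x : evenPart k g) (y : oddPart k g) :
    ((⁅x, y⁆ : oddPart k g) : g) = br (k := k) (x : g) (y : g) := rfl

/-- The even part is a Lie algebra. -/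
instance [CharZero k] : LieRing (evenPart k g) where
  add_lie x y z := Subtype.ext (by simp)
  lie_add x y z := Subtype.ext (by simp)
  lie_self x := by
    apply Subtype.ext
    have h := br_skew (k := k) 0 0 (x : g) (x : g) x.2 x.2
    have h2 : br (k := k) (x : g) (x : g) = -br (k := k) (x : g) (x : g) := by
      simpa [koszulSign] using h
    have h3 : (2 : k) • br (k := k) (x : g) (x : g) = 0 := by
      rw [two_smul]; nth_rewrite 1 [h2]; simp
    simpa using (smul_eq_zero.mp h3)
  leibniz_lie x y z := by
    apply Subtype.ext
    simpa [koszulSign] using jacobi (k := k) 0 0 0 (x : g) (y : g) (z : g) x.2 y.2 z.2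

instance [CharZero k] : LieAlgebra k (evenPart k g) where
  lie_smul c x y := Subtype.ext (by simp)

/-- The odd part is a module over the even part, by the bracket. -/
instance [CharZero k] : LieRingModule (evenPart k g) (oddPart k g) where
  add_lie x y z := Subtype.ext (by simp)
  lie_add x y z := Subtype.ext (by simp)
  leibniz_lie x y z := by
    apply Subtype.ext
    simpa [koszulSign] using jacobi (k := k) 0 0 1 (x : g) (y : g) (z : g) x.2 y.2 z.2

instance [CharZero k] : LieModule k (evenPart k g) (oddPart k g) where
  smul_lie c x y := Subtype.ext (by simp)
  lie_smul c x y := Subtype.ext (by simp)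

end EvenPart

/-! ### Basic classical Lie superalgebras and `sl(n,n)` -/

section Classes

variable (k g : Type*) [Field k] [CharZero k] [AddCommGroup g] [Module k g] [LieSuperalgebra k g]

/-- `g` is simple: it is not abelian, and its only (graded) ideals are `0` and `g`. -/
def IsSimple : Prop :=
  (∃ x y : g, br (k := k) x y ≠ 0) ∧
  ∀ I : Submodule k g, IsGradedSubspace (part (k := k) (L := g)) I →
    (∀ x : g, ∀ y ∈ I, br (k := k) x y ∈ I) → I = ⊥ ∨ I = ⊤

/-- `g` is a basic classical Lie superalgebra: it is finite dimensional and simple, the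
representation of the even part on the odd part is completely reducible, and there is an even
non-degenerate invariant bilinear form on `g`. -/
structure IsBasicClassical : Prop where
  finiteDimensional : FiniteDimensional k g
  simple : IsSimple k g
  completelyReducible : ComplementedLattice (LieSubmodule k (evenPart k g) (oddPart k g))
  exists_form : ∃ B : g →ₗ[k] g →ₗ[k] k, B.Nondegenerate ∧
    (∀ x y z : g, B (br (k := k) x y) z = B x (br (k := k) y z)) ∧
    (∀ x ∈ evenPart k g, ∀ y ∈ oddPart k g, B x y = 0 ∧ B y x = 0)

end Classes

section SL

variable (k : Type*) [Field k] (n : ℕ)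

/-- The `ℤ/2`-grading of the `(n|n) × (n|n)` block matrices: block diagonal matrices are even,
block antidiagonal matrices are odd. -/
def matrixPart (i : ZMod 2) : Set (Matrix (Fin n ⊕ Fin n) (Fin n ⊕ Fin n) k) :=
  {X | if i = 0 then X.toBlocks₁₂ = 0 ∧ X.toBlocks₂₁ = 0
       else X.toBlocks₁₁ = 0 ∧ X.toBlocks₂₂ = 0}

/-- The supertrace. -/
def supertrace (X : Matrix (Fin n ⊕ Fin n) (Fin n ⊕ Fin n) k) : k :=
  X.toBlocks₁₁.trace - X.toBlocks₂₂.trace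

/-- `g` is isomorphic to `sl(n,n)`, the Lie superalgebra of `(n|n) × (n|n)` matrices of supertrace
zero with the supercommutator `[X, Y] = X Y - (-1)^(|X| |Y|) Y X`. -/
def IsSL (g : Type*) [AddCommGroup g] [Module k g] [LieSuperalgebra k g] : Prop :=
  ∃ φ : g →ₗ[k] Matrix (Fin n ⊕ Fin n) (Fin n ⊕ Fin n) k,
    Function.Injective φ ∧
    Set.range φ = {X | supertrace k n X = 0} ∧
    (∀ (i : ZMod 2) (x : g), x ∈ part (k := k) i → φ x ∈ matrixPart k n i) ∧
    ∀ (i j : ZMod 2) (x y : g), x ∈ part (k := k) i → y ∈ part (k := k) j →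
      φ (br (k := k) x y) = φ x * φ y - koszulSign i j • (φ y * φ x)

end SL

/-! ### Triangular decompositions -/

section Triangular

variable (k g : Type*) [Field k] [CharZero k] [AddCommGroup g] [Module k g] [LieSuperalgebra k g]

/-- The choices behind a triangular decomposition `g = n⁻ ⊕ h ⊕ n⁺`: a Cartan subalgebra `h`
of the even part, a distinguished `ℤ`-grading of `g`, and a Borel subalgebra `b⁺` containing `h`
and the pieces of positive degree.  Such a Borel subalgebra is `h ⊕ (⨁_{α > 0} (g_0)_α) ⊕
⨁_{i > 0} g_i` for a system of positive roots of the piece `g_0` of degree zero (a reductive Lie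
algebra).  As usual, the system of positive roots is given by a regular integral element `d ∈ h`:
the positive roots are those with `α(d) > 0`. -/
structure TriangularDecomposition where
  /-- the Cartan subalgebra `h` -/
  cartan : LieSubalgebra k (evenPart k g)
  isCartan : cartan.IsCartanSubalgebra
  /-- the distinguished `ℤ`-grading -/
  deg : ℤ → Submodule k g
  deg_isInternal : DirectSum.IsInternal deg
  deg_br_mem : ∀ (i j : ℤ) (x y : g), x ∈ deg i → y ∈ deg j → br (k := k) x y ∈ deg (i + j)
  /-- pieces of even degree are even and pieces of odd degree are odd -/
  deg_le_part : ∀ i : ℤ, deg i ≤ part (k := k) (i : ZMod 2)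
  deg_eq_bot : ∀ i : ℤ, 2 < |i| → deg i = ⊥
  /-- pieces of degree `± 2` occur in type II only, that is, if the odd part is irreducible
  as a module over the even part -/
  deg_eq_bot_of_not_irreducible :
    ¬ LieModule.IsIrreducible k (evenPart k g) (oddPart k g) → ∀ i : ℤ, 1 < |i| → deg i = ⊥
  cartan_le_deg_zero : ∀ x ∈ cartan, (x : g) ∈ deg 0
  /-- the regular integral element of `h` that determines the positive roots of `g_0` -/
  d : evenPart k g
  d_mem : d ∈ cartan
  /-- `ad d` is diagonalizable on `g_0`, with integer eigenvalues -/
  d_integral : deg 0 ≤ ⨆ m : ℤ, deg 0 ⊓ Module.End.eigenspace (br (k := k) (d : g)) (m : k)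
  /-- `d` is regular: its centralizer in `g_0` is `h` -/
  d_regular : ∀ x : evenPart k g, (x : g) ∈ deg 0 → br (k := k) (d : g) (x : g) = 0 → x ∈ cartan

namespace TriangularDecomposition

variable {k g} (T : TriangularDecomposition k g)

/-- The Cartan subalgebra `h` as a subspace of `g`. -/
def h : Submodule k g := T.cartan.toSubmodule.map (evenPart k g).subtype

/-- `n⁺`: the positive root spaces of `g_0` and the pieces `g_i` with `i > 0`. -/
def nPlus : Submodule k g :=
  (⨆ m : {m : ℤ // 0 < m}, T.deg 0 ⊓ Module.End.eigenspace (br (k := k) (T.d : g)) ((m : ℤ) : k)) ⊔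
    ⨆ i : {i : ℤ // 0 < i}, T.deg i

/-- `n⁻`: the negative root spaces of `g_0` and the pieces `g_i` with `i < 0`. -/
def nMinus : Submodule k g :=
  (⨆ m : {m : ℤ // m < 0}, T.deg 0 ⊓ Module.End.eigenspace (br (k := k) (T.d : g)) ((m : ℤ) : k)) ⊔
    ⨆ i : {i : ℤ // i < 0}, T.deg i

end TriangularDecomposition

end Triangular

/-! ### The map superalgebra `g ⊗ A` -/

section Map

variable (k g A : Type*) [Field k] [AddCommGroup g] [Module k g] [LieSuperalgebra k g]
  [CommRing A] [Algebra k A]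

/-- `(g ⊗ A)_i = g_i ⊗ A`. -/
def mapPart (i : ZMod 2) : Submodule k (g ⊗[k] A) :=
  LinearMap.range ((part (k := k) (L := g) i).subtype.rTensor A)

/-- `[x ⊗ a, y ⊗ b] = [x, y] ⊗ a b`. -/
def mapBr : (g ⊗[k] A) →ₗ[k] (g ⊗[k] A) →ₗ[k] (g ⊗[k] A) :=
  TensorProduct.map₂ (br (k := k) (L := g)) (LinearMap.mul k A)

variable {k g A}

@[simp] theorem mapBr_tmul (x y : g) (a b : A) :
    mapBr k g A (x ⊗ₜ a) (y ⊗ₜ b) = br (k := k) x y ⊗ₜ[k] (a * b) := by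
  simp [mapBr]

theorem tmul_mem_mapPart {i : ZMod 2} {x : g} (hx : x ∈ part (k := k) i) (a : A) :
    x ⊗ₜ[k] a ∈ mapPart k g A i :=
  ⟨(⟨x, hx⟩ : part (k := k) (L := g) i) ⊗ₜ[k] a, by simp⟩

theorem mapPart_induction {i : ZMod 2} {P : g ⊗[k] A → Prop} (h0 : P 0)
    (ht : ∀ x ∈ part (k := k) (L := g) i, ∀ a : A, P (x ⊗ₜ[k] a))
    (ha : ∀ u v, P u → P v → P (u + v)) {u : g ⊗[k] A} (hu : u ∈ mapPart k g A i) : P u := by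
  obtain ⟨w, rfl⟩ := hu
  induction w with
  | zero => simpa using h0
  | tmul x a => simpa using ht x x.2 a
  | add u v hu hv => rw [map_add]; exact ha _ _ hu hv

theorem mapPart_isCompl : IsCompl (mapPart k g A 0) (mapPart k g A 1) := by
  have hc := isCompl (k := k) (L := g)
  constructor
  · rw [Submodule.disjoint_def]
    intro u h0 h1
    let p : g →ₗ[k] g := Submodule.projection _ _ hc
    have e0 : p.rTensor A u = u := by
      refine mapPart_induction (P := fun u => p.rTensor A u = u) (by simp) ?_ ?_ h0
      · intro x hx a
        simp [p, Submodule.projection_apply_of_mem_left hc hx]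
      · intro u v hu hv
        rw [map_add, hu, hv]
    have e1 : p.rTensor A u = 0 := by
      refine mapPart_induction (P := fun u => p.rTensor A u = 0) (by simp) ?_ ?_ h1
      · intro x hx a
        have : p x = 0 := by simpa [p] using hx
        simp [this]
      · intro u v hu hv
        rw [map_add, hu, hv, add_zero]
    rw [← e0, e1]
  · rw [codisjoint_iff, eq_top_iff]
    intro u _
    induction u with
    | zero => exact Submodule.zero_mem _
    | tmul x a =>
      have hx : x ∈ part (k := k) (L := g) 0 ⊔ part (k := k) (L := g) 1 := by
        rw [hc.sup_eq_top]; trivial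
      obtain ⟨y, hy, z, hz, rfl⟩ := Submodule.mem_sup.mp hx
      rw [TensorProduct.add_tmul]
      exact Submodule.add_mem_sup (tmul_mem_mapPart hy a) (tmul_mem_mapPart hz a)
    | add u v hu hv => exact Submodule.add_mem _ (hu trivial) (hv trivial)

/-- The map superalgebra `g ⊗ A`. -/
instance : LieSuperalgebra k (g ⊗[k] A) where
  part := mapPart k g A
  isCompl := mapPart_isCompl
  br := mapBr k g A
  br_mem i j x y hx hy := by
    refine mapPart_induction (P := fun x => mapBr k g A x y ∈ mapPart k g A (i + j)) (by simp)
      (fun x hx a => ?_) (fun u v hu hv => ?_) hx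
    · refine mapPart_induction (P := fun y => mapBr k g A (x ⊗ₜ a) y ∈ mapPart k g A (i + j))
        (by simp) (fun y hy b => ?_) (fun u v hu hv => ?_) hy
      · rw [mapBr_tmul]
        exact tmul_mem_mapPart (br_mem i j x y hx hy) _
      · rw [map_add]; exact Submodule.add_mem _ hu hv
    · rw [map_add, LinearMap.add_apply]; exact Submodule.add_mem _ hu hv
  br_skew i j x y hx hy := by
    refine mapPart_induction
      (P := fun x => mapBr k g A x y = -(koszulSign i j • mapBr k g A y x)) (by simp)
      (fun x hx a => ?_) (fun u v hu hv => ?_) hx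
    · refine mapPart_induction
        (P := fun y => mapBr k g A (x ⊗ₜ a) y = -(koszulSign i j • mapBr k g A y (x ⊗ₜ a)))
        (by simp) (fun y hy b => ?_) (fun u v hu hv => ?_) hy
      · rw [mapBr_tmul, mapBr_tmul, br_skew i j x y hx hy, TensorProduct.neg_tmul,
          TensorProduct.smul_tmul', mul_comm a b]
      · rw [map_add, map_add, LinearMap.add_apply, hu, hv, smul_add, neg_add]
    · rw [map_add, map_add, LinearMap.add_apply, hu, hv, smul_add, neg_add]
  jacobi i j l x y z hx hy hz := by
    refine mapPart_induction
      (P := fun x => mapBr k g A x (mapBr k g A y z) = mapBr k g A (mapBr k g A x y) z +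
        koszulSign i j • mapBr k g A y (mapBr k g A x z)) (by simp)
      (fun x hx a => ?_) (fun u v hu hv => ?_) hx
    · refine mapPart_induction
        (P := fun y => mapBr k g A (x ⊗ₜ a) (mapBr k g A y z) =
          mapBr k g A (mapBr k g A (x ⊗ₜ a) y) z +
          koszulSign i j • mapBr k g A y (mapBr k g A (x ⊗ₜ a) z)) (by simp)
        (fun y hy b => ?_) (fun u v hu hv => ?_) hy
      · refine mapPart_induction
          (P := fun z => mapBr k g A (x ⊗ₜ a) (mapBr k g A (y ⊗ₜ b) z) =
            mapBr k g A (mapBr k g A (x ⊗ₜ a) (y ⊗ₜ b)) z +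
            koszulSign i j • mapBr k g A (y ⊗ₜ b) (mapBr k g A (x ⊗ₜ a) z)) (by simp)
          (fun z hz c => ?_) (fun u v hu hv => ?_) hz
        · simp only [mapBr_tmul]
          rw [jacobi i j l x y z hx hy hz, TensorProduct.add_tmul, TensorProduct.smul_tmul',
            mul_assoc, mul_left_comm b a c]
        · simp only [map_add, hu, hv, smul_add]; abel
      · simp only [map_add, LinearMap.add_apply, hu, hv, smul_add]; abel
    · simp only [map_add, LinearMap.add_apply, hu, hv, smul_add]; abel

end Map

end LieSuperalgebra

/-! ### Modules over `g ⊗ A` -/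

namespace LieSupermodule

open LieSuperalgebra

/-- Irreducible modules: nonzero, without proper nonzero (graded) submodules. -/
def IsIrreducible (k L V : Type*) [Field k] [AddCommGroup L] [Module k L]
    [LieSuperalgebra k L] [AddCommGroup V] [Module k V] [LieSupermodule k L V] : Prop :=
  Nontrivial V ∧
  ∀ W : Submodule k V, IsGradedSubspace (LieSupermodule.part (k := k) (L := L) (V := V)) W →
    (∀ x : L, ∀ w ∈ W, LieSupermodule.act (k := k) x w ∈ W) → W = ⊥ ∨ W = ⊤

section

variable {k g : Type*} [Field k] [CharZero k] [AddCommGroup g] [Module k g] [LieSuperalgebra k g]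
  (T : TriangularDecomposition k g)
  (A V : Type*) [CommRing A] [Algebra k A] [AddCommGroup V] [Module k V]
  [LieSupermodule k (g ⊗[k] A) V]

/-- The weight space `V_μ`, where `μ ∈ h^*` and `h` is identified with `h ⊗ 1 ⊆ g ⊗ A`. -/
def weightSpace (μ : Module.Dual k T.h) : Submodule k V where
  carrier := {v | ∀ x : T.h, act (k := k) ((x : g) ⊗ₜ[k] (1 : A)) v = μ x • v}
  zero_mem' := by intro x; simp
  add_mem' := by
    intro v w hv hw x
    rw [map_add, hv x, hw x, smul_add]
  smul_mem' := by
    intro c v hv x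
    rw [map_smul, hv x, smul_comm]

open Classical in
/-- `V` is quasifinite: `V` is the direct sum of its weight spaces, and these are all finite
dimensional. -/
def IsQuasifinite : Prop :=
  DirectSum.IsInternal (weightSpace T A V) ∧ ∀ μ, FiniteDimensional k (weightSpace T A V μ)

variable {A} {V}

/-- `v` is a highest weight vector on which `h ⊗ A` acts by `ψ`: it is nonzero,
`(n⁺ ⊗ A) v = 0`, `u v = ψ(u) v` for `u ∈ h ⊗ A`, and `v` generates `V`. -/
structure IsHighestWeightVector (ψ : Module.Dual k (T.h ⊗[k] A)) (v : V) : Prop where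
  ne_zero : v ≠ 0
  nPlus_act : ∀ x ∈ T.nPlus, ∀ a : A, act (k := k) (x ⊗ₜ[k] a) v = 0
  h_act : ∀ u : T.h ⊗[k] A, act (k := k) (T.h.subtype.rTensor A u) v = ψ u • v
  generates : ∀ W : Submodule k V, v ∈ W →
    (∀ x : g ⊗[k] A, ∀ w ∈ W, act (k := k) x w ∈ W) → W = ⊤

variable (V)

/-- `V` is an irreducible highest weight module of highest weight `ψ ∈ (h ⊗ A)^*`, that is,
`V ≅ V(ψ)`, the irreducible quotient of `U(g ⊗ A) ⊗_{U(b⁺ ⊗ A)} k_ψ`. -/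
def IsIrreducibleHighestWeight (ψ : Module.Dual k (T.h ⊗[k] A)) : Prop :=
  IsIrreducible k (g ⊗[k] A) V ∧ ∃ v : V, IsHighestWeightVector T ψ v

end

section Support

variable (k g : Type*) {A : Type*} (V : Type*) [Field k] [AddCommGroup g] [Module k g]
  [LieSuperalgebra k g] [CommRing A] [Algebra k A] [AddCommGroup V] [Module k V]
  [LieSupermodule k (g ⊗[k] A) V]

/-- `(g ⊗ I) V = 0`. -/
def Annihilates (I : Ideal A) : Prop :=
  ∀ (x : g), ∀ a ∈ I, ∀ v : V, act (k := k) (x ⊗ₜ[k] a) v = 0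

variable (A)

/-- `Ann_A V`: the sum of all ideals `I` with `(g ⊗ I) V = 0`. -/
def annihilator : Ideal A := sSup {I : Ideal A | Annihilates k g V I}

/-- The support of `V`: the set of maximal ideals of `A` containing `Ann_A V`. -/
def support : Set (MaximalSpectrum A) := {m | annihilator k g A V ≤ m.asIdeal}

end Support

end LieSupermodule

/-! ### Reductive Lie algebras with a faithful semisimple representation -/

namespace LieAlgebra

open LieModule

section Reductive

variable {k L : Type*} [Field k] [CharZero k] [LieRing L] [LieAlgebra k L] [FiniteDimensional k L]

/-! The three conditions are linked in the cycle 1 ⇒ 3 ⇒ 2 ⇒ 1.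

1 ⇒ 3. The subspace `h` is spanned by brackets `[x, y]` with `x ∈ n⁺` and `y` a weight vector
(`IsSplit.h_le_span_br_nPlus`). The map `b ↦ (y ⊗ b) v` takes its values in a single weight space.
If `b` lies in its kernel, applying `x ⊗ a` gives `ψ([x, y] ⊗ ab) = 0` for all `a`. So the kernel,
which has finite codimension, lies in an ideal on which `ψ([x, y] ⊗ -)` vanishes; finitely many such
ideals are intersected.

3 ⇒ 2. If `ψ(h ⊗ I) = 0`, then `K = U(n⁻ ⊗ A)(n⁻ ⊗ I) v` is a submodule, because `b⁺ ⊗ I` kills `v`.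
By irreducibility `K = 0` as soon as `v ∉ K`. For Lie algebras this is clear from weights. Here the
weight of `v` may recur below `v`: in `sl(1,1)` the subalgebra `h` is even central. The eigenvalues
of the regular element `d` deal with the root vectors of degree zero. For negative degrees
(`notMem_lowerPart`) there are two cases, recorded in `IsSplit.inner`. Either the grading is given
by an element `z ∈ h`, and the eigenvalues of `z` separate `v` from everything below. Or the degrees
are `-1, 0, 1` only; then the operators of negative degree anticommute, and any finitely generated
space of them is nilpotent. If `v` could be recovered from vectors below it, a nonzero `W` with `W =
F • W` and `F` nilpotent would result.

2 ⇒ 1. Only the finite dimensional algebra `A / I` acts, so every piece of `g` gives a finite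
dimensional space of operators. The same two cases bound the number of operators of negative degree
needed to reach a given weight, and the eigenvalue of `d` then bounds the number of negative root
operators of degree zero.

The structure theory of `g` enters through `IsSplit`: `h` is commutative, acts diagonalizably and
lies in `[g, g]`, and one of the two cases above holds. Diagonalizability follows from reductivity
of the even part, which has a faithful semisimple representation: the natural one for `sl(n,n)`, the
odd part for basic classical `g` (if it is zero, the even part is simple). When the odd part is
irreducible, derivations of semisimple Lie algebras and Schur's lemma show that the degree
derivation is inner.

For finitely generated `A`, finite support is condition 2 in disguise, since an ideal lies in
finitely many maximal ideals exactly when it has finite codimension. -/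

/-- An element of the radical that is a sum of brackets acts by zero on every irreducible module,
since it acts by a scalar of trace zero. -/
lemma lie_eq_zero_of_mem_radical_of_mem_derived [IsAlgClosed k] {M : Type*}
    [AddCommGroup M] [Module k M] [LieRingModule L M] [LieModule k L M] [FiniteDimensional k M]
    [IsIrreducible k L M] {x : L} (hx : x ∈ radical k L)
    (hx' : x ∈ ⁅(⊤ : LieIdeal k L), (⊤ : LieIdeal k L)⁆) (m : M) : ⁅x, m⁆ = 0 := by
  have _i := nontrivial_of_isIrreducible k L M
  obtain ⟨χ, hχ⟩ : ∃ χ : Module.Dual k (radical k L), Nontrivial (weightSpace M χ) :=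
    exists_nontrivial_weightSpace_of_isSolvable k (radical k L) M
  let N : LieSubmodule k L M := weightSpaceOfIsLieTower k M χ
  replace hχ : Nontrivial N := hχ
  replace hχ : N = ⊤ := N.eq_top_of_isIrreducible k L M
  have hχ' : toEnd k _ M x = χ ⟨x, hx⟩ • LinearMap.id := by
    ext m
    have hm : ∀ (y : L) (hy : y ∈ radical k L), ⁅y, m⁆ = χ ⟨y, hy⟩ • m := by
      simpa [N, weightSpaceOfIsLieTower, mem_weightSpace] using
        (hχ ▸ LieSubmodule.mem_top _ : m ∈ N)
    simpa using hm x hx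
  have htr : LinearMap.trace k M (toEnd k L M x) = 0 := by
    clear hχ' hx
    rw [← LieSubmodule.mem_toSubmodule, LieSubmodule.lieIdeal_oper_eq_linear_span'] at hx'
    induction hx' using Submodule.span_induction with
    | mem u hu =>
      obtain ⟨a, -, b, -, rfl⟩ := hu
      simp
    | zero => simp
    | add u v _ _ hu hv => rw [map_add, map_add, hu, hv, add_zero]
    | smul t u _ hu => rw [map_smul, map_smul, hu, smul_zero]
  rw [hχ', map_smul, LinearMap.trace_id, smul_eq_mul] at htr
  have hfin : (Module.finrank k M : k) ≠ 0 := by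
    exact_mod_cast (Module.finrank_pos (R := k) (M := M)).ne'
  have h0 : χ ⟨x, hx⟩ = 0 := by simpa [hfin] using htr
  rw [h0, zero_smul] at hχ'
  simpa using congrArg (fun f => f m) hχ'

/-- If `M` is a sum of irreducible modules and faithful, then the radical of `L` meets `[L, L]`
trivially. -/
lemma radical_inf_derived_eq_bot [IsAlgClosed k] (M : Type*) [AddCommGroup M] [Module k M]
    [LieRingModule L M] [LieModule k L M] [FiniteDimensional k M]
    (hM : sSup {N : LieSubmodule k L M | IsAtom N} = ⊤)
    (hf : ∀ x : L, (∀ m : M, ⁅x, m⁆ = 0) → x = 0) :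
    ∀ x ∈ radical k L, x ∈ ⁅(⊤ : LieIdeal k L), (⊤ : LieIdeal k L)⁆ → x = 0 := by
  intro x hx hx'
  apply hf
  suffices h : sSup (LieSubmodule.toSubmodule '' {N : LieSubmodule k L M | IsAtom N}) ≤
      LinearMap.ker (toEnd k L M x) by
    intro m
    have hm : m ∈ (sSup {N : LieSubmodule k L M | IsAtom N} : LieSubmodule k L M) := by
      rw [hM]; trivial
    rw [← LieSubmodule.mem_toSubmodule, LieSubmodule.sSup_toSubmodule] at hm
    simpa using h hm
  refine sSup_le ?_
  rintro _ ⟨N, hN, rfl⟩ m hm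
  have hirr : IsIrreducible k L N := by
    have := hN.1
    have : Nontrivial N := (LieSubmodule.nontrivial_iff_ne_bot k L M).mpr hN.1
    refine IsIrreducible.mk fun N' hN' => ?_
    have h1 : N'.map N.incl ≤ N := by
      rw [LieSubmodule.map_le_iff_le_comap]; simp
    rcases h1.lt_or_eq with h | h
    · refine absurd ((LieSubmodule.eq_bot_iff N').mpr fun y hy => ?_) hN'
      have : (y : M) ∈ N'.map N.incl := LieSubmodule.mem_map_of_mem hy
      rw [hN.2 _ h] at this
      exact Subtype.ext (by simpa using this)
    · rw [eq_top_iff]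
      intro y _
      have : (y : M) ∈ N'.map N.incl := by rw [h]; exact y.2
      obtain ⟨z, hz, hzy⟩ := (LieSubmodule.mem_map _).mp this
      have : z = y := Subtype.ext hzy
      exact this ▸ hz
  have := lie_eq_zero_of_mem_radical_of_mem_derived (M := N) hx hx' ⟨m, hm⟩
  simpa using congrArg Subtype.val this

variable (h : ∀ x ∈ radical k L, x ∈ ⁅(⊤ : LieIdeal k L), (⊤ : LieIdeal k L)⁆ → x = 0)
include h

omit [CharZero k] [FiniteDimensional k L] in
-- The bracket lies both in the radical, which is an ideal, and in `[L, L]`.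
lemma radical_eq_center_of_radical_inf_derived {x : L} (hx : x ∈ radical k L) (y : L) :
    ⁅y, x⁆ = 0 :=
  h _ (LieSubmodule.lie_mem _ hx) (LieSubmodule.lie_mem_lie (by trivial) (by trivial))

/-- If `z` is Killing-orthogonal to `[L, L]`, invariance makes `[y, z]` orthogonal to all of `L`.
Cartan's criterion puts `[y, z]` in the radical; being in `[L, L]` too, it vanishes, and `z` is
central. -/
lemma killingCompl_derived_le_radical :
    LieIdeal.killingCompl k L ⁅(⊤ : LieIdeal k L), (⊤ : LieIdeal k L)⁆ ≤ radical k L := by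
  intro z hz
  have hz' : ∀ y : L, ⁅y, z⁆ = 0 := by
    intro y
    refine h _ (killingCompl_top_le_radical k L ?_)
      (LieSubmodule.lie_mem_lie (by trivial) (by trivial))
    rw [LieIdeal.mem_killingCompl]
    intro x _
    rw [← LieModule.traceForm_apply_lie_apply k L L x y z]
    exact (LieIdeal.mem_killingCompl k L _).mp hz _
      (LieSubmodule.lie_mem_lie (by trivial) (by trivial))
  exact center_le_radical k L ((mem_maxTrivSubmodule k L L z).mpr hz')

lemma disjoint_derived_killingCompl :
    Disjoint ⁅(⊤ : LieIdeal k L), (⊤ : LieIdeal k L)⁆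
      (LieIdeal.killingCompl k L ⁅(⊤ : LieIdeal k L), (⊤ : LieIdeal k L)⁆) := by
  rw [disjoint_iff, LieSubmodule.eq_bot_iff]
  rintro x ⟨hx, hx'⟩
  exact h x (killingCompl_derived_le_radical h hx') hx

lemma isCompl_derived_killingCompl :
    IsCompl (⁅(⊤ : LieIdeal k L), (⊤ : LieIdeal k L)⁆).toSubmodule
      (LieIdeal.killingCompl k L ⁅(⊤ : LieIdeal k L), (⊤ : LieIdeal k L)⁆).toSubmodule := by
  rw [LieIdeal.toSubmodule_killingCompl,
    LinearMap.BilinForm.isCompl_orthogonal_iff_disjoint (LieModule.traceForm_isSymm k L L).isRefl,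
    ← LieIdeal.toSubmodule_killingCompl, LieSubmodule.disjoint_toSubmodule]
  exact disjoint_derived_killingCompl h

/-- Every element of `L` is the sum of an element of `[L, L]` and a central element. -/
lemma exists_derived_add_central (x : L) :
    ∃ s ∈ ⁅(⊤ : LieIdeal k L), (⊤ : LieIdeal k L)⁆, ∃ z : L, (∀ y : L, ⁅y, z⁆ = 0) ∧ x = s + z := by
  have hx : x ∈ (⁅(⊤ : LieIdeal k L), (⊤ : LieIdeal k L)⁆).toSubmodule ⊔
      (LieIdeal.killingCompl k L ⁅(⊤ : LieIdeal k L), (⊤ : LieIdeal k L)⁆).toSubmodule := by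
    rw [(isCompl_derived_killingCompl h).sup_eq_top]; trivial
  obtain ⟨s, hs, z, hz, rfl⟩ := Submodule.mem_sup.mp hx
  exact ⟨s, hs, z, radical_eq_center_of_radical_inf_derived h
    (killingCompl_derived_le_radical h hz), rfl⟩

/-- The Killing form of an ideal is the restriction of that of `L`, so its kernel lies in the
orthogonal complement of `[L, L]`, hence in the radical. -/
lemma isKilling_derived : IsKilling k (⁅(⊤ : LieIdeal k L), (⊤ : LieIdeal k L)⁆ : LieIdeal k L) := by
  refine ⟨?_⟩
  rw [LieSubmodule.eq_bot_iff]
  intro x hx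
  rw [LieIdeal.mem_killingCompl] at hx
  have := h x (killingCompl_derived_le_radical h ?_) x.2
  · exact Subtype.ext this
  · rw [LieIdeal.mem_killingCompl]
    intro y hy
    have := hx ⟨y, hy⟩ trivial
    rw [LieIdeal.killingForm_eq] at this
    exact this

/-- The elements of a Cartan subalgebra of a reductive Lie algebra are ad-diagonalizable. -/
lemma iSup_eigenspace_ad_eq_top [IsAlgClosed k] (H : LieSubalgebra k L) [H.IsCartanSubalgebra]
    {x : L} (hx : x ∈ H) : ⨆ μ : k, Module.End.eigenspace (ad k L x) μ = ⊤ := by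
  set s : LieIdeal k L := ⁅(⊤ : LieIdeal k L), (⊤ : LieIdeal k L)⁆
  have hK : IsKilling k s := isKilling_derived h
  -- A Cartan subalgebra is its own normalizer, so it contains the centre.
  have hcen : ∀ z : L, (∀ y : L, ⁅y, z⁆ = 0) → z ∈ H := by
    intro z hz
    rw [← LieSubalgebra.IsCartanSubalgebra.self_normalizing (H := H),
      LieSubalgebra.mem_normalizer_iff]
    intro y hy
    rw [← lie_skew, hz y, neg_zero]
    exact H.zero_mem
  let Hs : LieSubalgebra k s := H.comap s.toLieSubalgebra.incl
  have hHs : ∀ y : s, y ∈ Hs ↔ (y : L) ∈ H := fun y => Iff.rfl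
  -- Elements of `H` differ from elements of `H ∩ [L, L]` by central ones, so whatever normalizes `H
  -- ∩ [L, L]` normalizes `H`.
  have hCar : Hs.IsCartanSubalgebra := by
    constructor
    · let f : Hs →ₗ⁅k⁆ H :=
        { toFun := fun y => ⟨(y : s), y.2⟩
          map_add' := fun _ _ => rfl
          map_smul' := fun _ _ => rfl
          map_lie' := rfl }
      exact Function.Injective.lieAlgebra_isNilpotent (f := f)
        (fun a b hab => Subtype.ext (Subtype.ext (congrArg (fun t : H => (t : L)) hab)))
    · refine le_antisymm (fun y hy => ?_) (LieSubalgebra.le_normalizer _)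
      rw [LieSubalgebra.mem_normalizer_iff] at hy
      rw [hHs, ← LieSubalgebra.IsCartanSubalgebra.self_normalizing (H := H),
        LieSubalgebra.mem_normalizer_iff]
      intro w hw
      obtain ⟨t, ht, z, hz, rfl⟩ := exists_derived_add_central h w
      have htH : t ∈ H := by
        have := H.sub_mem hw (hcen z hz)
        simpa using this
      rw [lie_add, hz, add_zero]
      exact hy ⟨t, ht⟩ htH
  obtain ⟨t, ht, z, hz, rfl⟩ := exists_derived_add_central h x
  have htH : t ∈ H := by
    have := H.sub_mem hx (hcen z hz)
    simpa using this
  have hz' : ∀ y : L, ⁅z, y⁆ = 0 := fun y => by rw [← lie_skew, hz, neg_zero]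
  have hss := IsKilling.isSemisimple_ad_of_mem_isCartanSubalgebra (K := k) (H := Hs)
    (x := ⟨t, ht⟩) htH
  have hsup := Module.End.IsSemisimple.iSup_eigenspace_eq_top hss
  rw [eq_top_iff]
  intro w _
  obtain ⟨u, hu, c, hc, rfl⟩ := exists_derived_add_central h w
  refine Submodule.add_mem _ ?_ ?_
  · have hu' : (⟨u, hu⟩ : s) ∈ ⨆ μ : k, Module.End.eigenspace (ad k s ⟨t, ht⟩) μ := by
      rw [hsup]; trivial
    have hle : (⨆ μ : k, Module.End.eigenspace (ad k s ⟨t, ht⟩) μ) ≤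
        (⨆ μ : k, Module.End.eigenspace (ad k L (t + z)) μ).comap s.toSubmodule.subtype := by
      refine iSup_le fun μ y hy => ?_
      refine Submodule.mem_iSup_of_mem (p := fun μ : k => Module.End.eigenspace (ad k L (t + z)) μ) μ ?_
      rw [Module.End.mem_eigenspace_iff] at hy ⊢
      have := congrArg (fun q : s => (q : L)) hy
      simpa [hz'] using this
    exact hle hu'
  · refine Submodule.mem_iSup_of_mem 0 ?_
    rw [Module.End.mem_eigenspace_iff]
    simp [hc]

omit h [CharZero k] [FiniteDimensional k L] in
/-- If `x` is ad-diagonalizable, then it acts diagonalizably on every sum of irreducible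
modules. -/
lemma iSup_eigenspace_toEnd_eq_top [IsAlgClosed k] {M : Type*} [AddCommGroup M] [Module k M]
    [LieRingModule L M] [LieModule k L M] [FiniteDimensional k M]
    (hM : sSup {N : LieSubmodule k L M | IsAtom N} = ⊤)
    {x : L} (hx : ⨆ μ : k, Module.End.eigenspace (ad k L x) μ = ⊤) :
    ⨆ μ : k, Module.End.eigenspace (toEnd k L M x) μ = ⊤ := by
  -- Eigenvectors of `ad x` span `L` and shift the eigenvalues of `x` on `M`, so the sum of the
  -- eigenspaces is a submodule.
  let W : LieSubmodule k L M :=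
    { toSubmodule := ⨆ μ : k, Module.End.eigenspace (toEnd k L M x) μ
      lie_mem := by
        intro y m hm
        have hy : y ∈ ⨆ μ : k, Module.End.eigenspace (ad k L x) μ := by rw [hx]; trivial
        change m ∈ (⨆ μ : k, Module.End.eigenspace (toEnd k L M x) μ) at hm
        change ⁅y, m⁆ ∈ (⨆ μ : k, Module.End.eigenspace (toEnd k L M x) μ)
        induction hy using Submodule.iSup_induction' with
        | mem α y hy =>
          induction hm using Submodule.iSup_induction' with
          | mem μ m hm =>
            refine Submodule.mem_iSup_of_mem (α + μ) ?_
            rw [Module.End.mem_eigenspace_iff] at *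
            simp only [ad_apply, toEnd_apply_apply] at *
            rw [leibniz_lie, hy, hm, smul_lie, lie_smul, add_smul]
          | zero => simp
          | add m m' _ _ hm hm' => rw [lie_add]; exact Submodule.add_mem _ hm hm'
        | zero => simp
        | add y y' _ _ hy hy' => rw [add_lie]; exact Submodule.add_mem _ hy hy' }
  have hW : W = ⊤ := by
    rw [eq_top_iff, ← hM]
    refine sSup_le fun N hN => ?_
    -- A minimal submodule contains an eigenvector of `x`, so it meets `W` and therefore lies in it.
    rcases (inf_le_left : N ⊓ W ≤ N).lt_or_eq with hlt | heq
    · exfalso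
      have hbot := hN.2 _ hlt
      have : Nontrivial N := (LieSubmodule.nontrivial_iff_ne_bot k L M).mpr hN.1
      obtain ⟨μ, hμ⟩ := Module.End.exists_eigenvalue (toEnd k L N x)
      obtain ⟨n, hn⟩ := hμ.exists_hasEigenvector
      have h1 : (n : M) ∈ N ⊓ W := by
        refine ⟨n.2, Submodule.mem_iSup_of_mem
          (p := fun μ : k => Module.End.eigenspace (toEnd k L M x) μ) μ ?_⟩
        rw [Module.End.mem_eigenspace_iff]
        simpa using congrArg Subtype.val hn.apply_eq_smul
      rw [hbot] at h1
      exact hn.2 (Subtype.ext (by simpa using h1))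
    · exact inf_eq_left.mp heq
  have := congrArg LieSubmodule.toSubmodule hW
  exact this

end Reductive

end LieAlgebra

/-! ### Diagonalizable endomorphisms -/

namespace Module.End

variable {k V W : Type*} [Field k] [AddCommGroup V] [Module k V] [AddCommGroup W] [Module k W]

/-- The product of `X - μ` over the finitely many eigenvalues is squarefree and annihilates `f`. -/
lemma isSemisimple_of_iSup_eigenspace_eq_top [FiniteDimensional k V] {f : Module.End k V}
    (hf : ⨆ μ : k, f.eigenspace μ = ⊤) : f.IsSemisimple := by
  classical
  let S : Finset k := (f.finite_hasEigenvalue).toFinset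
  let p : Polynomial k := ∏ μ ∈ S, (Polynomial.X - Polynomial.C μ)
  refine isSemisimple_of_squarefree_aeval_eq_zero (p := p) ?_ ?_
  · refine Polynomial.Separable.squarefree ?_
    exact Polynomial.separable_prod_X_sub_C_iff'.mpr (by simp)
  · have : (⊤ : Submodule k V) ≤ LinearMap.ker (Polynomial.aeval f p) := by
      rw [← hf]
      refine iSup_le fun μ v hv => ?_
      rcases eq_or_ne v 0 with rfl | hv0
      · simp
      have hμ : μ ∈ S := by
        simp only [S, Set.Finite.mem_toFinset]
        exact hasEigenvalue_of_hasEigenvector ⟨hv, hv0⟩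
      rw [LinearMap.mem_ker, aeval_apply_of_hasEigenvector ⟨hv, hv0⟩]
      have : p.eval μ = 0 := by
        rw [Polynomial.eval_prod]
        exact Finset.prod_eq_zero hμ (by simp)
      rw [this, zero_smul]
    exact LinearMap.ext fun v => this trivial

/-- An injective intertwiner pulls back diagonalizability. -/
lemma iSup_eigenspace_eq_top_of_injective [IsAlgClosed k] [FiniteDimensional k V]
    [FiniteDimensional k W] {f : Module.End k V} {h : Module.End k W} (Φ : V →ₗ[k] W)
    (hΦ : Function.Injective Φ) (hc : ∀ v, Φ (f v) = h (Φ v)) (hs : h.IsSemisimple) :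
    ⨆ μ : k, f.eigenspace μ = ⊤ := by
  have haev : ∀ p : Polynomial k, ∀ v, Φ (Polynomial.aeval f p v) = Polynomial.aeval h p (Φ v) := by
    intro p
    induction p using Polynomial.induction_on' with
    | add p q hp hq => intro v; simp [hp, hq]
    | monomial n a =>
      intro v
      have : ∀ n : ℕ, Φ ((f ^ n) v) = (h ^ n) (Φ v) := by
        intro n
        induction n with
        | zero => simp
        | succ n ih => rw [pow_succ', pow_succ', Module.End.mul_apply, hc, ih, Module.End.mul_apply]
      simp [Polynomial.aeval_monomial, this]
  -- The minimal polynomial of `h` is squarefree, and through the injection `Φ` it annihilates `f`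
  -- as well.
  refine IsSemisimple.iSup_eigenspace_eq_top (isSemisimple_of_squarefree_aeval_eq_zero
    (p := minpoly k h) hs.minpoly_squarefree ?_)
  ext v
  apply hΦ
  rw [haev, minpoly.aeval]
  simp

end Module.End

/-! ### The Lie superalgebra `sl(n,n)` -/

section Trace

variable {k ι : Type*} [Field k] [Fintype ι] [DecidableEq ι]

/-- A matrix of trace zero lies in every subspace that contains all commutators. -/
lemma Matrix.mem_of_trace_eq_zero [Nonempty ι] (S : Submodule k (Matrix ι ι k))
    (hS : ∀ P Q : Matrix ι ι k, Q * P - P * Q ∈ S) {Z : Matrix ι ι k} (hZ : Z.trace = 0) :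
    Z ∈ S := by
  obtain ⟨o⟩ := ‹Nonempty ι›
  -- Modulo commutators the off-diagonal matrix units vanish and the diagonal ones coincide, so only
  -- the trace survives.
  have key : ∀ Z : Matrix ι ι k, Z - Z.trace • Matrix.single o o 1 ∈ S := by
    intro Z
    induction Z using Matrix.induction_on' with
    | h_zero => simp
    | h_add P Q hP hQ =>
      have := S.add_mem hP hQ
      rw [Matrix.trace_add, add_smul]
      convert this using 1
      abel
    | h_std_basis i j x =>
      rcases eq_or_ne i j with rfl | hij
      · have := S.smul_mem x (hS (Matrix.single o i 1) (Matrix.single i o 1))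
        simpa [Matrix.trace_single_eq_same, smul_sub] using this
      · have := hS (Matrix.single i j x) (Matrix.single i i 1)
        rw [Matrix.single_mul_single_same, Matrix.single_mul_single_of_ne _ _ _ _ hij.symm] at this
        rw [Matrix.trace_single_eq_of_ne _ _ _ hij]
        simpa using this
  simpa [hZ] using key Z

end Trace

namespace LieSuperalgebra

section SL

variable {k g : Type*} [Field k] [AddCommGroup g] [Module k g] [LieSuperalgebra k g] {n : ℕ}
  {φ : g →ₗ[k] Matrix (Fin n ⊕ Fin n) (Fin n ⊕ Fin n) k}

lemma matrixPart_zero_inter_one {X : Matrix (Fin n ⊕ Fin n) (Fin n ⊕ Fin n) k}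
    (h0 : X ∈ matrixPart k n 0) (h1 : X ∈ matrixPart k n 1) : X = 0 := by
  have h0' : X.toBlocks₁₂ = 0 ∧ X.toBlocks₂₁ = 0 := by simpa [matrixPart] using h0
  have h1' : X.toBlocks₁₁ = 0 ∧ X.toBlocks₂₂ = 0 := by simpa [matrixPart] using h1
  rw [← Matrix.fromBlocks_toBlocks X, h0'.1, h0'.2, h1'.1, h1'.2, Matrix.fromBlocks_zero]

lemma matrixPart_sub {i : ZMod 2} {X Y : Matrix (Fin n ⊕ Fin n) (Fin n ⊕ Fin n) k}
    (hX : X ∈ matrixPart k n i) (hY : Y ∈ matrixPart k n i) : X - Y ∈ matrixPart k n i := by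
  have hs : ∀ a b c d : Matrix (Fin n) (Fin n) k, ∀ a' b' c' d' : Matrix (Fin n) (Fin n) k,
      Matrix.fromBlocks a b c d - Matrix.fromBlocks a' b' c' d' =
        Matrix.fromBlocks (a - a') (b - b') (c - c') (d - d') := by
    intros
    ext (i | i) (j | j) <;> simp
  rw [← Matrix.fromBlocks_toBlocks X, ← Matrix.fromBlocks_toBlocks Y, hs]
  simp only [matrixPart, Set.mem_ofPred_eq] at *
  split_ifs at * <;> simp [*]

section

variable (hinj : Function.Injective φ) (hrange : Set.range φ = {X | supertrace k n X = 0})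
  (hpart : ∀ (i : ZMod 2) (x : g), x ∈ part (k := k) i → φ x ∈ matrixPart k n i)
include hinj hrange hpart

omit hinj in
/-- Homogeneous matrices of supertrace zero come from homogeneous elements. -/
lemma exists_mem_part_of_matrixPart (i : ZMod 2)
    {X : Matrix (Fin n ⊕ Fin n) (Fin n ⊕ Fin n) k} (hX : supertrace k n X = 0)
    (hi : X ∈ matrixPart k n i) : ∃ x ∈ part (k := k) (L := g) i, φ x = X := by
  obtain ⟨x, rfl⟩ : X ∈ Set.range φ := by rw [hrange]; exact hX
  have hx : x ∈ part (k := k) (L := g) 0 ⊔ part (k := k) (L := g) 1 := by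
    rw [(isCompl (k := k) (L := g)).sup_eq_top]; trivial
  obtain ⟨y, hy, z, hz, rfl⟩ := Submodule.mem_sup.mp hx
  rcases (by decide : ∀ i : ZMod 2, i = 0 ∨ i = 1) i with rfl | rfl
  · refine ⟨y, hy, ?_⟩
    have h1 : φ z ∈ matrixPart k n 0 := by
      have := matrixPart_sub hi (hpart 0 y hy)
      simpa using this
    rw [map_add, matrixPart_zero_inter_one h1 (hpart 1 z hz), add_zero]
  · refine ⟨z, hz, ?_⟩
    have h1 : φ y ∈ matrixPart k n 1 := by
      have := matrixPart_sub hi (hpart 1 z hz)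
      simpa using this
    rw [map_add, matrixPart_zero_inter_one (hpart 0 y hy) h1, zero_add]

omit hinj in
lemma exists_odd_of_upper (P : Matrix (Fin n) (Fin n) k) :
    ∃ x ∈ part (k := k) (L := g) 1, φ x = Matrix.fromBlocks 0 P 0 0 :=
  exists_mem_part_of_matrixPart hrange hpart 1 (by simp [supertrace]) (by simp [matrixPart])

omit hinj in
lemma exists_odd_of_lower (P : Matrix (Fin n) (Fin n) k) :
    ∃ x ∈ part (k := k) (L := g) 1, φ x = Matrix.fromBlocks 0 0 P 0 :=
  exists_mem_part_of_matrixPart hrange hpart 1 (by simp [supertrace]) (by simp [matrixPart])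

omit hinj in
lemma exists_even_of_diagonal (P Q : Matrix (Fin n) (Fin n) k) (h : P.trace = Q.trace) :
    ∃ x ∈ part (k := k) (L := g) 0, φ x = Matrix.fromBlocks P 0 0 Q :=
  exists_mem_part_of_matrixPart hrange hpart 0 (by simp [supertrace, h])
    (by simp [matrixPart])

omit hinj hrange in
lemma eq_fromBlocks_of_even {x : g} (hx : x ∈ part (k := k) 0) :
    φ x = Matrix.fromBlocks (φ x).toBlocks₁₁ 0 0 (φ x).toBlocks₂₂ := by
  have h0' : (φ x).toBlocks₁₂ = 0 ∧ (φ x).toBlocks₂₁ = 0 := by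
    simpa [matrixPart] using hpart 0 x hx
  conv_lhs => rw [← Matrix.fromBlocks_toBlocks (φ x), h0'.1, h0'.2]

variable (hbr : ∀ (i j : ZMod 2) (x y : g), x ∈ part (k := k) i → y ∈ part (k := k) j →
      φ (br (k := k) x y) = φ x * φ y - koszulSign i j • (φ y * φ x))
include hbr

/-- The even part of `sl(n,n)` is spanned by brackets. -/
lemma even_le_span_br_of_isSL (hn : 1 ≤ n) :
    part (k := k) (L := g) 0 ≤ Submodule.span k {z | ∃ x y : g, br (k := k) x y = z} := by
  have : Nonempty (Fin n) := ⟨⟨0, hn⟩⟩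
  set W := Submodule.span k {z | ∃ x y : g, br (k := k) x y = z}
  -- The bracket of two odd elements is an anticommutator: opposite off-diagonal blocks `P`, `Q`
  -- give `diag(PQ, QP)`.
  have h1 : ∀ P Q : Matrix (Fin n) (Fin n) k,
      Matrix.fromBlocks (P * Q) 0 0 (Q * P) ∈ W.map φ := by
    intro P Q
    obtain ⟨p, hp, hp'⟩ := exists_odd_of_upper hrange hpart P
    obtain ⟨q, hq, hq'⟩ := exists_odd_of_lower hrange hpart Q
    refine ⟨br p q, Submodule.subset_span ⟨p, q, rfl⟩, ?_⟩
    rw [hbr 1 1 p q hp hq, hp', hq']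
    simp [koszulSign, Matrix.fromBlocks_multiply, Matrix.fromBlocks_add]
  let ι : Matrix (Fin n) (Fin n) k →ₗ[k] Matrix (Fin n ⊕ Fin n) (Fin n ⊕ Fin n) k :=
    { toFun := fun Z => Matrix.fromBlocks 0 0 0 Z
      map_add' := fun Z Z' => by simp [Matrix.fromBlocks_add]
      map_smul' := fun c Z => by simp [Matrix.fromBlocks_smul] }
  have h2 : ∀ Z : Matrix (Fin n) (Fin n) k, Z.trace = 0 → ι Z ∈ W.map φ := by
    intro Z hZ
    refine Matrix.mem_of_trace_eq_zero ((W.map φ).comap ι) (fun P Q => ?_) hZ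
    -- Passing from the pair `P, Q` to the pair `PQ, 1` keeps the upper block; the difference is the
    -- commutator `QP - PQ` in the lower block.
    have h := Submodule.sub_mem _ (h1 P Q) (h1 (P * Q) 1)
    rw [mul_one, one_mul] at h
    have e : Matrix.fromBlocks (P * Q) 0 0 (Q * P) - Matrix.fromBlocks (P * Q) 0 0 (P * Q) =
        ι (Q * P - P * Q) := by
      ext (i | i) (j | j) <;> simp [ι]
    rw [e] at h
    exact h
  intro x hx
  have htr : supertrace k n (φ x) = 0 := by
    have : φ x ∈ Set.range φ := ⟨x, rfl⟩
    rwa [hrange] at this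
  -- `diag(P, Q) = diag(P, P) + diag(0, Q - P)`, where `Q - P` has trace zero.
  have h3 := Submodule.add_mem _ (h1 (φ x).toBlocks₁₁ 1)
    (h2 ((φ x).toBlocks₂₂ - (φ x).toBlocks₁₁) (by
      rw [Matrix.trace_sub, ← neg_eq_zero, neg_sub]; exact htr))
  have e : Matrix.fromBlocks ((φ x).toBlocks₁₁ * 1) 0 0 (1 * (φ x).toBlocks₁₁) +
      ι ((φ x).toBlocks₂₂ - (φ x).toBlocks₁₁) = φ x := by
    rw [eq_fromBlocks_of_even hpart hx]
    ext (i | i) (j | j) <;> simp [ι]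
  rw [e] at h3
  obtain ⟨y, hy, hyx⟩ := h3
  exact hinj hyx ▸ hy

omit hinj in
/-- The odd part of `sl(n,n)` is reducible. -/
lemma not_isIrreducible_of_isSL [CharZero k] (hn : 1 ≤ n) :
    ¬ LieModule.IsIrreducible k (evenPart k g) (oddPart k g) := by
  intro hirr
  let U : LieSubmodule k (evenPart k g) (oddPart k g) :=
    { carrier := {y | (φ (y : g)).toBlocks₂₁ = 0}
      add_mem' := by
        intro a b ha hb
        ext i j
        have ha' := congrFun (congrFun ha i) j
        have hb' := congrFun (congrFun hb i) j
        simp only [Matrix.toBlocks₂₁, Matrix.of_apply, Matrix.zero_apply] at ha' hb' ⊢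
        simp [ha', hb']
      zero_mem' := by ext i j; simp [Matrix.toBlocks₂₁]
      smul_mem' := by
        intro c a ha
        ext i j
        have ha' := congrFun (congrFun ha i) j
        simp only [Matrix.toBlocks₂₁, Matrix.of_apply, Matrix.zero_apply] at ha' ⊢
        simp [ha']
      lie_mem := by
        intro x y hy
        change (φ (y : g)).toBlocks₂₁ = 0 at hy
        change (φ (br (k := k) (x : g) (y : g))).toBlocks₂₁ = 0
        have hodd : (φ (y : g)).toBlocks₁₁ = 0 ∧ (φ (y : g)).toBlocks₂₂ = 0 := by
          simpa [matrixPart] using hpart 1 _ y.2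
        have e : φ (y : g) = Matrix.fromBlocks 0 (φ (y : g)).toBlocks₁₂ 0 0 := by
          conv_lhs => rw [← Matrix.fromBlocks_toBlocks (φ (y : g)), hodd.1, hodd.2, hy]
        rw [hbr 0 1 _ _ x.2 y.2, eq_fromBlocks_of_even hpart x.2, e]
        ext i j
        simp [koszulSign, Matrix.fromBlocks_multiply, Matrix.toBlocks₂₁] }
  have hU : ∀ y : oddPart k g, y ∈ U ↔ (φ (y : g)).toBlocks₂₁ = 0 := fun y => Iff.rfl
  have : Nonempty (Fin n) := ⟨⟨0, hn⟩⟩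
  rcases hirr.eq_bot_or_eq_top U with h | h
  · obtain ⟨x, hx, hx'⟩ := exists_odd_of_upper hrange hpart (1 : Matrix (Fin n) (Fin n) k)
    have hxU : (⟨x, hx⟩ : oddPart k g) ∈ U := by rw [hU, hx']; simp
    rw [h, LieSubmodule.mem_bot] at hxU
    have h0 : x = 0 := congrArg Subtype.val hxU
    rw [h0, map_zero] at hx'
    have := congrArg Matrix.toBlocks₁₂ hx'
    rw [Matrix.toBlocks_fromBlocks₁₂] at this
    exact one_ne_zero this.symm
  · obtain ⟨x, hx, hx'⟩ := exists_odd_of_lower hrange hpart (1 : Matrix (Fin n) (Fin n) k)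
    have hxU : (⟨x, hx⟩ : oddPart k g) ∈ U := by rw [h]; trivial
    rw [hU, hx', Matrix.toBlocks_fromBlocks₂₁] at hxU
    exact one_ne_zero hxU

end

end SL

end LieSuperalgebra

/-! ### General facts on brackets with even elements -/

namespace LieSuperalgebra

section General

variable {k g : Type*} [Field k] [AddCommGroup g] [Module k g] [LieSuperalgebra k g]

lemma exists_even_add_odd (x : g) :
    ∃ y ∈ part (k := k) (L := g) 0, ∃ z ∈ part (k := k) (L := g) 1, y + z = x := by
  have hx : x ∈ part (k := k) (L := g) 0 ⊔ part (k := k) (L := g) 1 := by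
    rw [(isCompl (k := k) (L := g)).sup_eq_top]; trivial
  obtain ⟨y, hy, z, hz, h⟩ := Submodule.mem_sup.mp hx
  exact ⟨y, hy, z, hz, h⟩

lemma br_even_left_skew {j : ZMod 2} {x y : g} (hx : x ∈ part (k := k) (L := g) 0)
    (hy : y ∈ part (k := k) (L := g) j) : br (k := k) x y = -br (k := k) y x := by
  simpa [koszulSign] using br_skew 0 j x y hx hy

/-- Even elements cause no signs, so `ad x` is an ordinary derivation, also on inhomogeneous
elements. -/
lemma jacobi_even {x : g} (hx : x ∈ part (k := k) (L := g) 0) (y z : g) :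
    br (k := k) x (br (k := k) y z) =
      br (k := k) (br (k := k) x y) z + br (k := k) y (br (k := k) x z) := by
  obtain ⟨y0, hy0, y1, hy1, rfl⟩ := exists_even_add_odd (k := k) y
  obtain ⟨z0, hz0, z1, hz1, rfl⟩ := exists_even_add_odd (k := k) z
  have h00 := jacobi 0 0 0 x y0 z0 hx hy0 hz0
  have h01 := jacobi 0 0 1 x y0 z1 hx hy0 hz1
  have h10 := jacobi 0 1 0 x y1 z0 hx hy1 hz0
  have h11 := jacobi 0 1 1 x y1 z1 hx hy1 hz1
  simp only [koszulSign, zero_ne_one, false_and, if_false, one_smul] at h00 h01 h10 h11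
  simp only [map_add, LinearMap.add_apply, h00, h01, h10, h11]
  abel

/-- A subspace spanned by homogeneous elements is graded. -/
lemma mem_graded_of_mem_part {M : Type*} [AddCommGroup M] [Module k M]
    {p : ZMod 2 → Submodule k M} {W : Submodule k M} {i : ZMod 2} {w : M} (hw : w ∈ W)
    (hi : w ∈ p i) : w ∈ (W ⊓ p 0) ⊔ (W ⊓ p 1) := by
  rcases (by decide : ∀ i : ZMod 2, i = 0 ∨ i = 1) i with rfl | rfl
  · exact Submodule.mem_sup_left ⟨hw, hi⟩
  · exact Submodule.mem_sup_right ⟨hw, hi⟩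

/-- Makes simplicity of `g` applicable to `[g, g]`, which is spanned by brackets of homogeneous
elements. -/
lemma isGradedSubspace_span_br :
    IsGradedSubspace (part (k := k) (L := g)) (Submodule.span k {z | ∃ x y : g, br (k := k) x y = z}) := by
  refine Submodule.span_le.mpr ?_
  rintro _ ⟨x, y, rfl⟩
  obtain ⟨y0, hy0, y1, hy1, rfl⟩ := exists_even_add_odd (k := k) y
  obtain ⟨x0, hx0, x1, hx1, rfl⟩ := exists_even_add_odd (k := k) x
  have hW : ∀ x y : g, br (k := k) x y ∈ Submodule.span k {z | ∃ x y : g, br (k := k) x y = z} :=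
    fun x y => Submodule.subset_span ⟨x, y, rfl⟩
  rw [map_add, map_add, LinearMap.add_apply, LinearMap.add_apply]
  exact add_mem
    (add_mem (mem_graded_of_mem_part (hW _ _) (br_mem _ _ _ _ hx0 hy0))
      (mem_graded_of_mem_part (hW _ _) (br_mem _ _ _ _ hx1 hy0)))
    (add_mem (mem_graded_of_mem_part (hW _ _) (br_mem _ _ _ _ hx0 hy1))
      (mem_graded_of_mem_part (hW _ _) (br_mem _ _ _ _ hx1 hy1)))

variable [CharZero k]

/-- Diagonalizability of `ad x` on `g`, from the even and the odd part. -/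
lemma iSup_eigenspace_br_eq_top {x : evenPart k g}
    (h0 : ⨆ μ : k, Module.End.eigenspace (LieAlgebra.ad k (evenPart k g) x) μ = ⊤)
    (h1 : ⨆ μ : k, Module.End.eigenspace (LieModule.toEnd k (evenPart k g) (oddPart k g) x) μ = ⊤) :
    ⨆ μ : k, Module.End.eigenspace (br (k := k) (x : g)) μ = ⊤ := by
  rw [eq_top_iff]
  intro y _
  obtain ⟨y0, hy0, y1, hy1, rfl⟩ := exists_even_add_odd (k := k) y
  refine add_mem ?_ ?_
  · have hm : (⟨y0, hy0⟩ : evenPart k g) ∈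
        ⨆ μ : k, Module.End.eigenspace (LieAlgebra.ad k (evenPart k g) x) μ := by rw [h0]; trivial
    have hle : (⨆ μ : k, Module.End.eigenspace (LieAlgebra.ad k (evenPart k g) x) μ) ≤
        (⨆ μ : k, Module.End.eigenspace (br (k := k) (x : g)) μ).comap (evenPart k g).subtype := by
      refine iSup_le fun μ y hy => ?_
      refine Submodule.mem_iSup_of_mem
        (p := fun μ : k => Module.End.eigenspace (br (k := k) (x : g)) μ) μ ?_
      rw [Module.End.mem_eigenspace_iff] at hy ⊢
      exact congrArg (fun q : evenPart k g => (q : g)) hy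
    exact hle hm
  · have hm : (⟨y1, hy1⟩ : oddPart k g) ∈
        ⨆ μ : k, Module.End.eigenspace (LieModule.toEnd k (evenPart k g) (oddPart k g) x) μ := by
      rw [h1]; trivial
    have hle : (⨆ μ : k, Module.End.eigenspace
          (LieModule.toEnd k (evenPart k g) (oddPart k g) x) μ) ≤
        (⨆ μ : k, Module.End.eigenspace (br (k := k) (x : g)) μ).comap (oddPart k g).subtype := by
      refine iSup_le fun μ y hy => ?_
      refine Submodule.mem_iSup_of_mem
        (p := fun μ : k => Module.End.eigenspace (br (k := k) (x : g)) μ) μ ?_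
      rw [Module.End.mem_eigenspace_iff] at hy ⊢
      exact congrArg (fun q : oddPart k g => (q : g)) hy
    exact hle hm

end General

/-! ### Cartan subalgebras of the even part of `sl(n,n)` -/

section SL

variable {k g : Type*} [Field k] [CharZero k] [IsAlgClosed k] [AddCommGroup g] [Module k g]
  [LieSuperalgebra k g] {n : ℕ}

omit [CharZero k] [IsAlgClosed k] in
lemma finiteDimensional_of_isSL (h : IsSL k n g) : FiniteDimensional k g := by
  obtain ⟨φ, hinj, -⟩ := h
  exact Module.Finite.of_injective φ hinj

section Natural

variable {φ : g →ₗ[k] Matrix (Fin n ⊕ Fin n) (Fin n ⊕ Fin n) k}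
  (hbr : ∀ (i j : ZMod 2) (x y : g), x ∈ part (k := k) i → y ∈ part (k := k) j →
      φ (br (k := k) x y) = φ x * φ y - koszulSign i j • (φ y * φ x))

/-- The natural representation of the even part of `sl(n,n)` on column vectors. -/
@[reducible] def slNaturalRing : LieRingModule (evenPart k g) (Fin n ⊕ Fin n → k) where
  bracket x m := (φ (x : g)).mulVec m
  add_lie x y m := by
    change (φ ((x : g) + (y : g))).mulVec m = _
    rw [map_add, Matrix.add_mulVec]
  lie_add x m m' := Matrix.mulVec_add _ _ _
  leibniz_lie x y m := by
    change (φ (x : g)).mulVec ((φ (y : g)).mulVec m) =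
      (φ (br (k := k) (x : g) (y : g))).mulVec m + (φ (y : g)).mulVec ((φ (x : g)).mulVec m)
    rw [hbr 0 0 _ _ x.2 y.2]
    simp [koszulSign, Matrix.sub_mulVec]

omit [IsAlgClosed k] in
lemma slNatural : letI := slNaturalRing hbr
    LieModule k (evenPart k g) (Fin n ⊕ Fin n → k) :=
  letI := slNaturalRing hbr
  { smul_lie := fun c x m => by
      change (φ (c • (x : g))).mulVec m = c • (φ (x : g)).mulVec m
      rw [map_smul, Matrix.smul_mulVec]
    lie_smul := fun c x m => Matrix.mulVec_smul _ _ _ }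

variable (hrange : Set.range φ = {X | supertrace k n X = 0})
  (hpart : ∀ (i : ZMod 2) (x : g), x ∈ part (k := k) i → φ x ∈ matrixPart k n i)
include hrange hpart

omit [IsAlgClosed k] in
/-- The natural representation of `sl(n,n)` is the sum of two irreducible modules of its even
part. -/
lemma sSup_atoms_slNatural : letI := slNaturalRing hbr; have := slNatural hbr
    sSup {N : LieSubmodule k (evenPart k g) (Fin n ⊕ Fin n → k) | IsAtom N} = ⊤ := by
  let _ := slNaturalRing hbr
  have := slNatural hbr
  have hact : ∀ (x : evenPart k g) (m : Fin n ⊕ Fin n → k), ⁅x, m⁆ = (φ (x : g)).mulVec m :=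
    fun _ _ => rfl
  have hform : ∀ x : evenPart k g, ∀ m : Fin n ⊕ Fin n → k, ⁅x, m⁆ =
      Sum.elim ((φ (x : g)).toBlocks₁₁.mulVec (m ∘ Sum.inl))
        ((φ (x : g)).toBlocks₂₂.mulVec (m ∘ Sum.inr)) := by
    intro x m
    rw [hact]
    conv_lhs => rw [eq_fromBlocks_of_even hpart x.2, Matrix.fromBlocks_mulVec]
    simp
  let U1 : LieSubmodule k (evenPart k g) (Fin n ⊕ Fin n → k) :=
    { carrier := {m | m ∘ Sum.inr = 0}
      add_mem' := fun {a b} ha hb => by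
        ext i; have := congrFun ha i; have := congrFun hb i; simp_all
      zero_mem' := rfl
      smul_mem' := fun c a ha => by ext i; have := congrFun ha i; simp_all
      lie_mem := by
        intro x m hm
        change m ∘ Sum.inr = 0 at hm
        change ⁅x, m⁆ ∘ Sum.inr = 0
        rw [hform, hm]; simp }
  let U2 : LieSubmodule k (evenPart k g) (Fin n ⊕ Fin n → k) :=
    { carrier := {m | m ∘ Sum.inl = 0}
      add_mem' := fun {a b} ha hb => by
        ext i; have := congrFun ha i; have := congrFun hb i; simp_all
      zero_mem' := rfl
      smul_mem' := fun c a ha => by ext i; have := congrFun ha i; simp_all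
      lie_mem := by
        intro x m hm
        change m ∘ Sum.inl = 0 at hm
        change ⁅x, m⁆ ∘ Sum.inl = 0
        rw [hform, hm]; simp }
  have hU1 : ∀ m, m ∈ U1 ↔ m ∘ Sum.inr = 0 := fun m => Iff.rfl
  have hU2 : ∀ m, m ∈ U2 ↔ m ∘ Sum.inl = 0 := fun m => Iff.rfl
  have htrans : ∀ u w : Fin n → k, u ≠ 0 → ∃ P : Matrix (Fin n) (Fin n) k, P.mulVec u = w := by
    intro u w hu
    obtain ⟨i, hi⟩ := Function.ne_iff.mp hu
    refine ⟨Matrix.vecMulVec w (Pi.single i (u i)⁻¹), ?_⟩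
    ext j
    simp [Matrix.vecMulVec_mulVec, show u i ≠ 0 from hi]
  -- A nonzero vector of a summand generates it, because `diag(P, P)` has supertrace zero for every
  -- `P`.
  have key1 : ∀ N : LieSubmodule k (evenPart k g) (Fin n ⊕ Fin n → k), ∀ m ∈ N, m ∈ U1 → m ≠ 0 →
      U1 ≤ N := by
    intro N m hm hm1 hm0 w hw
    have hne : m ∘ Sum.inl ≠ 0 := by
      intro h; apply hm0; ext (i | i)
      · exact congrFun h i
      · exact congrFun hm1 i
    obtain ⟨P, hP⟩ := htrans _ (w ∘ Sum.inl) hne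
    obtain ⟨x, hx, hx'⟩ := exists_even_of_diagonal hrange hpart P P rfl
    have := N.lie_mem (x := ⟨x, hx⟩) hm
    rw [hform, hx', Matrix.toBlocks_fromBlocks₁₁, Matrix.toBlocks_fromBlocks₂₂, hP,
      (hU1 m).mp hm1] at this
    have e : w = Sum.elim (w ∘ Sum.inl) (P.mulVec 0) := by
      ext (i | i)
      · rfl
      · simpa using congrFun hw i
    exact e ▸ this
  have key2 : ∀ N : LieSubmodule k (evenPart k g) (Fin n ⊕ Fin n → k), ∀ m ∈ N, m ∈ U2 → m ≠ 0 →
      U2 ≤ N := by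
    intro N m hm hm1 hm0 w hw
    have hne : m ∘ Sum.inr ≠ 0 := by
      intro h; apply hm0; ext (i | i)
      · exact congrFun hm1 i
      · exact congrFun h i
    obtain ⟨P, hP⟩ := htrans _ (w ∘ Sum.inr) hne
    obtain ⟨x, hx, hx'⟩ := exists_even_of_diagonal hrange hpart P P rfl
    have := N.lie_mem (x := ⟨x, hx⟩) hm
    rw [hform, hx', Matrix.toBlocks_fromBlocks₁₁, Matrix.toBlocks_fromBlocks₂₂, hP,
      (hU2 m).mp hm1] at this
    have e : w = Sum.elim (P.mulVec 0) (w ∘ Sum.inr) := by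
      ext (i | i)
      · simpa using congrFun hw i
      · rfl
    exact e ▸ this
  have hle : ∀ U : LieSubmodule k (evenPart k g) (Fin n ⊕ Fin n → k),
      (∀ N : LieSubmodule k (evenPart k g) (Fin n ⊕ Fin n → k), ∀ m ∈ N, m ∈ U → m ≠ 0 → U ≤ N) →
      U ≤ sSup {N : LieSubmodule k (evenPart k g) (Fin n ⊕ Fin n → k) | IsAtom N} := by
    intro U hU
    -- For `n = 0` the summands are zero and hence not atoms.
    rcases eq_or_ne U ⊥ with rfl | hbot
    · exact bot_le
    refine le_sSup ⟨hbot, fun N hN => ?_⟩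
    rw [LieSubmodule.eq_bot_iff]
    intro m hm
    by_contra h0
    exact hN.not_ge (hU N m hm (hN.le hm) h0)
  rw [eq_top_iff]
  intro m _
  have hm : m = Sum.elim (m ∘ Sum.inl) (0 : Fin n → k) + Sum.elim (0 : Fin n → k) (m ∘ Sum.inr) := by
    ext (i | i) <;> simp
  rw [hm]
  exact add_mem (hle U1 key1 ((hU1 _).mpr (by simp))) (hle U2 key2 ((hU2 _).mpr (by simp)))

end Natural

/-- The Cartan subalgebras of the even part of `sl(n,n)` act diagonalizably on `sl(n,n)`. -/
lemma iSup_eigenspace_br_eq_top_of_isSL (h : IsSL k n g)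
    (H : LieSubalgebra k (evenPart k g)) (hH : H.IsCartanSubalgebra) {x : evenPart k g}
    (hx : x ∈ H) : ⨆ μ : k, Module.End.eigenspace (br (k := k) (x : g)) μ = ⊤ := by
  have := finiteDimensional_of_isSL h
  obtain ⟨φ, hinj, hrange, hpart, hbr⟩ := h
  let _ := slNaturalRing hbr
  have := slNatural hbr
  have hat := sSup_atoms_slNatural hbr hrange hpart
  have hrad := LieAlgebra.radical_inf_derived_eq_bot (L := evenPart k g) (Fin n ⊕ Fin n → k) hat (by
    intro y hy
    refine Subtype.ext (hinj ?_)
    rw [ZeroMemClass.coe_zero, map_zero]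
    apply Matrix.mulVec_injective
    ext1 m
    rw [Matrix.zero_mulVec]
    exact hy m)
  have hss := LieAlgebra.iSup_eigenspace_toEnd_eq_top hat
    (LieAlgebra.iSup_eigenspace_ad_eq_top hrad H hx)
  -- Commutation with a semisimple operator is semisimple on all endomorphisms, and `φ` embeds `ad
  -- x` into it.
  have hss' := LieAlgebra.ad_isSemisimple_of_isSemisimple
    (Module.End.isSemisimple_of_iSup_eigenspace_eq_top hss)
  let Φ : g →ₗ[k] Module.End k (Fin n ⊕ Fin n → k) := Matrix.toLin'.toLinearMap.comp φ
  refine Module.End.iSup_eigenspace_eq_top_of_injective Φ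
    (Matrix.toLin'.injective.comp hinj) (fun y => ?_) hss'
  have hxy : φ (br (k := k) (x : g) y) = φ x * φ y - φ y * φ x := by
    obtain ⟨y0, hy0, y1, hy1, rfl⟩ := exists_even_add_odd (k := k) y
    have h0 := hbr 0 0 _ _ x.2 hy0
    have h1 := hbr 0 1 _ _ x.2 hy1
    simp only [koszulSign, zero_ne_one, false_and, if_false, one_smul] at h0 h1
    rw [map_add, map_add, h0, h1, map_add, mul_add, add_mul]
    abel
  change Matrix.toLin' (φ (br (k := k) (x : g) y)) = _
  rw [hxy, map_sub, Matrix.toLin'_mul, Matrix.toLin'_mul]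
  rfl

end SL

end LieSuperalgebra

/-! ### Basic classical Lie superalgebras: reductivity and inner derivations -/

namespace LieSuperalgebra

section Simple

variable {k g : Type*} [Field k] [CharZero k] [AddCommGroup g] [Module k g] [LieSuperalgebra k g]
  (hs : IsSimple k g)
include hs

omit [CharZero k] in
lemma IsSimple.span_br_eq_top :
    Submodule.span k {z | ∃ x y : g, br (k := k) x y = z} = ⊤ := by
  obtain ⟨⟨x, y, hxy⟩, h⟩ := hs
  rcases h _ isGradedSubspace_span_br
    (fun x y _ => Submodule.subset_span ⟨x, y, rfl⟩) with h | h
  · exact absurd ((Submodule.mem_bot k).mp (h ▸ Submodule.subset_span ⟨x, y, rfl⟩)) hxy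
  · exact h

omit [CharZero k] in
/-- If the odd part is nonzero, then the even part acts faithfully on it. -/
lemma IsSimple.eq_zero_of_br_odd_eq_zero (hodd : oddPart k g ≠ ⊥) {x : g}
    (hx : x ∈ evenPart k g) (h0 : ∀ y ∈ oddPart k g, br (k := k) x y = 0) : x = 0 := by
  let K : Submodule k g :=
    { carrier := {x | x ∈ evenPart k g ∧ ∀ y ∈ oddPart k g, br (k := k) x y = 0}
      add_mem' := fun {a b} ha hb => ⟨add_mem ha.1 hb.1, fun y hy => by
        rw [map_add, LinearMap.add_apply, ha.2 y hy, hb.2 y hy, add_zero]⟩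
      zero_mem' := ⟨zero_mem _, fun y _ => by simp⟩
      smul_mem' := fun c a ha => ⟨Submodule.smul_mem _ c ha.1, fun y hy => by
        rw [map_smul, LinearMap.smul_apply, ha.2 y hy, smul_zero]⟩ }
  have hK : ∀ x, x ∈ K ↔ x ∈ evenPart k g ∧ ∀ y ∈ oddPart k g, br (k := k) x y = 0 :=
    fun x => Iff.rfl
  -- The annihilator of the odd part in the even part is an ideal: odd elements kill it, and even
  -- ones preserve it by the Jacobi identity.
  rcases hs.2 K (fun x hx => Submodule.mem_sup_left ⟨hx, hx.1⟩) (fun y x hx => by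
    obtain ⟨y0, hy0, y1, hy1, rfl⟩ := exists_even_add_odd (k := k) y
    have h1 : br (k := k) y1 x = 0 := by
      have := br_even_left_skew hx.1 hy1
      rw [hx.2 y1 hy1] at this
      exact neg_eq_zero.mp this.symm
    rw [map_add, LinearMap.add_apply, h1, add_zero]
    refine ⟨br_mem 0 0 _ _ hy0 hx.1, fun z hz => ?_⟩
    have := jacobi_even hy0 x z
    have hz' : br (k := k) y0 z ∈ oddPart k g := by
      have := br_mem (k := k) 0 1 y0 z hy0 hz
      rwa [zero_add] at this
    rw [hx.2 z hz, hx.2 _ hz', map_zero, add_zero] at this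
    exact this.symm) with h | h
  · have : x ∈ K := ⟨hx, h0⟩
    rw [h] at this
    exact this
  · exfalso
    apply hodd
    rw [eq_bot_iff, ← (isCompl (k := k) (L := g)).inf_eq_bot]
    intro y hy
    have : y ∈ K := by rw [h]; trivial
    exact ⟨this.1, hy⟩

/-- If the odd part vanishes, then the even part is a simple Lie algebra. -/
lemma IsSimple.isSimple_evenPart (hodd : oddPart k g = ⊥) :
    LieAlgebra.IsSimple k (evenPart k g) := by
  have heven : ∀ x : g, x ∈ evenPart k g := by
    intro x
    obtain ⟨y0, hy0, y1, hy1, rfl⟩ := exists_even_add_odd (k := k) x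
    have : y1 = 0 := by
      have : y1 ∈ oddPart k g := hy1
      rwa [hodd] at this
    rw [this, add_zero]
    exact hy0
  constructor
  · intro I
    rcases hs.2 (I.toSubmodule.map (evenPart k g).subtype)
      (fun x hx => Submodule.mem_sup_left ⟨hx, heven x⟩) (by
        rintro x _ ⟨y, hy, rfl⟩
        exact ⟨⁅(⟨x, heven x⟩ : evenPart k g), y⁆, I.lie_mem hy, rfl⟩) with h | h
    · left
      rw [LieSubmodule.eq_bot_iff]
      intro y hy
      have : (y : g) ∈ I.toSubmodule.map (evenPart k g).subtype := ⟨y, hy, rfl⟩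
      rw [h] at this
      exact Subtype.ext this
    · right
      rw [eq_top_iff]
      intro y _
      have : (y : g) ∈ I.toSubmodule.map (evenPart k g).subtype := by rw [h]; trivial
      obtain ⟨z, hz, hzy⟩ := this
      have : z = y := Subtype.ext hzy
      exact this ▸ hz
  · intro hab
    obtain ⟨x, y, hxy⟩ := hs.1
    exact hxy (congrArg Subtype.val
      (hab.trivial (⟨x, heven x⟩ : evenPart k g) ⟨y, heven y⟩))

end Simple

section Classical

variable {k g : Type*} [Field k] [CharZero k] [IsAlgClosed k] [AddCommGroup g] [Module k g]
  [LieSuperalgebra k g] (hg : IsBasicClassical k g)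
include hg

omit [IsAlgClosed k] in
lemma IsBasicClassical.sSup_atoms_oddPart :
    sSup {N : LieSubmodule k (evenPart k g) (oddPart k g) | IsAtom N} = ⊤ := by
  have := hg.completelyReducible
  have : IsAtomistic (LieSubmodule k (evenPart k g) (oddPart k g)) :=
    complementedLattice_iff_isAtomistic.mp this
  exact sSup_atoms_eq_top

/-- The even part of a basic classical Lie superalgebra is reductive. -/
lemma IsBasicClassical.radical_inf_derived : ∀ x ∈ LieAlgebra.radical k (evenPart k g),
    x ∈ ⁅(⊤ : LieIdeal k (evenPart k g)), (⊤ : LieIdeal k (evenPart k g))⁆ → x = 0 := by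
  have := hg.finiteDimensional
  rcases eq_or_ne (oddPart k g) ⊥ with hodd | hodd
  · have := hg.simple.isSimple_evenPart hodd
    intro x hx _
    rw [LieAlgebra.HasTrivialRadical.radical_eq_bot] at hx
    simpa using hx
  · refine LieAlgebra.radical_inf_derived_eq_bot (oddPart k g) hg.sSup_atoms_oddPart ?_
    intro x hx
    refine Subtype.ext (hg.simple.eq_zero_of_br_odd_eq_zero hodd x.2 fun y hy => ?_)
    exact congrArg Subtype.val (hx ⟨y, hy⟩)

/-- The Cartan subalgebras of the even part of a basic classical Lie superalgebra act
diagonalizably. -/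
lemma IsBasicClassical.iSup_eigenspace_br_eq_top (H : LieSubalgebra k (evenPart k g))
    (hH : H.IsCartanSubalgebra) {x : evenPart k g} (hx : x ∈ H) :
    ⨆ μ : k, Module.End.eigenspace (br (k := k) (x : g)) μ = ⊤ := by
  have := hg.finiteDimensional
  have h0 := LieAlgebra.iSup_eigenspace_ad_eq_top hg.radical_inf_derived H hx
  exact LieSuperalgebra.iSup_eigenspace_br_eq_top h0
    (LieAlgebra.iSup_eigenspace_toEnd_eq_top hg.sSup_atoms_oddPart h0)

/-- If the odd part of a basic classical Lie superalgebra is irreducible, then every even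
derivation that vanishes on the center of the even part is inner. -/
lemma IsBasicClassical.exists_eq_br_of_isIrreducible
    (hirr : LieModule.IsIrreducible k (evenPart k g) (oddPart k g)) (D : g →ₗ[k] g)
    (hD : ∀ i x, x ∈ part (k := k) (L := g) i → D x ∈ part (k := k) (L := g) i)
    (hder : ∀ x y, D (br (k := k) x y) = br (k := k) (D x) y + br (k := k) x (D y))
    (hcen : ∀ x : evenPart k g, (∀ y : evenPart k g, ⁅y, x⁆ = 0) → D x = 0) :
    ∃ z ∈ evenPart k g, ∀ x, D x = br (k := k) z x := by
  have := hg.finiteDimensional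
  have hrad := hg.radical_inf_derived
  set s : LieIdeal k (evenPart k g) :=
    ⁅(⊤ : LieIdeal k (evenPart k g)), (⊤ : LieIdeal k (evenPart k g))⁆ with hs
  have hK : LieAlgebra.IsKilling k s := LieAlgebra.isKilling_derived hrad
  let D0 : evenPart k g →ₗ[k] evenPart k g := D.restrict (hD 0)
  have hD0 : ∀ x : evenPart k g, ((D0 x : evenPart k g) : g) = D x := fun _ => rfl
  have hD0der : ∀ x y : evenPart k g, D0 ⁅x, y⁆ = ⁅D0 x, y⁆ + ⁅x, D0 y⁆ :=
    fun x y => Subtype.ext (hder x y)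
  have hD0s : ∀ x ∈ s.toSubmodule, D0 x ∈ s.toSubmodule := by
    intro x hx
    have hx' := hx
    rw [hs, LieSubmodule.lieIdeal_oper_eq_linear_span'] at hx'
    induction hx' using Submodule.span_induction with
    | mem u hu =>
      obtain ⟨a, -, b, -, rfl⟩ := hu
      rw [hD0der]
      exact add_mem (LieSubmodule.lie_mem_lie trivial trivial)
        (LieSubmodule.lie_mem_lie trivial trivial)
    | zero => simp
    | add u v hu' hv' hu hv =>
      rw [map_add]
      rw [← LieSubmodule.lieIdeal_oper_eq_linear_span'] at hu' hv'
      exact add_mem (hu hu') (hv hv')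
    | smul t u hu' hu =>
      rw [map_smul]
      rw [← LieSubmodule.lieIdeal_oper_eq_linear_span'] at hu'
      exact Submodule.smul_mem _ _ (hu hu')
  let Ds : LieDerivation k s s :=
    { toLinearMap := D0.restrict hD0s
      leibniz' := fun a b => by
        apply Subtype.ext
        have := hD0der a b
        change D0 ⁅(a : evenPart k g), (b : evenPart k g)⁆ =
          ⁅(a : evenPart k g), D0 b⁆ - ⁅(b : evenPart k g), D0 a⁆
        rw [this, ← lie_skew (D0 (a : evenPart k g)) (b : evenPart k g)]
        abel }
  -- Every derivation of the semisimple algebra `[g_0, g_0]` is inner. As `D` kills the centre, it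
  -- agrees with `ad z` on the whole even part.
  obtain ⟨z, hz⟩ := LieDerivation.IsKilling.exists_eq_ad Ds
  have hzs : ∀ x ∈ s, D0 x = ⁅(z : evenPart k g), x⁆ := by
    intro x hx
    have := congrArg (fun E : LieDerivation k s s => ((E ⟨x, hx⟩ : s) : evenPart k g)) hz
    simp only [LieDerivation.ad_apply_apply] at this
    exact this.symm
  have hz0 : ∀ x : evenPart k g, D0 x = ⁅(z : evenPart k g), x⁆ := by
    intro x
    obtain ⟨t, ht, c, hc, rfl⟩ := LieAlgebra.exists_derived_add_central hrad x
    have hc0 : D0 c = 0 := Subtype.ext (hcen c hc)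
    rw [map_add, hzs t ht, hc0, lie_add, hc]
  -- On the odd part `D - ad z` commutes with the even part, so it is a scalar `c` by Schur's lemma.
  let E : Module.End k (oddPart k g) :=
    (D.restrict (hD 1) : oddPart k g →ₗ[k] oddPart k g) - LieModule.toEnd k (evenPart k g) (oddPart k g) (z : evenPart k g)
  have hE : ∀ y : oddPart k g, ((E y : oddPart k g) : g) = D y - br (k := k) (z : g) (y : g) :=
    fun _ => rfl
  have hEcomm : ∀ (x : evenPart k g) (y : oddPart k g), E ⁅x, y⁆ = ⁅x, E y⁆ := by
    intro x y
    apply Subtype.ext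
    have h1 := congrArg Subtype.val (hz0 x)
    have h2 := jacobi_even (k := k) (z : evenPart k g).2 (x : g) (y : g)
    have h3 := hder x y
    rw [hE, coe_lie_odd, coe_lie_odd, hE, map_sub]
    rw [hD0, coe_lie_even] at h1
    rw [h2, h3, h1]
    abel
  have := LieModule.nontrivial_of_isIrreducible k (evenPart k g) (oddPart k g)
  obtain ⟨c, hc⟩ := Module.End.exists_eigenvalue E
  let N : LieSubmodule k (evenPart k g) (oddPart k g) :=
    { toSubmodule := E.eigenspace c
      lie_mem := by
        intro x y hy
        change y ∈ E.eigenspace c at hy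
        change ⁅x, y⁆ ∈ E.eigenspace c
        rw [Module.End.mem_eigenspace_iff] at *
        rw [hEcomm, hy, lie_smul] }
  have hN : N = ⊤ := by
    refine (hirr.eq_bot_or_eq_top N).resolve_left fun h => hc ?_
    exact congrArg LieSubmodule.toSubmodule h
  have hEc : ∀ y : oddPart k g, E y = c • y := by
    intro y
    have : y ∈ N := by rw [hN]; trivial
    exact Module.End.mem_eigenspace_iff.mp this
  have hDodd : ∀ y ∈ oddPart k g, D y = br (k := k) (z : g) y + c • y := by
    intro y hy
    have := congrArg Subtype.val (hEc ⟨y, hy⟩)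
    rw [hE] at this
    rw [sub_eq_iff_eq_add] at this
    rw [this, add_comm]
    rfl
  have hDeven : ∀ x ∈ evenPart k g, D x = br (k := k) (z : g) x :=
    fun x hx => congrArg Subtype.val (hz0 ⟨x, hx⟩)
  -- On a bracket of two odd elements, which is even, `D` is `ad z`, but the Leibniz rule gives `ad
  -- z + 2c`. If `c ≠ 0`, all these brackets vanish and the odd part is an ideal, against
  -- simplicity.
  have hc0 : c = 0 := by
    by_contra hc0
    have hoo : ∀ y ∈ oddPart k g, ∀ y' ∈ oddPart k g, br (k := k) y y' = 0 := by
      intro y hy y' hy'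
      have h1 := hder y y'
      rw [hDeven _ (br_mem 1 1 _ _ hy hy'), hDodd y hy, hDodd y' hy',
        jacobi_even (z : evenPart k g).2] at h1
      have h2 : ((2 : k) * c) • br (k := k) y y' = 0 := by
        rw [mul_smul, two_smul]
        simp only [map_add, LinearMap.add_apply, map_smul, LinearMap.smul_apply] at h1
        have := sub_eq_zero.mpr h1
        rw [← neg_eq_zero, ← this]
        abel
      exact (smul_eq_zero.mp h2).resolve_left (mul_ne_zero two_ne_zero hc0)
    have heo : ∀ x : g, ∀ y ∈ oddPart k g, br (k := k) x y ∈ oddPart k g := by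
      intro x y hy
      obtain ⟨x0, hx0, x1, hx1, rfl⟩ := exists_even_add_odd (k := k) x
      rw [map_add, LinearMap.add_apply, hoo x1 hx1 y hy, add_zero]
      have := br_mem (k := k) 0 1 x0 y hx0 hy
      rwa [zero_add] at this
    rcases hg.simple.2 (oddPart k g) (fun x hx => Submodule.mem_sup_right ⟨hx, hx⟩) heo with h | h
    · obtain ⟨y, hy⟩ := exists_ne (0 : oddPart k g)
      have : (y : g) ∈ (⊥ : Submodule k g) := h ▸ y.2
      exact hy (Subtype.ext this)
    · obtain ⟨x, y, hxy⟩ := hg.simple.1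
      exact hxy (hoo x (h ▸ trivial) y (h ▸ trivial))
  refine ⟨z, (z : evenPart k g).2, fun x => ?_⟩
  obtain ⟨x0, hx0, x1, hx1, rfl⟩ := exists_even_add_odd (k := k) x
  rw [map_add, map_add, hDeven x0 hx0, hDodd x1 hx1, hc0, zero_smul, add_zero]

end Classical

end LieSuperalgebra

/-! ### The degree derivation, and the structural properties of `g` -/

namespace LieSuperalgebra

namespace TriangularDecomposition

variable {k g : Type*} [Field k] [CharZero k] [AddCommGroup g] [Module k g] [LieSuperalgebra k g]
  (T : TriangularDecomposition k g)

lemma h_le_deg_zero : T.h ≤ T.deg 0 := by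
  rintro _ ⟨y, hy, rfl⟩
  exact T.cartan_le_deg_zero y hy

lemma h_le_even : T.h ≤ part (k := k) (L := g) 0 := by
  rintro _ ⟨y, hy, rfl⟩
  exact y.2

lemma d_mem_h : (T.d : g) ∈ T.h := ⟨T.d, T.d_mem, rfl⟩

/-- The regular element as an element of `h`. -/
def dh : T.h := ⟨T.d, T.d_mem_h⟩

lemma mem_h_of_br_d_eq_zero {x : g} (hx : x ∈ T.deg 0) (h : br (k := k) (T.d : g) x = 0) :
    x ∈ T.h :=
  ⟨⟨x, by have := T.deg_le_part 0 hx; rwa [Int.cast_zero] at this⟩, T.d_regular ⟨x, _⟩ hx h, rfl⟩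

lemma iSup_deg : ⨆ i, T.deg i = ⊤ := T.deg_isInternal.submodule_iSup_eq_top

/-- The derivation of `g` that multiplies the piece of degree `i` by `i`. -/
lemma exists_degree_map : ∃ D : g →ₗ[k] g, ∀ i, ∀ x ∈ T.deg i, D x = (i : k) • x := by
  classical
  let e := LinearEquiv.ofBijective (DirectSum.coeLinearMap T.deg) T.deg_isInternal
  let F : (DirectSum ℤ fun i => T.deg i) →ₗ[k] g :=
    DirectSum.toModule k ℤ g fun i => (i : k) • (T.deg i).subtype
  refine ⟨F ∘ₗ e.symm.toLinearMap, fun i x hx => ?_⟩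
  have : e.symm x = DirectSum.lof k ℤ (fun i => T.deg i) i ⟨x, hx⟩ := by
    rw [LinearEquiv.symm_apply_eq]
    exact (DirectSum.coeLinearMap_lof T.deg i ⟨x, hx⟩).symm
  simp [this, F]

lemma degree_map_br {D : g →ₗ[k] g} (hD : ∀ i, ∀ x ∈ T.deg i, D x = (i : k) • x) (x y : g) :
    D (br (k := k) x y) = br (k := k) (D x) y + br (k := k) x (D y) := by
  have hx : x ∈ ⨆ i, T.deg i := by rw [T.iSup_deg]; trivial
  have hy : y ∈ ⨆ i, T.deg i := by rw [T.iSup_deg]; trivial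
  induction hx using Submodule.iSup_induction' with
  | mem i x hx =>
    induction hy using Submodule.iSup_induction' with
    | mem j y hy =>
      rw [hD _ _ hx, hD _ _ hy, hD _ _ (T.deg_br_mem i j x y hx hy)]
      simp [add_smul]
    | zero => simp
    | add y y' _ _ hy hy' => simp only [map_add, hy, hy']; abel
  | zero => simp
  | add x x' _ _ hx hx' => simp only [map_add, LinearMap.add_apply, hx, hx']; abel

lemma degree_map_mem_part {D : g →ₗ[k] g} (hD : ∀ i, ∀ x ∈ T.deg i, D x = (i : k) • x)
    (j : ZMod 2) {x : g} (hx : x ∈ part (k := k) (L := g) j) : D x ∈ part (k := k) (L := g) j := by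
  have key : ∀ x : g, ∃ y ∈ part (k := k) (L := g) 0, ∃ z ∈ part (k := k) (L := g) 1,
      y + z = x ∧ D y ∈ part (k := k) (L := g) 0 ∧ D z ∈ part (k := k) (L := g) 1 := by
    intro x
    have hx : x ∈ ⨆ i, T.deg i := by rw [T.iSup_deg]; trivial
    induction hx using Submodule.iSup_induction' with
    | mem i x hx =>
      have hp := T.deg_le_part i hx
      rcases (by decide : ∀ i : ZMod 2, i = 0 ∨ i = 1) (i : ZMod 2) with h | h
      · rw [h] at hp
        refine ⟨x, hp, 0, zero_mem _, add_zero _, ?_, by simp⟩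
        rw [hD i x hx]
        exact Submodule.smul_mem _ _ hp
      · rw [h] at hp
        refine ⟨0, zero_mem _, x, hp, zero_add _, by simp, ?_⟩
        rw [hD i x hx]
        exact Submodule.smul_mem _ _ hp
    | zero => exact ⟨0, zero_mem _, 0, zero_mem _, by simp⟩
    | add x x' _ _ hx hx' =>
      obtain ⟨y, hy, z, hz, rfl, h1, h2⟩ := hx
      obtain ⟨y', hy', z', hz', rfl, h1', h2'⟩ := hx'
      refine ⟨y + y', add_mem hy hy', z + z', add_mem hz hz', by abel, ?_, ?_⟩
      · rw [map_add]; exact add_mem h1 h1'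
      · rw [map_add]; exact add_mem h2 h2'
  obtain ⟨y, hy, z, hz, rfl, h1, h2⟩ := key x
  have hc := (isCompl (k := k) (L := g)).disjoint
  rcases (by decide : ∀ i : ZMod 2, i = 0 ∨ i = 1) j with rfl | rfl
  · have hz0 : z = 0 := by
      have : z ∈ part (k := k) (L := g) 0 := by simpa using sub_mem hx hy
      exact Submodule.disjoint_def.mp hc z this hz
    rw [hz0, add_zero]; exact h1
  · have hy0 : y = 0 := by
      have : y ∈ part (k := k) (L := g) 1 := by simpa using sub_mem hx hz
      exact Submodule.disjoint_def.mp hc y hy this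
    rw [hy0, zero_add]; exact h2

/-- The structural properties of a triangular decomposition of a basic classical Lie superalgebra
or of `sl(n,n)` that govern its highest weight modules. -/
structure IsSplit : Prop where
  finiteDimensional : FiniteDimensional k g
  iSup_eigenspace : ∀ x ∈ T.h, ⨆ μ : k, Module.End.eigenspace (br (k := k) (x : g)) μ = ⊤
  br_h : ∀ x ∈ T.h, ∀ y ∈ T.h, br (k := k) x y = 0
  h_le_span_br : T.h ≤ Submodule.span k {z | ∃ x y : g, br (k := k) x y = z}
  inner : (∀ i, 1 < |i| → T.deg i = ⊥) ∨
    ∃ z ∈ T.h, ∀ i, ∀ x ∈ T.deg i, br (k := k) z x = (i : k) • x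

/-- Elements of `h` that act diagonalizably commute, since `h` is nilpotent. -/
lemma br_h_eq_zero [FiniteDimensional k g]
    (hd : ∀ x ∈ T.h, ⨆ μ : k, Module.End.eigenspace (br (k := k) (x : g)) μ = ⊤) :
    ∀ x ∈ T.h, ∀ y ∈ T.h, br (k := k) x y = 0 := by
  rintro _ ⟨x, hx, rfl⟩ _ ⟨y, hy, rfl⟩
  have := T.isCartan
  obtain ⟨n, hn⟩ := LieModule.exists_forall_pow_toEnd_eq_zero k T.cartan T.cartan
  have h1 := congrArg (fun f => f ⟨y, hy⟩) (hn ⟨x, hx⟩)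
  have h2 : ∀ m : ℕ, ∀ w : T.cartan,
      ((((LieModule.toEnd k T.cartan T.cartan ⟨x, hx⟩) ^ m) w : T.cartan) : evenPart k g) =
        (((LieAlgebra.ad k (evenPart k g) x) ^ m) (w : evenPart k g)) := by
    intro m
    induction m with
    | zero => intro w; rfl
    | succ m ih =>
      intro w
      rw [pow_succ, pow_succ, Module.End.mul_apply, Module.End.mul_apply, ih]
      rfl
  have h3 : ∀ m : ℕ, ∀ w : evenPart k g,
      ((((LieAlgebra.ad k (evenPart k g) x) ^ m) w : evenPart k g) : g) =
        ((br (k := k) (x : g)) ^ m) (w : g) := by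
    intro m
    induction m with
    | zero => intro w; rfl
    | succ m ih =>
      intro w
      rw [pow_succ, pow_succ, Module.End.mul_apply, Module.End.mul_apply, ih]
      rfl
  have h4 : ((br (k := k) (x : g)) ^ n) (y : g) = 0 := by
    rw [← h3, ← h2 n ⟨y, hy⟩]
    have := congrArg (fun w : T.cartan => ((w : evenPart k g) : g)) h1
    simpa using this
  -- `ad x` is nilpotent on the nilpotent algebra `h`, and it is semisimple, so it vanishes there.
  have hss : Module.End.IsSemisimple (br (k := k) (x : g)) :=
    Module.End.isSemisimple_of_iSup_eigenspace_eq_top (hd _ ⟨x, hx, rfl⟩)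
  have h5 : (y : g) ∈ Module.End.maxGenEigenspace (br (k := k) (x : g)) 0 := by
    rw [Module.End.mem_maxGenEigenspace]
    exact ⟨n, by simpa using h4⟩
  rw [hss.isFinitelySemisimple.maxGenEigenspace_eq_eigenspace, Module.End.mem_eigenspace_iff,
    zero_smul] at h5
  exact h5

variable [IsAlgClosed k]

/-- The odd part is reducible, so the grading has no pieces of degree `± 2`: the first alternative
of `inner`. -/
lemma isSplit_of_isSL {n : ℕ} (hn : 1 ≤ n) (hg : IsSL k n g) : T.IsSplit := by
  have hfin := finiteDimensional_of_isSL hg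
  have hd : ∀ x ∈ T.h, ⨆ μ : k, Module.End.eigenspace (br (k := k) (x : g)) μ = ⊤ := by
    rintro _ ⟨x, hx, rfl⟩
    exact iSup_eigenspace_br_eq_top_of_isSL hg T.cartan T.isCartan hx
  obtain ⟨φ, hinj, hrange, hpart, hbr⟩ := hg
  exact ⟨hfin, hd, T.br_h_eq_zero hd,
    T.h_le_even.trans (even_le_span_br_of_isSL hinj hrange hpart hbr hn),
    Or.inl (T.deg_eq_bot_of_not_irreducible (not_isIrreducible_of_isSL hrange hpart hbr hn))⟩

/-- If the odd part is irreducible, the degree derivation is inner: it vanishes in degree zero,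
hence on the centre of the even part, which lies in the Cartan subalgebra. Otherwise there are no
pieces of degree `± 2`. -/
lemma isSplit_of_isBasicClassical (hg : IsBasicClassical k g) : T.IsSplit := by
  have hfin := hg.finiteDimensional
  have hd : ∀ x ∈ T.h, ⨆ μ : k, Module.End.eigenspace (br (k := k) (x : g)) μ = ⊤ := by
    rintro _ ⟨x, hx, rfl⟩
    exact hg.iSup_eigenspace_br_eq_top T.cartan T.isCartan hx
  refine ⟨hfin, hd, T.br_h_eq_zero hd, by rw [hg.simple.span_br_eq_top]; exact le_top, ?_⟩
  by_cases hirr : LieModule.IsIrreducible k (evenPart k g) (oddPart k g)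
  · right
    obtain ⟨D, hD⟩ := T.exists_degree_map
    have hDh : ∀ x ∈ T.deg 0, D x = 0 := fun x hx => by simpa using hD 0 x hx
    obtain ⟨z, hz, hDz⟩ := hg.exists_eq_br_of_isIrreducible hirr D
      (fun i x hx => T.degree_map_mem_part hD i hx) (T.degree_map_br hD) (by
        intro x hx
        refine hDh x (T.cartan_le_deg_zero x ?_)
        rw [← T.isCartan.self_normalizing, LieSubalgebra.mem_normalizer_iff]
        intro y _
        rw [← lie_skew, hx y, neg_zero]
        exact T.cartan.zero_mem)
    -- Distinct integers stay distinct in `k`, so the kernel of `D` is no larger than the piece of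
    -- degree zero.
    have hD0 : ∀ x, D x = 0 → x ∈ T.deg 0 := by
      intro x hx
      have hx' : x ∈ ⨆ i, T.deg i := by rw [T.iSup_deg]; trivial
      have key : ∀ x ∈ ⨆ i, T.deg i, ∃ u ∈ T.deg 0, ∃ w ∈ ⨆ μ : {μ : k // μ ≠ 0},
          Module.End.eigenspace D μ, x = u + w := by
        intro x hx
        induction hx using Submodule.iSup_induction' with
        | mem i x hx =>
          rcases eq_or_ne i 0 with rfl | hi
          · exact ⟨x, hx, 0, zero_mem _, by simp⟩
          · refine ⟨0, zero_mem _, x, ?_, by simp⟩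
            exact Submodule.mem_iSup_of_mem
              (p := fun μ : {μ : k // μ ≠ 0} => Module.End.eigenspace D μ)
              ⟨(i : k), by exact_mod_cast hi⟩ (Module.End.mem_eigenspace_iff.mpr (hD i x hx))
        | zero => exact ⟨0, zero_mem _, 0, zero_mem _, by simp⟩
        | add x y _ _ hx hy =>
          obtain ⟨u, hu, w, hw, rfl⟩ := hx
          obtain ⟨u', hu', w', hw', rfl⟩ := hy
          exact ⟨u + u', add_mem hu hu', w + w', add_mem hw hw', by abel⟩
      obtain ⟨u, hu, w, hw, rfl⟩ := key x hx'
      have hw0 : w ∈ Module.End.eigenspace D 0 := by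
        rw [Module.End.mem_eigenspace_iff, zero_smul]
        rwa [map_add, hDh u hu, zero_add] at hx
      have hind := (Module.End.eigenspaces_iSupIndep D) 0
      rw [iSup_subtype'] at hind
      rw [Submodule.disjoint_def.mp hind w hw0 hw, add_zero]
      exact hu
    refine ⟨z, ?_, fun i x hx => by rw [← hDz, hD i x hx]⟩
    -- `D z = [z, z] = 0` gives degree zero; then `[z, d] = D d = 0` puts `z` in the centralizer of
    -- `d` in degree zero, which is `h`.
    have hz0 : z ∈ T.deg 0 := by
      refine hD0 z ?_
      have := br_even_left_skew hz hz
      rw [hDz]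
      have h2 : (2 : k) • br (k := k) z z = 0 := by
        rw [two_smul]; nth_rewrite 1 [this]; simp
      exact (smul_eq_zero.mp h2).resolve_left two_ne_zero
    refine T.mem_h_of_br_d_eq_zero hz0 ?_
    have hdz := hDz (T.d : g)
    rw [hDh _ (T.cartan_le_deg_zero _ T.d_mem)] at hdz
    rw [br_even_left_skew T.d.2 hz, ← hdz, neg_zero]
  · exact Or.inl (T.deg_eq_bot_of_not_irreducible hirr)

end TriangularDecomposition

end LieSuperalgebra

/-! ### Weight decomposition of `g`, and brackets that span `h` -/

/-- If a vector of the `q`-th piece of an independent family lies in the sum of subspaces of the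
pieces, then it lies in the `q`-th one. -/
lemma iSupIndep.mem_of_mem_iSup {R M ι : Type*} [Ring R] [AddCommGroup M] [Module R M]
    {G S : ι → Submodule R M} (hG : iSupIndep G) (hS : ∀ p, S p ≤ G p) {q : ι} {w : M}
    (hw : w ∈ G q) (hw' : w ∈ ⨆ p, S p) : w ∈ S q := by
  have hle : (⨆ p, S p) ≤ S q ⊔ ⨆ (p) (_ : p ≠ q), G p := by
    refine iSup_le fun p => ?_
    rcases eq_or_ne p q with rfl | hp
    · exact le_sup_left
    · exact (hS p).trans ((le_iSup₂ (f := fun p (_ : p ≠ q) => G p) p hp).trans le_sup_right)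
  obtain ⟨s, hs, t, ht, rfl⟩ := Submodule.mem_sup.mp (hle hw')
  have ht' : t ∈ G q := by simpa using sub_mem hw (hS q hs)
  rw [Submodule.disjoint_def.mp (hG q) t ht' ht, add_zero]
  exact hs

namespace LieSuperalgebra

namespace TriangularDecomposition

variable {k g : Type*} [Field k] [CharZero k] [AddCommGroup g] [Module k g] [LieSuperalgebra k g]
  (T : TriangularDecomposition k g)

/-- The vectors of degree `i` and weight `χ`. -/
def wt (i : ℤ) (χ : Module.Dual k T.h) : Submodule k g :=
  T.deg i ⊓ ⨅ y : T.h, Module.End.eigenspace (br (k := k) (y : g)) (χ y)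

lemma mem_wt {i : ℤ} {χ : Module.Dual k T.h} {x : g} :
    x ∈ T.wt i χ ↔ x ∈ T.deg i ∧ ∀ y : T.h, br (k := k) (y : g) x = χ y • x := by
  simp [wt]

lemma wt_le_deg (i : ℤ) (χ : Module.Dual k T.h) : T.wt i χ ≤ T.deg i := inf_le_left

lemma wt_le_eigenspace (i : ℤ) (χ : Module.Dual k T.h) :
    T.wt i χ ≤ Module.End.eigenspace (br (k := k) (T.d : g)) (χ T.dh) :=
  fun _ hx => Module.End.mem_eigenspace_iff.mpr ((T.mem_wt.mp hx).2 T.dh)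

/-- The vectors of degree zero on which `d` acts by `m`. -/
def zeroPart (m : ℤ) : Submodule k g :=
  T.deg 0 ⊓ Module.End.eigenspace (br (k := k) (T.d : g)) (m : k)

lemma mem_zeroPart {m : ℤ} {x : g} :
    x ∈ T.zeroPart m ↔ x ∈ T.deg 0 ∧ br (k := k) (T.d : g) x = (m : k) • x := by
  simp [zeroPart]

/-- The negative root spaces in degree zero. -/
def negZero : Submodule k g := ⨆ m : {m : ℤ // m < 0}, T.zeroPart m

/-- The positive root spaces in degree zero. -/
def posZero : Submodule k g := ⨆ m : {m : ℤ // 0 < m}, T.zeroPart m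

/-- The pieces of negative degree. -/
def negDeg : Submodule k g := ⨆ i : {i : ℤ // i < 0}, T.deg i

/-- The pieces of positive degree. -/
def posDeg : Submodule k g := ⨆ i : {i : ℤ // 0 < i}, T.deg i

lemma nPlus_eq : T.nPlus = T.posZero ⊔ T.posDeg := rfl

lemma nMinus_eq : T.nMinus = T.negZero ⊔ T.negDeg := rfl

lemma zeroPart_le_deg (m : ℤ) : T.zeroPart m ≤ T.deg 0 := inf_le_left

lemma negZero_le_deg : T.negZero ≤ T.deg 0 := iSup_le fun m => T.zeroPart_le_deg m

lemma zeroPart_le_negZero {m : ℤ} (hm : m < 0) : T.zeroPart m ≤ T.negZero :=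
  le_iSup (fun m : {m : ℤ // m < 0} => T.zeroPart m) ⟨m, hm⟩

lemma zeroPart_le_posZero {m : ℤ} (hm : 0 < m) : T.zeroPart m ≤ T.posZero :=
  le_iSup (fun m : {m : ℤ // 0 < m} => T.zeroPart m) ⟨m, hm⟩

lemma deg_le_negDeg {i : ℤ} (hi : i < 0) : T.deg i ≤ T.negDeg :=
  le_iSup (fun i : {i : ℤ // i < 0} => T.deg i) ⟨i, hi⟩

lemma deg_le_posDeg {i : ℤ} (hi : 0 < i) : T.deg i ≤ T.posDeg :=
  le_iSup (fun i : {i : ℤ // 0 < i} => T.deg i) ⟨i, hi⟩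

lemma zeroPart_zero_le_h : T.zeroPart 0 ≤ T.h := fun x hx => by
  rw [mem_zeroPart] at hx
  exact T.mem_h_of_br_d_eq_zero hx.1 (by simpa using hx.2)

lemma deg_zero_le : T.deg 0 ≤ T.negZero ⊔ T.h ⊔ T.posZero := by
  refine T.d_integral.trans (iSup_le fun m => ?_)
  change T.zeroPart m ≤ _
  rcases lt_trichotomy m 0 with hm | rfl | hm
  · exact (T.zeroPart_le_negZero hm).trans (le_sup_left.trans le_sup_left)
  · exact T.zeroPart_zero_le_h.trans (le_sup_right.trans le_sup_left)
  · exact (T.zeroPart_le_posZero hm).trans le_sup_right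

lemma top_le : ⊤ ≤ T.negDeg ⊔ T.deg 0 ⊔ T.posDeg := by
  rw [← T.iSup_deg]
  refine iSup_le fun i => ?_
  rcases lt_trichotomy i 0 with hi | rfl | hi
  · exact (T.deg_le_negDeg hi).trans (le_sup_left.trans le_sup_left)
  · exact le_sup_right.trans le_sup_left
  · exact (T.deg_le_posDeg hi).trans le_sup_right

/-- Brackets with elements of degree zero preserve sums of homogeneous pieces. -/
lemma br_mem_iSup_deg (s : Set ℤ) {x y : g} (hx : x ∈ T.deg 0)
    (hy : y ∈ ⨆ i : s, T.deg i) : br (k := k) x y ∈ ⨆ i : s, T.deg i := by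
  induction hy using Submodule.iSup_induction' with
  | mem i y hy =>
    refine Submodule.mem_iSup_of_mem i ?_
    simpa using T.deg_br_mem 0 i x y hx hy
  | zero => simp
  | add y y' _ _ hy hy' => rw [map_add]; exact add_mem hy hy'

lemma br_deg_zero_negDeg {x y : g} (hx : x ∈ T.deg 0) (hy : y ∈ T.negDeg) :
    br (k := k) x y ∈ T.negDeg := T.br_mem_iSup_deg {i | i < 0} hx hy

lemma br_deg_zero_deg_zero {x y : g} (hx : x ∈ T.deg 0) (hy : y ∈ T.deg 0) :
    br (k := k) x y ∈ T.deg 0 := by simpa using T.deg_br_mem 0 0 x y hx hy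

lemma br_zeroPart {m : ℤ} {μ : k} {x y : g} (hx : x ∈ T.zeroPart m)
    (hy : y ∈ Module.End.eigenspace (br (k := k) (T.d : g)) μ) :
    br (k := k) x y ∈ Module.End.eigenspace (br (k := k) (T.d : g)) (m + μ) := by
  rw [mem_zeroPart] at hx
  rw [Module.End.mem_eigenspace_iff] at *
  rw [jacobi_even T.d.2, hx.2, hy]
  simp [add_smul]

variable {T} (hT : T.IsSplit)
include hT

/-- The degree derivation and the `ad y` with `y ∈ h` commute and are diagonalizable, hence
simultaneously diagonalizable. -/
lemma IsSplit.iSup_wt : ⨆ p : ℤ × Module.Dual k T.h, T.wt p.1 p.2 = ⊤ := by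
  have := hT.finiteDimensional
  obtain ⟨D, hD⟩ := T.exists_degree_map
  -- The index `none` stands for the degree derivation.
  let f : Option T.h → Module.End k g := fun o => o.elim D fun y => br (k := k) (y : g)
  have hss : ∀ o, ⨆ μ : k, Module.End.eigenspace (f o) μ = ⊤ := by
    intro o
    cases o with
    | none =>
      rw [eq_top_iff, ← T.iSup_deg]
      refine iSup_le fun i x hx => ?_
      exact Submodule.mem_iSup_of_mem (p := fun μ : k => Module.End.eigenspace D μ) (i : k)
        (Module.End.mem_eigenspace_iff.mpr (hD i x hx))
    | some y => exact hT.iSup_eigenspace y y.2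
  have hmax : ∀ o μ, Module.End.maxGenEigenspace (f o) μ = Module.End.eigenspace (f o) μ :=
    fun o μ => (Module.End.isSemisimple_of_iSup_eigenspace_eq_top
      (hss o)).isFinitelySemisimple.maxGenEigenspace_eq_eigenspace μ
  have hDh : ∀ y : T.h, Commute D (br (k := k) (y : g)) := by
    intro y
    ext x
    have := T.degree_map_br hD (y : g) x
    rw [hD 0 _ (T.h_le_deg_zero y.2)] at this
    simpa using this
  have hcomm : Pairwise fun o o' => Commute (f o) (f o') := by
    intro o o' _
    cases o with
    | none => cases o' with
      | none => exact Commute.refl _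
      | some y => exact hDh y
    | some y => cases o' with
      | none => exact (hDh y).symm
      | some y' =>
        ext x
        have := jacobi_even (T.h_le_even y.2) (y' : g) x
        rw [hT.br_h _ y.2 _ y'.2, map_zero, LinearMap.zero_apply, zero_add] at this
        exact this
  have htop := Module.End.iSup_iInf_maxGenEigenspace_eq_top_of_iSup_maxGenEigenspace_eq_top_of_commute
    f hcomm (fun o => by simp_rw [hmax]; exact hss o)
  rw [eq_top_iff, ← htop]
  refine iSup_le fun χ x hx => ?_
  rcases eq_or_ne x 0 with rfl | hx0
  · exact zero_mem _
  have hx' : ∀ o, f o x = χ o • x := by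
    intro o
    have := (Submodule.mem_iInf _).mp hx o
    rw [hmax, Module.End.mem_eigenspace_iff] at this
    exact this
  have hinj : ∀ a b : k, a • x = b • x → a = b := fun a b h => smul_left_injective k hx0 h
  -- The eigenvalue on a fixed nonzero joint eigenvector depends linearly on `y`.
  let χ' : Module.Dual k T.h :=
    { toFun := fun y => χ (some y)
      map_add' := fun y y' => hinj _ _ (by
        rw [add_smul, ← hx', ← hx', ← hx']; simp [f])
      map_smul' := fun c y => hinj _ _ (by
        rw [RingHom.id_apply, smul_eq_mul, mul_smul, ← hx', ← hx']; simp [f]) }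
  have hmem : x ∈ ⨆ i, T.deg i := by rw [T.iSup_deg]; trivial
  have hE : iSupIndep fun i : ℤ => Module.End.eigenspace D (i : k) :=
    (Module.End.eigenspaces_iSupIndep D).comp (Int.cast_injective (α := k))
  have hle : ∀ i, T.deg i ≤ Module.End.eigenspace D (i : k) :=
    fun i x hx => Module.End.mem_eigenspace_iff.mpr (hD i x hx)
  -- The pieces `deg i` span `g`, so `D` has only integer eigenvalues.
  obtain ⟨i, hi⟩ : ∃ i : ℤ, χ none = i := by
    by_contra! hne
    have hind := Module.End.eigenspaces_iSupIndep D (χ none)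
    refine hx0 (Submodule.disjoint_def.mp hind x (Module.End.mem_eigenspace_iff.mpr (hx' none)) ?_)
    have : (⨆ i, T.deg i) ≤ ⨆ (μ) (_ : μ ≠ χ none), Module.End.eigenspace D μ :=
      iSup_le fun i => (hle i).trans (le_iSup₂_of_le (i : k) (hne i).symm le_rfl)
    exact this hmem
  refine Submodule.mem_iSup_of_mem (p := fun p : ℤ × Module.Dual k T.h => T.wt p.1 p.2) (i, χ') ?_
  rw [mem_wt]
  refine ⟨hE.mem_of_mem_iSup hle (Module.End.mem_eigenspace_iff.mpr ?_) hmem, fun y => hx' (some y)⟩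
  rw [← hi]
  exact hx' none

lemma IsSplit.deg_le_iSup_wt (i : ℤ) : T.deg i ≤ ⨆ χ, T.wt i χ := by
  intro x hx
  refine T.deg_isInternal.submodule_iSupIndep.mem_of_mem_iSup
    (S := fun i => ⨆ χ, T.wt i χ) (fun i => iSup_le fun χ => T.wt_le_deg i χ) hx ?_
  rw [← iSup_prod (f := fun p : ℤ × Module.Dual k T.h => T.wt p.1 p.2), hT.iSup_wt]
  trivial

lemma IsSplit.negDeg_le_iSup : T.negDeg ≤
    ⨆ ν : k, T.negDeg ⊓ Module.End.eigenspace (br (k := k) (T.d : g)) ν := by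
  refine iSup_le fun i => (hT.deg_le_iSup_wt i).trans (iSup_le fun χ => ?_)
  refine le_iSup_of_le (χ T.dh) (le_inf ?_ (T.wt_le_eigenspace _ _))
  exact (T.wt_le_deg _ _).trans (T.deg_le_negDeg i.2)

omit hT in
/-- The eigenvalues of `d` in degree zero are integers. -/
lemma exists_int_of_mem_wt_zero {χ : Module.Dual k T.h} {x : g} (hx : x ∈ T.wt 0 χ) (hx0 : x ≠ 0) :
    ∃ m : ℤ, χ T.dh = m ∧ x ∈ T.zeroPart m := by
  by_contra! hne
  have hind := Module.End.eigenspaces_iSupIndep (br (k := k) (T.d : g)) (χ T.dh)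
  refine hx0 (Submodule.disjoint_def.mp hind x (T.wt_le_eigenspace 0 χ hx) ?_)
  have hne' : ∀ m : ℤ, (m : k) ≠ χ T.dh := fun m hm => hne m hm.symm
    ⟨T.wt_le_deg 0 χ hx, hm ▸ T.wt_le_eigenspace 0 χ hx⟩
  have : (⨆ m : ℤ, T.deg 0 ⊓ Module.End.eigenspace (br (k := k) (T.d : g)) (m : k)) ≤
      ⨆ (μ) (_ : μ ≠ χ T.dh), Module.End.eigenspace (br (k := k) (T.d : g)) μ :=
    iSup_le fun m => inf_le_right.trans (le_iSup₂_of_le (m : k) (hne' m) le_rfl)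
  exact this (T.d_integral (T.wt_le_deg 0 χ hx))

/-- `h` is spanned by brackets of elements of `n⁺` with weight vectors. -/
lemma IsSplit.h_le_span_br_nPlus : T.h ≤ Submodule.span k
    {z | z ∈ T.h ∧ ∃ x ∈ T.nPlus, ∃ i χ, ∃ y ∈ T.wt i χ, br (k := k) x y = z} := by
  set C := Submodule.span k
    {z | z ∈ T.h ∧ ∃ x ∈ T.nPlus, ∃ i χ, ∃ y ∈ T.wt i χ, br (k := k) x y = z} with hC
  -- Brackets are sorted by degree and `d`-eigenvalue. Both are zero on `h`, so only `S (0, 0)`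
  -- matters.
  let S : ℤ × k → Submodule k g := fun p => Submodule.span k
    {z | ∃ i j χ χ', ∃ x ∈ T.wt i χ, ∃ y ∈ T.wt j χ', i + j = p.1 ∧ χ T.dh + χ' T.dh = p.2 ∧
      br (k := k) x y = z}
  have hS1 : ∀ p, S p ≤ T.deg p.1 := by
    intro p
    refine Submodule.span_le.mpr ?_
    rintro _ ⟨i, j, χ, χ', x, hx, y, hy, hij, -, rfl⟩
    have := T.deg_br_mem i j x y (T.wt_le_deg _ _ hx) (T.wt_le_deg _ _ hy)
    rwa [hij] at this
  have hS2 : ∀ p, S p ≤ Module.End.eigenspace (br (k := k) (T.d : g)) p.2 := by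
    intro p
    refine Submodule.span_le.mpr ?_
    rintro _ ⟨i, j, χ, χ', x, hx, y, hy, -, hμ, rfl⟩
    have h1 := Module.End.mem_eigenspace_iff.mp (T.wt_le_eigenspace _ _ hx)
    have h2 := Module.End.mem_eigenspace_iff.mp (T.wt_le_eigenspace _ _ hy)
    refine Module.End.mem_eigenspace_iff.mpr ?_
    rw [jacobi_even T.d.2, h1, h2, ← hμ]
    simp [add_smul]
  have hall : Submodule.span k {z | ∃ x y : g, br (k := k) x y = z} ≤ ⨆ p, S p := by
    refine Submodule.span_le.mpr ?_
    rintro _ ⟨x, y, rfl⟩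
    have hx : x ∈ ⨆ p : ℤ × Module.Dual k T.h, T.wt p.1 p.2 := by rw [hT.iSup_wt]; trivial
    have hy : y ∈ ⨆ p : ℤ × Module.Dual k T.h, T.wt p.1 p.2 := by rw [hT.iSup_wt]; trivial
    change br (k := k) x y ∈ ⨆ p, S p
    induction hx using Submodule.iSup_induction' with
    | mem p x hx =>
      induction hy using Submodule.iSup_induction' with
      | mem q y hy =>
        exact Submodule.mem_iSup_of_mem (p.1 + q.1, p.2 T.dh + q.2 T.dh)
          (Submodule.subset_span ⟨_, _, _, _, x, hx, y, hy, rfl, rfl, rfl⟩)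
      | zero => simp
      | add y y' _ _ hy hy' => rw [map_add]; exact add_mem hy hy'
    | zero => simp
    | add x x' _ _ hx hx' => rw [map_add, LinearMap.add_apply]; exact add_mem hx hx'
  -- When degrees and eigenvalues cancel, either one of the two factors lies in `n⁺`, or both lie in
  -- `h` and commute.
  have hS0 : S (0, 0) ≤ C := by
    refine Submodule.span_le.mpr ?_
    rintro _ ⟨i, j, χ, χ', x, hx, y, hy, hij, hμ, rfl⟩
    have hmem : br (k := k) x y ∈ S (0, 0) :=
      Submodule.subset_span ⟨i, j, χ, χ', x, hx, y, hy, hij, hμ, rfl⟩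
    have hh : br (k := k) x y ∈ T.h := by
      refine T.mem_h_of_br_d_eq_zero (hS1 _ hmem) ?_
      have := Module.End.mem_eigenspace_iff.mp (hS2 _ hmem)
      simpa using this
    have hx1 : x ∈ T.nPlus → br (k := k) x y ∈ C :=
      fun h => Submodule.subset_span ⟨hh, x, h, j, χ', y, hy, rfl⟩
    have hy1 : y ∈ T.nPlus → br (k := k) x y ∈ C := by
      intro h
      have hsk := br_skew _ _ x y (T.deg_le_part _ (T.wt_le_deg _ _ hx))
        (T.deg_le_part _ (T.wt_le_deg _ _ hy))
      have hyx : br (k := k) y x ∈ C := by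
        refine Submodule.subset_span ⟨?_, y, h, i, χ, x, hx, rfl⟩
        have hsk' := br_skew _ _ y x (T.deg_le_part _ (T.wt_le_deg _ _ hy))
          (T.deg_le_part _ (T.wt_le_deg _ _ hx))
        rw [hsk']
        exact neg_mem (zsmul_mem hh _)
      rw [hsk]
      exact neg_mem (zsmul_mem hyx _)
    change br (k := k) x y ∈ C
    rcases lt_trichotomy i 0 with hi | rfl | hi
    · refine hy1 ?_
      have hj : 0 < j := by simp at hij; omega
      exact (le_sup_right : _ ≤ T.nPlus) (T.deg_le_posDeg hj (T.wt_le_deg _ _ hy))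
    · obtain rfl : j = 0 := by simpa using hij
      rcases eq_or_ne x 0 with rfl | hx0
      · simp
      rcases eq_or_ne y 0 with rfl | hy0
      · simp
      obtain ⟨m, hm, hxm⟩ := exists_int_of_mem_wt_zero hx hx0
      obtain ⟨m', hm', hym⟩ := exists_int_of_mem_wt_zero hy hy0
      have hmm : m + m' = 0 := by
        rw [hm, hm'] at hμ
        have hμ' : (m : k) + (m' : k) = 0 := hμ
        exact_mod_cast hμ'
      rcases lt_trichotomy m 0 with h | rfl | h
      · exact hy1 ((le_sup_left : _ ≤ T.nPlus) (T.zeroPart_le_posZero (by omega) hym))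
      · obtain rfl : m' = 0 := by simpa using hmm
        rw [hT.br_h x (T.zeroPart_zero_le_h hxm) y (T.zeroPart_zero_le_h hym)]
        exact zero_mem _
      · exact hx1 ((le_sup_left : _ ≤ T.nPlus) (T.zeroPart_le_posZero h hxm))
    · exact hx1 ((le_sup_right : _ ≤ T.nPlus) (T.deg_le_posDeg hi (T.wt_le_deg _ _ hx)))
  intro x hx
  have h1 : x ∈ ⨆ μ, S (0, μ) := by
    refine T.deg_isInternal.submodule_iSupIndep.mem_of_mem_iSup (S := fun n => ⨆ μ, S (n, μ))
      (fun n => iSup_le fun μ => hS1 (n, μ)) (T.h_le_deg_zero hx) ?_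
    rw [← iSup_prod (f := S)]
    exact hall (hT.h_le_span_br hx)
  refine hS0 ((Module.End.eigenspaces_iSupIndep (br (k := k) (T.d : g))).mem_of_mem_iSup
    (S := fun μ => S (0, μ)) (fun μ => hS2 (0, μ)) ?_ h1)
  rw [Module.End.mem_eigenspace_iff, zero_smul]
  exact hT.br_h _ T.d_mem_h _ hx

/-- Iterated brackets with the negative root vectors of degree zero eventually vanish. -/
lemma IsSplit.exists_iterate_br_negZero_eq_bot : ∃ r : ℕ,
    (Submodule.map₂ (br (k := k) (L := g)) T.negZero)^[r] ⊤ = ⊥ := by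
  have := hT.finiteDimensional
  let E := Module.End.eigenspace (br (k := k) (T.d : g))
  let f : Module.End k g := br (k := k) (T.d : g)
  -- The eigenvalues of `d` outside degree zero are not assumed to be integers, but only finitely
  -- many natural numbers are differences of two eigenvalues.
  have hfin : {n : ℕ | ∃ μ ν : k, f.HasEigenvalue μ ∧ f.HasEigenvalue ν ∧ μ - n = ν}.Finite := by
    have h1 : (Set.image2 (fun μ ν : k => μ - ν) {μ | f.HasEigenvalue μ}
      {μ | f.HasEigenvalue μ}).Finite := f.finite_hasEigenvalue.image2 _ f.finite_hasEigenvalue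
    refine (h1.preimage (Nat.cast_injective (R := k)).injOn).subset ?_
    rintro n ⟨μ, ν, hμ, hν, h⟩
    exact ⟨μ, hμ, ν, hν, by rw [← h]; simp⟩
  obtain ⟨r, hr⟩ := hfin.bddAbove
  refine ⟨r + 1, ?_⟩
  -- Each bracket with a negative root vector lowers the eigenvalue by at least one; the second
  -- component of `p` is the total drop.
  have key : ∀ j : ℕ, (Submodule.map₂ (br (k := k) (L := g)) T.negZero)^[j] ⊤ ≤
      ⨆ p : {p : k × ℕ // f.HasEigenvalue p.1 ∧ j ≤ p.2}, E (p.1.1 - p.1.2) := by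
    intro j
    induction j with
    | zero =>
      intro x _
      have hx : x ∈ ⨆ μ : k, E μ := by
        rw [hT.iSup_eigenspace _ T.d_mem_h]; trivial
      refine (iSup_le fun μ => ?_ : (⨆ μ : k, E μ) ≤ _) hx
      by_cases hμ : f.HasEigenvalue μ
      · exact le_iSup_of_le ⟨(μ, 0), hμ, le_rfl⟩ (by simp)
      · have : E μ = ⊥ := by simpa [Module.End.hasEigenvalue_iff] using hμ
        rw [this]; exact bot_le
    | succ j ih =>
      rw [Function.iterate_succ_apply', Submodule.map₂_le]
      intro x hx y hy
      replace hy := ih hy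
      induction hx using Submodule.iSup_induction' with
      | mem m x hx =>
        induction hy using Submodule.iSup_induction' with
        | mem p y hy =>
          refine Submodule.mem_iSup_of_mem
            ⟨(p.1.1, p.1.2 + (-(m : ℤ)).toNat), p.2.1, ?_⟩ ?_
          · have := p.2.2; have := m.2; simp only; omega
          · have h1 := T.br_zeroPart hx hy
            convert h1 using 2
            have h2 : (((-(m : ℤ)).toNat : ℕ) : k) = -((m : ℤ) : k) := by
              rw [← Int.cast_natCast, Int.toNat_of_nonneg (by have := m.2; omega)]
              simp
            rw [Nat.cast_add, h2]
            ring
        | zero => simp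
        | add y y' _ _ hy hy' => rw [map_add]; exact add_mem hy hy'
      | zero => simp
      | add x x' _ _ hx hx' => rw [map_add, LinearMap.add_apply]; exact add_mem hx hx'
  rw [eq_bot_iff]
  refine (key (r + 1)).trans (iSup_le fun p => ?_)
  by_contra hne
  have hν : f.HasEigenvalue (p.1.1 - p.1.2) := by
    rw [Module.End.hasEigenvalue_iff]
    intro h
    exact hne h.le
  have := hr ⟨_, _, p.2.1, hν, rfl⟩
  have := p.2.2
  omega

end TriangularDecomposition

end LieSuperalgebra

/-! ### Subspaces generated by subspaces of operators -/

namespace Submodule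

section OpClosure

variable {k V : Type*} [Field k] [AddCommGroup V] [Module k V]
  {P Q M : Submodule k (Module.End k V)} {S U W : Submodule k V}

variable (P S) in
/-- The smallest subspace that contains `S` and is stable under the operators in `P`. -/
def opClosure : Submodule k V := ⨆ n : ℕ, P ^ n • S

lemma le_opClosure : S ≤ opClosure P S :=
  le_iSup_of_le 0 (by rw [pow_zero, Submodule.one_smul])

lemma op_pow_succ_smul (n : ℕ) : P ^ (n + 1) • S = P • P ^ n • S := by
  rw [pow_succ', ← smul_eq_mul, Submodule.smul_assoc]

lemma smul_opClosure_le : P • opClosure P S ≤ opClosure P S := by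
  rw [opClosure, smul_iSup]
  exact iSup_le fun n => le_iSup_of_le (n + 1) (op_pow_succ_smul n).ge

lemma opClosure_le (hS : S ≤ W) (hW : P • W ≤ W) : opClosure P S ≤ W := by
  refine iSup_le fun n => ?_
  induction n with
  | zero => rwa [pow_zero, Submodule.one_smul]
  | succ n ih => rw [op_pow_succ_smul]; exact (smul_mono le_rfl ih).trans hW

lemma opClosure_mono (hP : P ≤ Q) (hS : S ≤ W) : opClosure P S ≤ opClosure Q W :=
  opClosure_le (hS.trans le_opClosure) ((smul_mono hP le_rfl).trans smul_opClosure_le)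

/-- The operators in `M` map the closure into a stable subspace `U` if they map the generators
into `U` and commute with the operators in `P` up to operators in `M`. -/
lemma smul_opClosure_le_of_mul_le (h : M * P ≤ M ⊔ P * M) (hS : M • S ≤ U) (hU : P • U ≤ U) :
    M • opClosure P S ≤ U := by
  rw [opClosure, smul_iSup]
  refine iSup_le fun n => ?_
  induction n with
  | zero => rwa [pow_zero, Submodule.one_smul]
  | succ n ih =>
    rw [op_pow_succ_smul, ← Submodule.smul_assoc, smul_eq_mul]
    refine (smul_mono h le_rfl).trans ?_
    rw [sup_smul, ← smul_eq_mul, Submodule.smul_assoc]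
    exact sup_le ih ((smul_mono le_rfl ih).trans hU)

lemma op_smul_eq_map₂ : P • S = map₂ LinearMap.id P S :=
  le_antisymm (smul_le.mpr fun _ hf _ hx => apply_mem_map₂ (LinearMap.id : Module.End k V →ₗ[k] _) hf hx)
    (map₂_le.mpr fun _ hf _ hx => smul_mem_smul hf hx)

lemma FG.op_smul (hP : P.FG) (hS : S.FG) : (P • S).FG := by
  rw [op_smul_eq_map₂]
  exact hP.map₂ _ hS

/-- Iterating gives `S ≤ P ^ n • S` for all `n`, as in Nakayama's lemma. -/
lemma eq_bot_of_le_smul (hP : IsNilpotent P) (h : S ≤ P • S) : S = ⊥ := by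
  obtain ⟨n, hn⟩ := hP
  have : ∀ n, S ≤ P ^ n • S := fun n => by
    induction n with
    | zero => rw [pow_zero, Submodule.one_smul]
    | succ n ih => rw [op_pow_succ_smul]; exact h.trans (smul_mono le_rfl ih)
  refine eq_bot_iff.mpr ((this n).trans ?_)
  rw [hn, zero_eq_bot, bot_smul]

end OpClosure

/-- A finitely generated subspace of anticommuting elements of an algebra is nilpotent. -/
lemma isNilpotent_of_fg_of_anticommute {k R : Type*} [Field k] [CharZero k] [Ring R] [Algebra k R]
    {E : Submodule k R} (hE : E.FG) (h : ∀ x ∈ E, ∀ y ∈ E, x * y = -(y * x)) : IsNilpotent E := by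
  obtain ⟨s, rfl⟩ := hE
  replace h : ∀ x ∈ s, ∀ y ∈ s, x * y = -(y * x) := fun x hx y hy =>
    h x (subset_span hx) y (subset_span hy)
  classical
  induction s using Finset.induction_on with
  | empty => exact ⟨1, by simp⟩
  | insert x s _ ih =>
    rw [Finset.coe_insert, span_insert, ← add_eq_sup]
    -- Anticommuting elements span commuting subspaces, since a sign does not change a subspace, and
    -- a sum of commuting nilpotent subspaces is nilpotent.
    refine Commute.isNilpotent_add ?_ ?_ (ih fun a ha b hb =>
      h a (Finset.mem_insert_of_mem ha) b (Finset.mem_insert_of_mem hb))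
    · have key : ∀ y ∈ span k (s : Set R), x * y = -(y * x) := by
        intro y hy
        induction hy using span_induction with
        | mem y hy => exact h x (Finset.mem_insert_self x s) y (Finset.mem_insert_of_mem hy)
        | zero => simp
        | add y z _ _ hy hz => rw [mul_add, add_mul, hy, hz]; abel
        | smul c y _ hy => simp [hy]
      refine le_antisymm (mul_le.mpr fun a ha b hb => ?_) (mul_le.mpr fun b hb a ha => ?_)
      · obtain ⟨c, rfl⟩ := mem_span_singleton.mp ha
        have := mul_mem_mul hb ha
        have h2 : c • x * b = -(b * c • x) := by simp [key b hb]
        rw [h2]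
        exact neg_mem this
      · obtain ⟨c, rfl⟩ := mem_span_singleton.mp ha
        have := mul_mem_mul ha hb
        have h2 : b * c • x = -(c • x * b) := by simp [key b hb]
        rw [h2]
        exact neg_mem this
    · refine ⟨2, ?_⟩
      have hx : x * x = 0 := by
        have h1 := h x (Finset.mem_insert_self x s) x (Finset.mem_insert_self x s)
        have h2 : (2 : k) • (x * x) = 0 := by
          rw [two_smul]; nth_rewrite 1 [h1]; simp
        simpa using h2
      rw [pow_two, span_mul_span]
      simp [hx]

end Submodule

namespace Module.End

variable {k V : Type*} [Field k] [AddCommGroup V] [Module k V]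

/-- An eigenvector that is, modulo a stable subspace `U`, a sum of eigenvectors for other
eigenvalues lies in `U`. -/
lemma mem_of_mem_iSup_eigenspace_sup {f : End k V} {U : Submodule k V} (hU : ∀ u ∈ U, f u ∈ U)
    {μ : k} {v : V} (hv : f v = μ • v) {ι : Type*} {ν : ι → k} (hν : ∀ i, ν i ≠ μ)
    {R : ι → Submodule k V} (hR : ∀ i, R i ≤ f.eigenspace (ν i)) (h : v ∈ (⨆ i, R i) ⊔ U) :
    v ∈ U := by
  -- In `V / U` eigenvectors for distinct eigenvalues are independent, which forces the class of `v`
  -- to be zero.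
  let fq : End k (V ⧸ U) := U.mapQ U f hU
  have h1 : U.mkQ v ∈ fq.eigenspace μ := by
    rw [mem_eigenspace_iff]
    simp only [fq, Submodule.mkQ_apply, Submodule.mapQ_apply, hv, Submodule.Quotient.mk_smul]
  have h2 : U.mkQ v ∈ ⨆ (c) (_ : c ≠ μ), fq.eigenspace c := by
    have : U.mkQ v ∈ ((⨆ i, R i) ⊔ U).map U.mkQ := Submodule.mem_map_of_mem h
    rw [Submodule.map_sup, Submodule.mkQ_map_self, sup_bot_eq, Submodule.map_iSup] at this
    refine (iSup_le fun i => ?_ : (⨆ i, (R i).map U.mkQ) ≤ _) this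
    refine le_iSup₂_of_le (f := fun c (_ : c ≠ μ) => fq.eigenspace c) (ν i) (hν i) ?_
    rintro _ ⟨x, hx, rfl⟩
    have hx' := mem_eigenspace_iff.mp (hR i hx)
    rw [mem_eigenspace_iff]
    simp only [fq, Submodule.mkQ_apply, Submodule.mapQ_apply, hx', Submodule.Quotient.mk_smul]
  have h3 := Submodule.disjoint_def.mp (eigenspaces_iSupIndep fq μ) _ h1 h2
  simpa using h3

end Module.End

/-! ### Graded subspaces and spaces of operators from `g ⊗ A` -/

namespace IsGradedSubspace

variable {k M : Type*} [Field k] [AddCommGroup M] [Module k M] {p : ZMod 2 → Submodule k M}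

lemma of_le {i : ZMod 2} {W : Submodule k M} (h : W ≤ p i) : IsGradedSubspace p W := by
  intro w hw
  fin_cases i
  · exact Submodule.mem_sup_left ⟨hw, h hw⟩
  · exact Submodule.mem_sup_right ⟨hw, h hw⟩

lemma iSup {ι : Sort*} {W : ι → Submodule k M} (h : ∀ i, IsGradedSubspace p (W i)) :
    IsGradedSubspace p (⨆ i, W i) :=
  iSup_le fun i => (h i).trans (sup_le_sup (inf_le_inf_right _ (le_iSup W i))
    (inf_le_inf_right _ (le_iSup W i)))

lemma sup {W U : Submodule k M} (hW : IsGradedSubspace p W) (hU : IsGradedSubspace p U) :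
    IsGradedSubspace p (W ⊔ U) :=
  sup_le (hW.trans (sup_le_sup (inf_le_inf_right _ le_sup_left) (inf_le_inf_right _ le_sup_left)))
    (hU.trans (sup_le_sup (inf_le_inf_right _ le_sup_right) (inf_le_inf_right _ le_sup_right)))

lemma top (h : IsCompl (p 0) (p 1)) : IsGradedSubspace p ⊤ := by
  simp [IsGradedSubspace, h.sup_eq_top]

lemma eq_iSup {W : Submodule k M} (h : IsGradedSubspace p W) : W = ⨆ i, W ⊓ p i := by
  refine le_antisymm (h.trans (sup_le (le_iSup (fun i => W ⊓ p i) 0)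
    (le_iSup (fun i => W ⊓ p i) 1))) (iSup_le fun i => inf_le_left)

end IsGradedSubspace

namespace LieSupermodule

open LieSuperalgebra

section Ops

variable {k g : Type*} [Field k] [AddCommGroup g] [Module k g] [LieSuperalgebra k g]
  {A V : Type*} [CommRing A] [Algebra k A] [AddCommGroup V] [Module k V]
  [LieSupermodule k (g ⊗[k] A) V]

variable (k g A V) in
/-- The bilinear map that sends `x` and `a` to the operator `x ⊗ a` on `V`. -/
def actMap : g →ₗ[k] A →ₗ[k] Module.End k V :=
  (TensorProduct.mk k g A).compr₂ (act (k := k) (L := g ⊗[k] A) (V := V))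

@[simp] lemma actMap_apply (x : g) (a : A) (v : V) :
    actMap k g A V x a v = act (k := k) (x ⊗ₜ[k] a) v := rfl

variable (V) in
/-- The space of operators on `V` given by `N ⊗ C ⊆ g ⊗ A`. -/
def ops (N : Submodule k g) (C : Submodule k A) : Submodule k (Module.End k V) :=
  Submodule.map₂ (actMap k g A V) N C

variable {N M Q : Submodule k g} {C D : Submodule k A} {W U : Submodule k V}

lemma actMap_mem_ops {x : g} {a : A} (hx : x ∈ N) (ha : a ∈ C) :
    actMap k g A V x a ∈ ops V N C := Submodule.apply_mem_map₂ _ hx ha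

lemma ops_mono (hN : N ≤ M) (hC : C ≤ D) : ops V N C ≤ ops V M D := Submodule.map₂_le_map₂ hN hC

lemma ops_sup_left : ops V (N ⊔ M) C = ops V N C ⊔ ops V M C := Submodule.map₂_sup_left _ _ _ _

lemma ops_sup_right : ops V N (C ⊔ D) = ops V N C ⊔ ops V N D := Submodule.map₂_sup_right _ _ _ _

lemma ops_iSup_left {ι : Sort*} {N : ι → Submodule k g} :
    ops V (⨆ i, N i) C = ⨆ i, ops V (N i) C := Submodule.map₂_iSup_left _ _ _

lemma ops_bot_left : ops V (⊥ : Submodule k g) C = ⊥ := Submodule.map₂_bot_left _ _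

lemma ops_smul_le : ops V N C • W ≤ U ↔
    ∀ x ∈ N, ∀ a ∈ C, ∀ w ∈ W, act (k := k) (x ⊗ₜ[k] a) w ∈ U := by
  refine ⟨fun h x hx a ha w hw => h (Submodule.smul_mem_smul (actMap_mem_ops hx ha) hw),
    fun h => Submodule.smul_le.mpr fun f hf w hw => ?_⟩
  have : ops V N C ≤ U.comap ((LinearMap.id : Module.End k V →ₗ[k] V →ₗ[k] V).flip w) :=
    Submodule.map₂_le.mpr fun x hx a ha => h x hx a ha w hw
  exact this hf

lemma act_mem_smul {x : g} {a : A} {w : V} (hx : x ∈ N) (ha : a ∈ C) (hw : w ∈ W) :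
    act (k := k) (x ⊗ₜ[k] a) w ∈ ops V N C • W :=
  Submodule.smul_mem_smul (actMap_mem_ops hx ha) hw

lemma actMap_mul {i j : ZMod 2} {x y : g} (hx : x ∈ LieSuperalgebra.part (k := k) (L := g) i)
    (hy : y ∈ LieSuperalgebra.part (k := k) (L := g) j) (a b : A) :
    actMap k g A V x a * actMap k g A V y b = actMap k g A V (br (k := k) x y) (a * b) +
      koszulSign i j • (actMap k g A V y b * actMap k g A V x a) := by
  ext v
  have h := act_br (k := k) i j (x ⊗ₜ[k] a) (y ⊗ₜ[k] b) v (tmul_mem_mapPart hx a)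
    (tmul_mem_mapPart hy b)
  have h2 : br (k := k) (x ⊗ₜ[k] a) (y ⊗ₜ[k] b) = br (k := k) x y ⊗ₜ[k] (a * b) := mapBr_tmul x y a b
  rw [h2] at h
  simp [h]

lemma act_act_of_even {x : g} (hx : x ∈ LieSuperalgebra.part (k := k) (L := g) 0) (y : g) (a b : A) (v : V) :
    act (k := k) (x ⊗ₜ[k] a) (act (k := k) (y ⊗ₜ[k] b) v) =
      act (k := k) (br (k := k) x y ⊗ₜ[k] (a * b)) v +
        act (k := k) (y ⊗ₜ[k] b) (act (k := k) (x ⊗ₜ[k] a) v) := by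
  obtain ⟨y₀, hy₀, y₁, hy₁, rfl⟩ := exists_even_add_odd (k := k) y
  have h0 := congrArg (fun f : Module.End k V => f v) (actMap_mul (V := V) hx hy₀ a b)
  have h1 := congrArg (fun f : Module.End k V => f v) (actMap_mul (V := V) hx hy₁ a b)
  simp [koszulSign] at h0 h1
  simp only [TensorProduct.add_tmul, map_add, LinearMap.add_apply, h0, h1]
  abel

lemma actMap_mul_of_even {x : g} (hx : x ∈ LieSuperalgebra.part (k := k) (L := g) 0) (y : g) (a b : A) :
    actMap k g A V x a * actMap k g A V y b =
      actMap k g A V (br (k := k) x y) (a * b) + actMap k g A V y b * actMap k g A V x a :=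
  LinearMap.ext fun v => act_act_of_even hx y a b v

/-- Even operators commute with other operators up to commutators. -/
lemma ops_mul_ops_le_of_even (hM : M ≤ LieSuperalgebra.part (k := k) 0)
    (hQ : ∀ x ∈ M, ∀ y ∈ N, br (k := k) x y ∈ Q) :
    ops V M C * ops V N D ≤ ops V Q (C * D) ⊔ ops V N D * ops V M C := by
  rw [Submodule.mul_le]
  intro f hf f' hf'
  have h1 : ops V M C ≤ Submodule.comap (LinearMap.mulRight k f')
      (ops V Q (C * D) ⊔ ops V N D * ops V M C) := by
    refine Submodule.map₂_le.mpr fun x hx a ha => ?_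
    have h2 : ops V N D ≤ Submodule.comap (LinearMap.mulLeft k (actMap k g A V x a))
      (ops V Q (C * D) ⊔ ops V N D * ops V M C) := by
      refine Submodule.map₂_le.mpr fun y hy b hb => ?_
      rw [Submodule.mem_comap, LinearMap.mulLeft_apply, actMap_mul_of_even (hM hx)]
      exact Submodule.add_mem_sup (actMap_mem_ops (hQ x hx y hy) (Submodule.mul_mem_mul ha hb))
        (Submodule.mul_mem_mul (actMap_mem_ops hy hb) (actMap_mem_ops hx ha))
    exact h2 hf'
  exact h1 hf

/-- Gradedness reduces to homogeneous elements, and subspaces absorb the sign in the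
supercommutator. -/
lemma ops_mul_ops_le (hM : IsGradedSubspace (LieSuperalgebra.part (k := k)) M)
    (hN : IsGradedSubspace (LieSuperalgebra.part (k := k)) N) (hQ : ∀ x ∈ M, ∀ y ∈ N, br (k := k) x y ∈ Q) :
    ops V M C * ops V N D ≤ ops V Q (C * D) ⊔ ops V N D * ops V M C := by
  conv_lhs => rw [hM.eq_iSup, hN.eq_iSup, ops_iSup_left, ops_iSup_left, Submodule.iSup_mul]
  refine iSup_le fun i => ?_
  rw [Submodule.mul_iSup]
  refine iSup_le fun j => ?_
  rw [Submodule.mul_le]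
  intro f hf f' hf'
  have h1 : ops V (M ⊓ LieSuperalgebra.part (k := k) i) C ≤ Submodule.comap (LinearMap.mulRight k f')
      (ops V Q (C * D) ⊔ ops V N D * ops V M C) := by
    refine Submodule.map₂_le.mpr fun x hx a ha => ?_
    have h2 : ops V (N ⊓ LieSuperalgebra.part (k := k) j) D ≤
        Submodule.comap (LinearMap.mulLeft k (actMap k g A V x a))
          (ops V Q (C * D) ⊔ ops V N D * ops V M C) := by
      refine Submodule.map₂_le.mpr fun y hy b hb => ?_
      rw [Submodule.mem_comap, LinearMap.mulLeft_apply, actMap_mul hx.2 hy.2]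
      exact Submodule.add_mem_sup (actMap_mem_ops (hQ x hx.1 y hy.1) (Submodule.mul_mem_mul ha hb))
        (Submodule.smul_of_tower_mem _ _
          (Submodule.mul_mem_mul (actMap_mem_ops hy.1 hb) (actMap_mem_ops hx.1 ha)))
    exact h2 hf'
  exact h1 hf

lemma isGradedSubspace_ops_smul (hN : IsGradedSubspace (LieSuperalgebra.part (k := k)) N)
    (hW : IsGradedSubspace (part (k := k) (L := g ⊗[k] A) (V := V)) W) :
    IsGradedSubspace (part (k := k) (L := g ⊗[k] A) (V := V)) (ops V N C • W) := by
  have h : ops V N C • W = ⨆ i, ⨆ j, ops V (N ⊓ LieSuperalgebra.part (k := k) i) C •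
      (W ⊓ part (k := k) (L := g ⊗[k] A) (V := V) j) := by
    conv_lhs => rw [hN.eq_iSup, hW.eq_iSup, ops_iSup_left, Submodule.iSup_smul]
    simp_rw [Submodule.smul_iSup]
  rw [h]
  refine .iSup fun i => .iSup fun j => .of_le (i := i + j) ?_
  exact ops_smul_le.mpr fun x hx a _ w hw => act_mem i j _ w (tmul_mem_mapPart hx.2 a) hw.2

lemma isGradedSubspace_opClosure (hN : IsGradedSubspace (LieSuperalgebra.part (k := k)) N)
    (hW : IsGradedSubspace (part (k := k) (L := g ⊗[k] A) (V := V)) W) :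
    IsGradedSubspace (part (k := k) (L := g ⊗[k] A) (V := V)) (Submodule.opClosure (ops V N C) W) := by
  refine .iSup fun n => ?_
  induction n with
  | zero => rwa [pow_zero, Submodule.one_smul]
  | succ n ih => rw [Submodule.op_pow_succ_smul]; exact isGradedSubspace_ops_smul hN ih

/-- A subspace is stable under `g ⊗ A` if it is stable under pure tensors. -/
lemma act_mem_of_ops_smul_le (h : ops V (⊤ : Submodule k g) (⊤ : Submodule k A) • W ≤ W)
    (x : g ⊗[k] A) {w : V} (hw : w ∈ W) : act (k := k) x w ∈ W := by
  induction x with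
  | zero => simp
  | tmul x a => exact h (act_mem_smul trivial trivial hw)
  | add x y hx hy => rw [map_add, LinearMap.add_apply]; exact add_mem hx hy

end Ops

end LieSupermodule

/-! ### The submodule generated by a primitive vector; inner gradings -/

namespace LieSupermodule

open LieSuperalgebra Submodule

section Primitive

variable {k g : Type*} [Field k] [CharZero k] [AddCommGroup g] [Module k g] [LieSuperalgebra k g]
  (T : TriangularDecomposition k g)
  {A V : Type*} [CommRing A] [Algebra k A] [AddCommGroup V] [Module k V]
  [LieSupermodule k (g ⊗[k] A) V]

/-- A nonzero vector killed by `n⁺ ⊗ A` on which `h ⊗ A` acts by `ψ`. -/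
structure IsPrimitiveVector (ψ : Module.Dual k (T.h ⊗[k] A)) (v : V) : Prop where
  ne_zero : v ≠ 0
  nPlus_act : ∀ x ∈ T.nPlus, ∀ a : A, act (k := k) (x ⊗ₜ[k] a) v = 0
  h_act : ∀ (x : T.h) (a : A), act (k := k) ((x : g) ⊗ₜ[k] a) v = ψ (x ⊗ₜ a) • v

variable (A) in
/-- The subspace generated by `v` under the negative root spaces of degree zero. -/
def topPart (v : V) : Submodule k V := opClosure (ops V T.negZero (⊤ : Submodule k A)) (span k {v})

variable (A) in
/-- The subspace generated by `v` under `n⁻ ⊗ A`. -/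
def fullPart (v : V) : Submodule k V := opClosure (ops V T.negDeg (⊤ : Submodule k A)) (topPart T A v)

variable (A) in
/-- The part of the module generated by `v` that lies below the top. -/
def lowerPart (v : V) : Submodule k V := ops V T.negDeg (⊤ : Submodule k A) • fullPart T A v

variable {T} {ψ : Module.Dual k (T.h ⊗[k] A)} {v : V}

lemma mem_topPart : v ∈ topPart T A v := le_opClosure (mem_span_singleton_self v)

lemma topPart_le_fullPart : topPart T A v ≤ fullPart T A v := le_opClosure

lemma lowerPart_le_fullPart : lowerPart T A v ≤ fullPart T A v := smul_opClosure_le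

lemma deg_zero_le_part : T.deg 0 ≤ LieSuperalgebra.part (k := k) 0 := by
  simpa using T.deg_le_part 0

lemma isGradedSubspace_negDeg : IsGradedSubspace (LieSuperalgebra.part (k := k)) T.negDeg :=
  .iSup fun i => .of_le (T.deg_le_part i)

lemma isGradedSubspace_posDeg : IsGradedSubspace (LieSuperalgebra.part (k := k)) T.posDeg :=
  .iSup fun i => .of_le (T.deg_le_part i)

lemma isGradedSubspace_nPlus : IsGradedSubspace (LieSuperalgebra.part (k := k)) T.nPlus :=
  .sup (.iSup fun m => .of_le ((T.zeroPart_le_deg m).trans deg_zero_le_part)) isGradedSubspace_posDeg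

lemma isGradedSubspace_nMinus : IsGradedSubspace (LieSuperalgebra.part (k := k)) T.nMinus :=
  .sup (.iSup fun m => .of_le ((T.zeroPart_le_deg m).trans deg_zero_le_part)) isGradedSubspace_negDeg

/-- Commuting operators from the degree zero part past operators from a stable subspace. -/
lemma ops_deg_zero_mul_le {N : Submodule k g} (hN : ∀ x ∈ T.deg 0, ∀ y ∈ N, br (k := k) x y ∈ N) :
    ops V (T.deg 0) (⊤ : Submodule k A) * ops V N (⊤ : Submodule k A) ≤
      ops V N (⊤ : Submodule k A) ⊔ ops V N (⊤ : Submodule k A) * ops V (T.deg 0) (⊤ : Submodule k A) :=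
  (ops_mul_ops_le_of_even deg_zero_le_part hN).trans (sup_le_sup (ops_mono le_rfl le_top) le_rfl)

section

variable (hv : IsPrimitiveVector T ψ v)
include hv

/-- Commutators of degree zero operators with those of `negZero` again have degree zero. On `v`
itself, `h` acts by scalars and `posZero` by zero. -/
lemma ops_deg_zero_smul_topPart :
    ops V (T.deg 0) (⊤ : Submodule k A) • topPart T A v ≤ topPart T A v := by
  refine smul_opClosure_le_of_mul_le ?_ ?_ smul_opClosure_le
  · exact (ops_mul_ops_le_of_even deg_zero_le_part fun x hx y hy =>
      T.br_deg_zero_deg_zero hx (T.negZero_le_deg hy)).trans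
      (sup_le_sup (ops_mono le_rfl le_top) le_rfl)
  · refine (smul_mono (ops_mono T.deg_zero_le le_rfl) le_rfl).trans ?_
    rw [ops_sup_left, ops_sup_left, sup_smul, sup_smul]
    refine sup_le (sup_le ((smul_mono le_rfl le_opClosure).trans smul_opClosure_le) ?_) ?_
    · refine ops_smul_le.mpr fun x hx a _ w hw => ?_
      obtain ⟨c, rfl⟩ := mem_span_singleton.mp hw
      rw [map_smul, hv.h_act ⟨x, hx⟩ a]
      exact smul_mem _ _ (smul_mem _ _ mem_topPart)
    · refine ops_smul_le.mpr fun x hx a _ w hw => ?_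
      obtain ⟨c, rfl⟩ := mem_span_singleton.mp hw
      rw [map_smul, hv.nPlus_act x ((le_sup_left : T.posZero ≤ T.nPlus) hx) a, smul_zero]
      exact zero_mem _

/-- `[posDeg, negZero] ⊆ posDeg`, and `posDeg` kills `v`. -/
lemma ops_posDeg_smul_topPart : ops V T.posDeg (⊤ : Submodule k A) • topPart T A v ≤ ⊥ := by
  refine smul_opClosure_le_of_mul_le ?_ ?_ (by simp)
  · refine (ops_mul_ops_le isGradedSubspace_posDeg
      (.of_le (T.negZero_le_deg.trans deg_zero_le_part)) (Q := T.posDeg) fun x hx y hy => ?_).trans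
      (sup_le_sup (ops_mono le_rfl le_top) le_rfl)
    refine (iSup_le fun i => ?_ : T.posDeg ≤ T.posDeg.comap ((br (k := k) (L := g)).flip y)) hx
    intro x hx
    refine T.deg_le_posDeg i.2 ?_
    simpa using T.deg_br_mem i 0 x y hx (T.negZero_le_deg hy)
  · refine ops_smul_le.mpr fun x hx a _ w hw => ?_
    obtain ⟨c, rfl⟩ := mem_span_singleton.mp hw
    rw [map_smul, hv.nPlus_act x ((le_sup_right : T.posDeg ≤ T.nPlus) hx) a, smul_zero]
    exact zero_mem _

/-- Commuting past `negDeg` produces elements of `g` again, so only the action on the top part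
counts: `deg 0` preserves it and `posDeg` kills it. -/
lemma ops_top_smul_fullPart :
    ops V (⊤ : Submodule k g) (⊤ : Submodule k A) • fullPart T A v ≤ fullPart T A v := by
  refine smul_opClosure_le_of_mul_le ?_ ?_ smul_opClosure_le
  · exact (ops_mul_ops_le (.top (LieSuperalgebra.isCompl (k := k))) isGradedSubspace_negDeg
      fun _ _ _ _ => mem_top).trans (sup_le_sup (ops_mono le_rfl le_top) le_rfl)
  · refine (smul_mono (ops_mono T.top_le le_rfl) le_rfl).trans ?_
    rw [ops_sup_left, ops_sup_left, sup_smul, sup_smul]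
    refine sup_le (sup_le ((smul_mono le_rfl le_opClosure).trans smul_opClosure_le) ?_) ?_
    · exact (ops_deg_zero_smul_topPart hv).trans le_opClosure
    · exact (ops_posDeg_smul_topPart hv).trans bot_le

end

lemma ops_negDeg_smul_lowerPart :
    ops V T.negDeg (⊤ : Submodule k A) • lowerPart T A v ≤ lowerPart T A v :=
  smul_mono le_rfl lowerPart_le_fullPart

lemma ops_deg_zero_smul_lowerPart (hv : IsPrimitiveVector T ψ v) :
    ops V (T.deg 0) (⊤ : Submodule k A) • lowerPart T A v ≤ lowerPart T A v := by
  rw [lowerPart, ← Submodule.smul_assoc, smul_eq_mul]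
  refine (smul_mono (ops_deg_zero_mul_le fun x hx y hy => T.br_deg_zero_negDeg hx hy) le_rfl).trans ?_
  rw [sup_smul, ← smul_eq_mul, Submodule.smul_assoc]
  exact sup_le le_rfl (smul_mono le_rfl
    ((smul_mono (ops_mono le_top le_rfl) le_rfl).trans (ops_top_smul_fullPart hv)))

omit [CharZero k] in
/-- Weight vectors shift eigenvalues. -/
lemma act_mem_eigenspace {z : g} (hz : z ∈ LieSuperalgebra.part (k := k) 0) {x : g} {c μ ν : k}
    (hx : br (k := k) z x = c • x) (a : A) {w : V}
    (hw : w ∈ (actMap k g A V z 1).eigenspace μ) (hν : ν = μ + c) :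
    act (k := k) (x ⊗ₜ[k] a) w ∈ (actMap k g A V z 1).eigenspace ν := by
  rw [Module.End.mem_eigenspace_iff, actMap_apply] at hw ⊢
  rw [act_act_of_even hz, hx, hw, one_mul, map_smul, ← TensorProduct.smul_tmul', map_smul,
    LinearMap.smul_apply, hν, add_smul, add_comm]

/-- `z` commutes with all operators that generate the top part from `v`. -/
lemma topPart_le_eigenspace (hv : IsPrimitiveVector T ψ v) {z : g} (hz : z ∈ T.h)
    (hz0 : ∀ x ∈ T.deg 0, br (k := k) z x = 0) :
    topPart T A v ≤ (actMap k g A V z 1).eigenspace (ψ (⟨z, hz⟩ ⊗ₜ 1)) := by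
  refine opClosure_le ?_ (ops_smul_le.mpr fun x hx a _ w hw => ?_)
  · rw [span_singleton_le_iff_mem, Module.End.mem_eigenspace_iff]
    exact hv.h_act ⟨z, hz⟩ 1
  · exact act_mem_eigenspace (T.h_le_even hz) (c := 0) (by simp [hz0 x (T.negZero_le_deg hx)]) a hw
      (by simp)

/-- If the grading is inner then the lower part is a sum of eigenspaces that do not contain `v`. -/
lemma lowerPart_le_iSup_eigenspace (hv : IsPrimitiveVector T ψ v) {z : g} (hz : z ∈ T.h)
    (hzi : ∀ i, ∀ x ∈ T.deg i, br (k := k) z x = (i : k) • x) :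
    lowerPart T A v ≤ ⨆ n : ℕ,
      (actMap k g A V z 1).eigenspace (ψ (⟨z, hz⟩ ⊗ₜ 1) - (n + 1 : ℕ)) := by
  set E := (actMap k g A V z 1).eigenspace
  set c := ψ (⟨z, hz⟩ ⊗ₜ 1)
  have key : ∀ i : ℤ, i < 0 → ∀ x ∈ T.deg i, ∀ a : A, ∀ n : ℕ, ∀ w ∈ E (c - n),
      act (k := k) (x ⊗ₜ[k] a) w ∈ ⨆ n : ℕ, E (c - (n + 1 : ℕ)) := by
    intro i hi x hx a n w hw
    obtain ⟨j, rfl⟩ : ∃ j : ℕ, i = -(j + 1 : ℕ) := ⟨(-i - 1).toNat, by omega⟩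
    refine mem_iSup_of_mem (n + j) (act_mem_eigenspace (T.h_le_even hz) (hzi _ x hx) a hw ?_)
    push_cast
    ring
  have key2 : ops V T.negDeg (⊤ : Submodule k A) • (⨆ n : ℕ, E (c - n)) ≤
      ⨆ n : ℕ, E (c - (n + 1 : ℕ)) := by
    rw [TriangularDecomposition.negDeg, ops_iSup_left, iSup_smul]
    refine iSup_le fun i => ?_
    rw [smul_iSup]
    exact iSup_le fun n => ops_smul_le.mpr fun x hx a _ w hw => key i i.2 x hx a n w hw
  refine (smul_mono le_rfl (opClosure_le ?_ ?_)).trans key2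
  · refine (topPart_le_eigenspace hv hz fun x hx => by simp [hzi 0 x hx]).trans ?_
    refine le_iSup_of_le 0 ?_
    simp [E, c]
  · exact key2.trans (iSup_le fun n => le_iSup (fun n : ℕ => E (c - n)) (n + 1))

/-- The eigenvalues of `z` on the lower part differ from that of `v` by positive integers, which are
nonzero in characteristic zero. -/
lemma notMem_lowerPart_of_inner (hv : IsPrimitiveVector T ψ v) {z : g} (hz : z ∈ T.h)
    (hzi : ∀ i, ∀ x ∈ T.deg i, br (k := k) z x = (i : k) • x) : v ∉ lowerPart T A v := by
  intro h
  refine hv.ne_zero ?_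
  have h1 := lowerPart_le_iSup_eigenspace hv hz hzi h
  have := Module.End.mem_of_mem_iSup_eigenspace_sup (f := actMap k g A V z 1) (U := ⊥)
    (μ := ψ (⟨z, hz⟩ ⊗ₜ 1)) (v := v) (by simp) (hv.h_act ⟨z, hz⟩ 1)
    (ν := fun n : ℕ => ψ (⟨z, hz⟩ ⊗ₜ 1) - (n + 1 : ℕ)) (fun n hn => ?_) (fun n => le_rfl)
    (by rwa [sup_bot_eq])
  · simpa using this
  · have h2 : ((n + 1 : ℕ) : k) = 0 := by simpa using hn
    exact Nat.succ_ne_zero n (by exact_mod_cast h2)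

end Primitive

end LieSupermodule

/-! ### Primitive vectors when there are no pieces of degree `± 2` -/

namespace LieSupermodule

open LieSuperalgebra Submodule

section Localization

variable {k g : Type*} [Field k] [AddCommGroup g] [Module k g] [LieSuperalgebra k g]
  {A V : Type*} [CommRing A] [Algebra k A] [AddCommGroup V] [Module k V]
  [LieSupermodule k (g ⊗[k] A) V]

/-- An additional operator `x ⊗ a` only enlarges the finite dimensional coefficient space `C` by
`a`. -/
lemma ops_smul_iSup_fg_le (N : Submodule k g) {W : Submodule k A → Submodule k V} (hW : Monotone W) :
    ops V N (⊤ : Submodule k A) • (⨆ C : {C : Submodule k A // C.FG}, W C) ≤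
      ⨆ C : {C : Submodule k A // C.FG}, ops V N C.1 • W C := by
  rw [smul_iSup]
  refine iSup_le fun C => ops_smul_le.mpr fun x hx a _ w hw => ?_
  refine mem_iSup_of_mem ⟨C.1 ⊔ span k {a}, C.2.sup (fg_span_singleton a)⟩ ?_
  exact act_mem_smul hx (mem_sup_right (mem_span_singleton_self a)) (hW le_sup_left hw)

lemma opClosure_iSup_fg_le (N : Submodule k g) {W : Submodule k A → Submodule k V}
    (hW : Monotone W) :
    opClosure (ops V N (⊤ : Submodule k A)) (⨆ C : {C : Submodule k A // C.FG}, W C) ≤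
      ⨆ C : {C : Submodule k A // C.FG}, opClosure (ops V N C.1) (W C) := by
  refine opClosure_le (iSup_mono fun C => le_opClosure) ?_
  refine (ops_smul_iSup_fg_le N (W := fun C => opClosure (ops V N C) (W C))
    fun C D h => opClosure_mono (ops_mono le_rfl h) (hW h)).trans (iSup_mono fun C => ?_)
  exact smul_opClosure_le

lemma fg_ops [FiniteDimensional k g] (N : Submodule k g) {C : Submodule k A} (hC : C.FG) :
    (ops V N C).FG := (IsNoetherian.noetherian N).map₂ _ hC

end Localization

variable {k g : Type*} [Field k] [CharZero k] [AddCommGroup g] [Module k g] [LieSuperalgebra k g]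
  {T : TriangularDecomposition k g}
  {A V : Type*} [CommRing A] [Algebra k A] [AddCommGroup V] [Module k V]
  [LieSupermodule k (g ⊗[k] A) V] {ψ : Module.Dual k (T.h ⊗[k] A)} {v : V}

/-- Nilpotency needs finitely many operators, while `A` may be infinite dimensional; but one
membership involves only finitely many elements of `A`. -/
lemma exists_fg_of_mem_lowerPart (h : v ∈ lowerPart T A v) : ∃ C : Submodule k A, C.FG ∧
    v ∈ ops V T.negDeg C • opClosure (ops V T.negDeg C) (opClosure (ops V T.negZero C) (span k {v})) := by
  let W : Submodule k A → Submodule k V := fun C => opClosure (ops V T.negZero C) (span k {v})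
  have hW : Monotone W := fun C D h => opClosure_mono (ops_mono le_rfl h) le_rfl
  let W' : Submodule k A → Submodule k V := fun C => opClosure (ops V T.negDeg C) (W C)
  have hW' : Monotone W' := fun C D h => opClosure_mono (ops_mono le_rfl h) (hW h)
  have h1 : topPart T A v ≤ ⨆ C : {C : Submodule k A // C.FG}, W C := by
    have h := opClosure_iSup_fg_le (V := V) T.negZero
      (monotone_const : Monotone fun _ : Submodule k A => span k {v})
    have hne : Nonempty {C : Submodule k A // C.FG} := ⟨⟨⊥, fg_bot⟩⟩
    rwa [iSup_const] at h
  have h2 : fullPart T A v ≤ ⨆ C : {C : Submodule k A // C.FG}, W' C :=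
    (opClosure_mono le_rfl h1).trans (opClosure_iSup_fg_le T.negDeg hW)
  have h3 := ((smul_mono le_rfl h2).trans (ops_smul_iSup_fg_le T.negDeg hW')) h
  have hne : Nonempty {C : Submodule k A // C.FG} := ⟨⟨⊥, fg_bot⟩⟩
  rw [mem_iSup_of_directed] at h3
  · obtain ⟨C, hC⟩ := h3
    exact ⟨C.1, C.2, hC⟩
  · intro C D
    exact ⟨⟨C.1 ⊔ D.1, C.2.sup D.2⟩, smul_mono (ops_mono le_rfl le_sup_left) (hW' le_sup_left),
      smul_mono (ops_mono le_rfl le_sup_right) (hW' le_sup_right)⟩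

/-- The operators of negative degree anticommute if there are no pieces of degree `-2`. -/
lemma anticommute_of_mem_ops_negDeg (hdeg : ∀ i : ℤ, 1 < |i| → T.deg i = ⊥) {f f' : Module.End k V}
    (hf : f ∈ ops V T.negDeg (⊤ : Submodule k A)) (hf' : f' ∈ ops V T.negDeg (⊤ : Submodule k A)) :
    f * f' = -(f' * f) := by
  -- Only degree `-1` remains; it is odd and its brackets lie in degree `-2`, so the
  -- supercommutators vanish.
  have hneg : T.negDeg ≤ T.deg (-1) := by
    refine iSup_le fun i => ?_
    rcases eq_or_ne i.1 (-1) with h | h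
    · rw [h]
    · rw [hdeg i (by have := i.2; rw [abs_of_neg i.2]; omega)]
      exact bot_le
  have hodd : T.deg (-1) ≤ LieSuperalgebra.part (k := k) 1 := by
    have := T.deg_le_part (-1)
    rwa [show ((-1 : ℤ) : ZMod 2) = 1 by decide] at this
  have key : ∀ x ∈ T.negDeg, ∀ y ∈ T.negDeg, ∀ a b : A,
      actMap k g A V x a * actMap k g A V y b = -(actMap k g A V y b * actMap k g A V x a) := by
    intro x hx y hy a b
    have hxy := T.deg_br_mem (-1) (-1) x y (hneg hx) (hneg hy)
    rw [hdeg _ (by norm_num), mem_bot] at hxy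
    rw [actMap_mul (hodd (hneg hx)) (hodd (hneg hy)), hxy]
    simp [koszulSign]
  let L : Module.End k V →ₗ[k] Module.End k V →ₗ[k] Module.End k V :=
    LinearMap.mul k _ + (LinearMap.mul k _).flip
  have h1 : ops V T.negDeg (⊤ : Submodule k A) ≤ LinearMap.ker (L.flip f') := by
    refine map₂_le.mpr fun x hx a _ => ?_
    have h2 : ops V T.negDeg (⊤ : Submodule k A) ≤ LinearMap.ker (L (actMap k g A V x a)) := by
      refine map₂_le.mpr fun y hy b _ => ?_
      simp [L, key x hx y hy a b]
    exact h2 hf'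
  have := h1 hf
  rw [LinearMap.mem_ker] at this
  exact eq_neg_of_add_eq_zero_left this

/-- Weights do not help here, since they may vanish on elements of negative degree. Instead, a
finitely generated space `F` of anticommuting operators is chosen that is stable under commutators
with `Y`. Let `W` be generated from `v` by `Y` and then `F`. If `v ∈ F • W`, then `W ≤ F • W`, and
nilpotency of `F` gives `W = 0`. -/
lemma notMem_lowerPart_of_deg_eq_bot (hT : T.IsSplit) (hdeg : ∀ i : ℤ, 1 < |i| → T.deg i = ⊥)
    (hv : IsPrimitiveVector T ψ v) : v ∉ lowerPart T A v := by
  intro h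
  have := hT.finiteDimensional
  obtain ⟨C, hC, hvC⟩ := exists_fg_of_mem_lowerPart h
  obtain ⟨r, hr⟩ := hT.exists_iterate_br_negZero_eq_bot
  let φ : Submodule k g → Submodule k g := map₂ (br (k := k) (L := g)) T.negZero
  have hφ : Monotone φ := fun N N' h => map₂_le_map₂_right h
  let N : ℕ → Submodule k g := fun j => φ^[j] T.negDeg
  have hN : ∀ j, N (j + 1) = φ (N j) := fun j => Function.iterate_succ_apply' _ _ _
  have hNr : N r = ⊥ := eq_bot_iff.mpr ((hφ.iterate r le_top).trans hr.le)
  have hNneg : ∀ j, N j ≤ T.negDeg := by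
    intro j
    induction j with
    | zero => exact le_rfl
    | succ j ih =>
      rw [hN]
      exact map₂_le.mpr fun x hx y hy => T.br_deg_zero_negDeg (T.negZero_le_deg hx) (ih hy)
  -- After `j` brackets with `negZero ⊗ C` the coefficients lie in `C ^ (j + 1)`. The range `r + 1`
  -- keeps the term `j = 0` even for `r = 0`.
  let F : Submodule k (Module.End k V) := ⨆ j ∈ Finset.range (r + 1), ops V (N j) (C ^ (j + 1))
  have hle : ∀ j < r + 1, ops V (N j) (C ^ (j + 1)) ≤ F := fun j hj =>
    le_iSup₂_of_le (f := fun j (_ : j ∈ Finset.range (r + 1)) => ops V (N j) (C ^ (j + 1))) j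
      (Finset.mem_range.mpr hj) le_rfl
  have hFfg : F.FG := fg_biSup _ _ fun j _ => fg_ops _ (hC.pow _)
  have hFneg : F ≤ ops V T.negDeg (⊤ : Submodule k A) :=
    iSup₂_le fun j _ => ops_mono (hNneg j) le_top
  have hFnil : IsNilpotent F := isNilpotent_of_fg_of_anticommute hFfg fun x hx y hy =>
    anticommute_of_mem_ops_negDeg hdeg (hFneg hx) (hFneg hy)
  have hCF : ops V T.negDeg C ≤ F := by
    have := hle 0 (Nat.succ_pos r)
    rwa [zero_add, pow_one] at this
  let Y := ops V T.negZero C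
  have hYF : Y * F ≤ F ⊔ F * Y := by
    simp only [F, mul_iSup]
    refine iSup₂_le fun j hj => ?_
    refine (ops_mul_ops_le_of_even (Q := N (j + 1)) (T.negZero_le_deg.trans deg_zero_le_part)
      fun x hx y hy => by rw [hN]; exact apply_mem_map₂ _ hx hy).trans (sup_le_sup ?_ ?_)
    · rw [← pow_succ']
      rcases eq_or_ne j r with rfl | hjr
      · have : N (j + 1) = ⊥ := by rw [hN, hNr]; exact map₂_bot_right _ _
        rw [this, ops_bot_left]
        exact bot_le
      · exact hle (j + 1) (by have := Finset.mem_range.mp hj; omega)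
    · exact mul_le_mul' (hle j (Finset.mem_range.mp hj)) le_rfl
  let V₀ := opClosure Y (span k {v})
  let W := opClosure F V₀
  have hvW : v ∈ F • W := smul_mono hCF (opClosure_mono hCF le_rfl) hvC
  have hFW : F • W ≤ W := smul_opClosure_le
  have hYW : Y • W ≤ W := by
    -- Commutators of `Y` with `F` fall into `F` and not into `Y`, so the two are treated together.
    have h1 : (Y ⊔ F) * F ≤ (Y ⊔ F) ⊔ F * (Y ⊔ F) := by
      rw [Submodule.sup_mul]
      refine sup_le (hYF.trans (sup_le_sup le_sup_right (mul_le_mul' le_rfl le_sup_left)))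
        (le_sup_of_le_right (mul_le_mul' le_rfl le_sup_right))
    refine (smul_mono_left le_sup_left).trans (smul_opClosure_le_of_mul_le h1 ?_ hFW)
    rw [sup_smul]
    exact sup_le (smul_opClosure_le.trans le_opClosure) ((smul_mono le_rfl le_opClosure).trans hFW)
  -- `F • W` contains `v` and is stable under `Y`, so it contains `V₀`; being stable under `F`, it
  -- contains `W`.
  have hV₀ : V₀ ≤ F • W := by
    refine opClosure_le (by rwa [span_singleton_le_iff_mem]) ?_
    rw [← Submodule.smul_assoc, smul_eq_mul]
    refine (smul_mono hYF le_rfl).trans ?_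
    rw [sup_smul, ← smul_eq_mul, Submodule.smul_assoc]
    exact sup_le le_rfl (smul_mono le_rfl hYW)
  have hWF : W ≤ F • W := opClosure_le hV₀ (smul_mono le_rfl hFW)
  have hW := eq_bot_of_le_smul hFnil hWF
  have := hFW hvW
  rw [hW, mem_bot] at this
  exact hv.ne_zero this

/-- A primitive vector does not lie below the top part that it generates. -/
lemma notMem_lowerPart (hT : T.IsSplit) (hv : IsPrimitiveVector T ψ v) : v ∉ lowerPart T A v := by
  rcases hT.inner with h | ⟨z, hz, hzi⟩
  · exact notMem_lowerPart_of_deg_eq_bot hT h hv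
  · exact notMem_lowerPart_of_inner hv hz hzi

end LieSupermodule

/-! ### From `ψ(h ⊗ I) = 0` to `(g ⊗ I) V = 0` -/

namespace LieSupermodule

open LieSuperalgebra Submodule

variable {k g : Type*} [Field k] [CharZero k] [AddCommGroup g] [Module k g] [LieSuperalgebra k g]
  {T : TriangularDecomposition k g}
  {A V : Type*} [CommRing A] [Algebra k A] [AddCommGroup V] [Module k V]
  [LieSupermodule k (g ⊗[k] A) V] {ψ : Module.Dual k (T.h ⊗[k] A)} {v : V}

/-- A primitive vector does not lie in the subspace generated by vectors of lower weight. -/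
lemma opClosure_nMinus_ne_top (hT : T.IsSplit) (hv : IsPrimitiveVector T ψ v) :
    v ∉ opClosure (ops V T.nMinus (⊤ : Submodule k A))
      (ops V T.nMinus (⊤ : Submodule k A) • span k {v}) := by
  set E := (actMap k g A V (T.d : g) 1).eigenspace
  set c := ψ (T.dh ⊗ₜ 1)
  let B₀ : ℕ → Submodule k V := fun n => topPart T A v ⊓ E (c - n)
  have hd := deg_zero_le_part (T.h_le_deg_zero T.d_mem_h)
  have hB₀ : ops V T.negZero (⊤ : Submodule k A) • (⨆ n, B₀ n) ≤ ⨆ n, B₀ (n + 1) := by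
    rw [TriangularDecomposition.negZero, ops_iSup_left, iSup_smul]
    refine iSup_le fun m => ?_
    rw [smul_iSup]
    refine iSup_le fun n => ops_smul_le.mpr fun x hx a _ w hw => ?_
    obtain ⟨j, hj⟩ : ∃ j : ℕ, (m : ℤ) = -(j + 1 : ℕ) := ⟨(-(m : ℤ) - 1).toNat, by have := m.2; omega⟩
    refine mem_iSup_of_mem (n + j) ⟨?_, ?_⟩
    · exact smul_opClosure_le (act_mem_smul (T.zeroPart_le_negZero m.2 hx) mem_top hw.1)
    · refine act_mem_eigenspace hd (T.mem_zeroPart.mp hx).2 a hw.2 ?_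
      rw [hj]
      push_cast
      ring
  have hneg : ops V T.negDeg (⊤ : Submodule k A) • (⨆ n, B₀ n) ≤ lowerPart T A v :=
    smul_mono le_rfl ((iSup_le fun n => inf_le_left).trans topPart_le_fullPart)
  have hshift : ⨆ n, B₀ (n + 1) ≤ ⨆ n, B₀ n := iSup_le fun n => le_iSup B₀ (n + 1)
  have hv0 : span k {v} ≤ ⨆ n, B₀ n := by
    refine le_iSup_of_le 0 ?_
    rw [span_singleton_le_iff_mem]
    refine ⟨mem_topPart, Module.End.mem_eigenspace_iff.mpr ?_⟩
    rw [Nat.cast_zero, sub_zero]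
    exact hv.h_act T.dh 1
  -- Operators from `n⁻` either lower the eigenvalue of `d` within the top part or lead into the
  -- lower part.
  have hmain : ops V T.nMinus (⊤ : Submodule k A) • (⨆ n, B₀ n) ≤
      (⨆ n, B₀ (n + 1)) ⊔ lowerPart T A v := by
    rw [T.nMinus_eq, ops_sup_left, sup_smul]
    exact sup_le_sup hB₀ hneg
  have hle : opClosure (ops V T.nMinus (⊤ : Submodule k A))
      (ops V T.nMinus (⊤ : Submodule k A) • span k {v}) ≤ (⨆ n, B₀ (n + 1)) ⊔ lowerPart T A v := by
    refine opClosure_le ((smul_mono le_rfl hv0).trans hmain) ?_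
    rw [smul_sup]
    refine sup_le ((smul_mono le_rfl hshift).trans hmain) (le_sup_of_le_right ?_)
    rw [T.nMinus_eq, ops_sup_left, sup_smul]
    exact sup_le ((smul_mono (ops_mono T.negZero_le_deg le_rfl) le_rfl).trans
      (ops_deg_zero_smul_lowerPart hv)) ops_negDeg_smul_lowerPart
  intro h
  refine notMem_lowerPart hT hv ?_
  -- Modulo the lower part, `v` would be a sum of eigenvectors of `d` for eigenvalues other than its
  -- own.
  refine Module.End.mem_of_mem_iSup_eigenspace_sup (f := actMap k g A V (T.d : g) 1) (μ := c)
    (fun u hu => ?_) (hv.h_act T.dh 1) (ν := fun n : ℕ => c - (n + 1 : ℕ)) (fun n hn => ?_)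
    (R := fun n => B₀ (n + 1)) (fun n => inf_le_right) (hle h)
  · exact ops_deg_zero_smul_lowerPart hv
      (act_mem_smul (T.h_le_deg_zero T.d_mem_h) (mem_top : (1 : A) ∈ ⊤) hu)
  · have h2 : ((n + 1 : ℕ) : k) = 0 := by simpa using hn
    exact Nat.succ_ne_zero n (by exact_mod_cast h2)

lemma top_le_nMinus_sup : (⊤ : Submodule k g) ≤ T.nMinus ⊔ (T.h ⊔ T.nPlus) := by
  have h1 := T.top_le
  have h2 := T.deg_zero_le
  rw [T.nMinus_eq, T.nPlus_eq]
  refine h1.trans (sup_le (sup_le (le_sup_of_le_left le_sup_right) (h2.trans (sup_le (sup_le ?_ ?_) ?_)))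
    ?_)
  · exact le_sup_of_le_left le_sup_left
  · exact le_sup_of_le_right le_sup_left
  · exact le_sup_of_le_right (le_sup_of_le_right le_sup_left)
  · exact le_sup_of_le_right (le_sup_of_le_right le_sup_right)

/-- `K = U(n⁻ ⊗ A)(n⁻ ⊗ I) v` is a graded submodule that does not contain `v`, so it vanishes.
Homogeneity of `v` makes `K` graded. -/
lemma act_eq_zero_of_homogeneous (hT : T.IsSplit) (hV : IsIrreducible k (g ⊗[k] A) V)
    (hv : IsPrimitiveVector T ψ v) {i : ZMod 2} (hvi : v ∈ part (k := k) (L := g ⊗[k] A) i)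
    {I : Ideal A} (hI : ∀ x : T.h, ∀ a ∈ I, ψ (x ⊗ₜ[k] a) = 0) (x : g) {a : A} (ha : a ∈ I) :
    act (k := k) (x ⊗ₜ[k] a) v = 0 := by
  let J : Submodule k A := I.restrictScalars k
  set S := ops V T.nMinus J • span k {v} with hS
  set K := opClosure (ops V T.nMinus (⊤ : Submodule k A)) S with hK
  have hb : ∀ y ∈ T.h ⊔ T.nPlus, ∀ b : A, act (k := k) (y ⊗ₜ[k] b) v ∈ span k {v} := by
    intro y hy b
    obtain ⟨y, hy', z, hz, rfl⟩ := mem_sup.mp hy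
    rw [TensorProduct.add_tmul, map_add, LinearMap.add_apply, hv.h_act ⟨y, hy'⟩ b,
      hv.nPlus_act z hz b, add_zero]
    exact smul_mem _ _ (mem_span_singleton_self v)
  have hb0 : ∀ y ∈ T.h ⊔ T.nPlus, ∀ b ∈ I, act (k := k) (y ⊗ₜ[k] b) v = 0 := by
    intro y hy b hb
    obtain ⟨y, hy', z, hz, rfl⟩ := mem_sup.mp hy
    rw [TensorProduct.add_tmul, map_add, LinearMap.add_apply, hv.h_act ⟨y, hy'⟩ b,
      hv.nPlus_act z hz b, add_zero, hI ⟨y, hy'⟩ b hb, zero_smul]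
  have hJS : ops V (⊤ : Submodule k g) J • span k {v} ≤ S := by
    refine (smul_mono (ops_mono (top_le_nMinus_sup (T := T)) le_rfl) le_rfl).trans ?_
    rw [ops_sup_left, sup_smul]
    refine sup_le le_rfl (ops_smul_le.mpr fun y hy b hb w hw => ?_)
    obtain ⟨c, rfl⟩ := mem_span_singleton.mp hw
    rw [map_smul, hb0 y hy b hb, smul_zero]
    exact zero_mem _
  have hgb : IsGradedSubspace (LieSuperalgebra.part (k := k)) (T.h ⊔ T.nPlus) :=
    .sup (.of_le T.h_le_even) isGradedSubspace_nPlus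
  have hKs : ops V (⊤ : Submodule k g) (⊤ : Submodule k A) • K ≤ K := by
    refine smul_opClosure_le_of_mul_le ?_ ?_ smul_opClosure_le
    · exact (ops_mul_ops_le (.top (LieSuperalgebra.isCompl (k := k))) isGradedSubspace_nMinus
        fun _ _ _ _ => mem_top).trans (sup_le_sup (ops_mono le_rfl le_top) le_rfl)
    · refine (smul_mono (ops_mono (top_le_nMinus_sup (T := T)) le_rfl) le_rfl).trans ?_
      rw [ops_sup_left, sup_smul]
      refine sup_le ((smul_mono le_rfl le_opClosure).trans smul_opClosure_le)
        (le_trans ?_ le_opClosure)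
      -- Moving `b⁺ ⊗ A` past `n⁻ ⊗ I` leaves `(g ⊗ I) v` and `(n⁻ ⊗ I)(b⁺ ⊗ A) v`. Both lie in `S`:
      -- `b⁺ ⊗ I` kills `v`, and `b⁺ ⊗ A` multiplies `v` by scalars.
      rw [hS, ← Submodule.smul_assoc, smul_eq_mul]
      refine (smul_mono (ops_mul_ops_le hgb isGradedSubspace_nMinus (Q := ⊤)
        fun _ _ _ _ => mem_top) le_rfl).trans ?_
      rw [sup_smul, ← smul_eq_mul (ops V T.nMinus J), Submodule.smul_assoc]
      refine sup_le ((smul_mono (ops_mono le_rfl ?_) le_rfl).trans hJS) (smul_mono le_rfl ?_)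
      · exact mul_le.mpr fun b _ c hc => I.mul_mem_left b hc
      · refine ops_smul_le.mpr fun y hy b _ w hw => ?_
        obtain ⟨c, rfl⟩ := mem_span_singleton.mp hw
        rw [map_smul]
        exact smul_mem _ _ (hb y hy b)
  have hKg : IsGradedSubspace (part (k := k) (L := g ⊗[k] A)) K :=
    isGradedSubspace_opClosure isGradedSubspace_nMinus (isGradedSubspace_ops_smul
      isGradedSubspace_nMinus (.of_le (i := i) (by rwa [span_singleton_le_iff_mem])))
  rcases hV.2 K hKg fun x w hw => act_mem_of_ops_smul_le hKs x hw with h | h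
  · have hSK : S ≤ K := le_opClosure
    have := hSK (hJS <| act_mem_smul (mem_top : x ∈ ⊤) ha (mem_span_singleton_self v))
    rwa [h, mem_bot] at this
  · refine absurd ?_ (opClosure_nMinus_ne_top hT hv)
    refine opClosure_mono le_rfl (smul_mono (ops_mono le_rfl le_top) le_rfl) (?_ : v ∈ K)
    rw [h]
    trivial

lemma IsHighestWeightVector.isPrimitiveVector (hv : IsHighestWeightVector T ψ v) :
    IsPrimitiveVector T ψ v where
  ne_zero := hv.ne_zero
  nPlus_act := hv.nPlus_act
  h_act x a := by simpa using hv.h_act (x ⊗ₜ a)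

/-- The homogeneous components of a highest weight vector are primitive vectors. -/
lemma IsPrimitiveVector.of_add (hv : IsPrimitiveVector T ψ v) {i : ZMod 2} {u w : V}
    (hu : u ∈ part (k := k) (L := g ⊗[k] A) i) (hw : w ∈ part (k := k) (L := g ⊗[k] A) (i + 1))
    (huw : u + w = v) (hu0 : u ≠ 0) : IsPrimitiveVector T ψ u := by
  have hdisj : ∀ j, Disjoint (part (k := k) (L := g ⊗[k] A) (V := V) j)
      (part (k := k) (L := g ⊗[k] A) (j + 1)) := by
    intro j
    have := (isCompl (k := k) (L := g ⊗[k] A) (V := V)).disjoint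
    fin_cases j
    · exact this
    · exact this.symm
  have hzero : ∀ j, ∀ u' ∈ part (k := k) (L := g ⊗[k] A) (V := V) j,
      ∀ w' ∈ part (k := k) (L := g ⊗[k] A) (V := V) (j + 1), u' + w' = 0 → u' = 0 := by
    intro j u' hu' w' hw' h
    refine disjoint_def.mp (hdisj j) u' hu' ?_
    rw [eq_neg_of_add_eq_zero_left h]
    exact neg_mem hw'
  refine ⟨hu0, fun x hx a => ?_, fun x a => ?_⟩
  · have hx' := isGradedSubspace_nPlus hx
    obtain ⟨x₀, hx₀, x₁, hx₁, rfl⟩ := mem_sup.mp hx'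
    have key : ∀ j, ∀ y ∈ T.nPlus ⊓ LieSuperalgebra.part (k := k) j,
        act (k := k) (y ⊗ₜ[k] a) u = 0 := by
      intro j y hy
      have h := hv.nPlus_act y hy.1 a
      rw [← huw, map_add] at h
      refine hzero (j + i) _ (act_mem j i _ u (tmul_mem_mapPart hy.2 a) hu) _ ?_ h
      rw [add_assoc]
      exact act_mem j (i + 1) _ w (tmul_mem_mapPart hy.2 a) hw
    rw [TensorProduct.add_tmul, map_add, LinearMap.add_apply, key 0 x₀ hx₀, key 1 x₁ hx₁, add_zero]
  · have h := hv.h_act x a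
    rw [← huw, map_add, smul_add] at h
    rw [← sub_eq_zero]
    refine hzero i _ (sub_mem ?_ (smul_mem _ _ hu))
      (act (k := k) ((x : g) ⊗ₜ[k] a) w - ψ (x ⊗ₜ a) • w) (sub_mem ?_ (smul_mem _ _ hw)) ?_
    · simpa using act_mem 0 i _ u (tmul_mem_mapPart (T.h_le_even x.2) a) hu
    · simpa using act_mem 0 (i + 1) _ w (tmul_mem_mapPart (T.h_le_even x.2) a) hw
    · rw [sub_add_sub_comm, h, sub_self]

/-- If `h ⊗ I` acts by zero on a highest weight vector then `g ⊗ I` annihilates the module. -/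
theorem annihilates_of_forall_eq_zero (hT : T.IsSplit) (hV : IsIrreducible k (g ⊗[k] A) V)
    (hv : IsHighestWeightVector T ψ v) {I : Ideal A}
    (hI : ∀ x : T.h, ∀ a ∈ I, ψ (x ⊗ₜ[k] a) = 0) : Annihilates k g V I := by
  have hv' := hv.isPrimitiveVector
  have h0 : ∀ x : g, ∀ a ∈ I, act (k := k) (x ⊗ₜ[k] a) v = 0 := by
    intro x a ha
    have hmem : v ∈ part (k := k) (L := g ⊗[k] A) 0 ⊔ part (k := k) (L := g ⊗[k] A) 1 := by
      rw [(isCompl (k := k) (L := g ⊗[k] A)).sup_eq_top]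
      trivial
    obtain ⟨u, hu, w, hw, huw⟩ := mem_sup.mp hmem
    have hu' : act (k := k) (x ⊗ₜ[k] a) u = 0 := by
      rcases eq_or_ne u 0 with rfl | hne
      · simp
      · exact act_eq_zero_of_homogeneous hT hV (hv'.of_add hu hw huw hne) hu hI x ha
    have hw' : act (k := k) (x ⊗ₜ[k] a) w = 0 := by
      rcases eq_or_ne w 0 with rfl | hne
      · simp
      · exact act_eq_zero_of_homogeneous hT hV
          (hv'.of_add (i := 1) hw hu (by rw [add_comm, huw]) hne) hw hI x ha
    rw [← huw, map_add, hu', hw', add_zero]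
  let J : Submodule k A := I.restrictScalars k
  -- The vectors killed by `g ⊗ I` form a submodule, because `I` is an ideal.
  let W : Submodule k V := ⨅ f : ops V (⊤ : Submodule k g) J, LinearMap.ker f.1
  have hmemW : ∀ w, w ∈ W ↔ ops V (⊤ : Submodule k g) J • span k {w} ≤ ⊥ := by
    intro w
    rw [mem_iInf, Submodule.smul_le]
    constructor
    · intro h f hf u hu
      obtain ⟨c, rfl⟩ := mem_span_singleton.mp hu
      have : f w = 0 := h ⟨f, hf⟩
      simp [this]
    · intro h f
      exact h f.1 f.2 w (mem_span_singleton_self w)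
  have hWt : W = ⊤ := by
    refine hv.generates W ?_ fun x w hw => act_mem_of_ops_smul_le ?_ x hw
    · rw [hmemW]
      refine ops_smul_le.mpr fun x _ a ha u hu => ?_
      obtain ⟨c, rfl⟩ := mem_span_singleton.mp hu
      rw [map_smul, h0 x a ha, smul_zero]
      exact zero_mem _
    · refine Submodule.smul_le.mpr fun f hf u hu => ?_
      rw [hmemW] at hu ⊢
      have hfu : span k {f • u} ≤ ops V (⊤ : Submodule k g) (⊤ : Submodule k A) • span k {u} := by
        rw [span_singleton_le_iff_mem]
        exact smul_mem_smul hf (mem_span_singleton_self u)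
      refine (smul_mono le_rfl hfu).trans ?_
      rw [← Submodule.smul_assoc, smul_eq_mul]
      have hgr : IsGradedSubspace (LieSuperalgebra.part (k := k)) (⊤ : Submodule k g) :=
        .top (LieSuperalgebra.isCompl (k := k))
      refine (smul_mono (ops_mul_ops_le hgr hgr (Q := ⊤) fun _ _ _ _ => mem_top) le_rfl).trans ?_
      rw [sup_smul, ← smul_eq_mul (ops V ⊤ (⊤ : Submodule k A)), Submodule.smul_assoc]
      refine sup_le ((smul_mono (ops_mono le_rfl ?_) le_rfl).trans hu)
        ((smul_mono le_rfl hu).trans (by simp))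
      exact mul_le.mpr fun b hb c _ => I.mul_mem_right c hb
  intro x a ha w
  have : w ∈ W := by rw [hWt]; trivial
  rw [hmemW] at this
  simpa using this (act_mem_smul (mem_top : x ∈ ⊤) ha (mem_span_singleton_self w))

end LieSupermodule

/-! ### From finite dimensional weight spaces to an ideal of finite codimension -/

/-- A linear map to a finite dimensional space whose kernel lies in an ideal bounds the dimension
of the quotient. -/
lemma Ideal.finiteDimensional_quotient_of_ker_le {k A E : Type*} [Field k] [CommRing A] [Algebra k A]
    [AddCommGroup E] [Module k E] [FiniteDimensional k E] {I : Ideal A} (f : A →ₗ[k] E)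
    (h : ∀ a, f a = 0 → a ∈ I) : FiniteDimensional k (A ⧸ I) := by
  let p : A →ₗ[k] A ⧸ I := (Ideal.Quotient.mkₐ k I).toLinearMap
  have : Module.Finite k (A ⧸ LinearMap.ker f) := Module.Finite.equiv f.quotKerEquivRange.symm
  refine Module.Finite.of_surjective ((LinearMap.ker f).liftQ p fun a ha =>
    Ideal.Quotient.eq_zero_iff_mem.mpr (h a (LinearMap.mem_ker.mp ha))) fun y => ?_
  obtain ⟨a, rfl⟩ := Ideal.Quotient.mk_surjective y
  exact ⟨Submodule.Quotient.mk a, rfl⟩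

namespace LieSupermodule

open LieSuperalgebra Submodule

variable {k g : Type*} [Field k] [CharZero k] [AddCommGroup g] [Module k g] [LieSuperalgebra k g]
  {T : TriangularDecomposition k g}
  {A V : Type*} [CommRing A] [Algebra k A] [AddCommGroup V] [Module k V]
  [LieSupermodule k (g ⊗[k] A) V] {ψ : Module.Dual k (T.h ⊗[k] A)} {v : V}

lemma act_mem_weightSpace {i : ℤ} {χ μ : Module.Dual k T.h} {x : g} (hx : x ∈ T.wt i χ) (a : A)
    {w : V} (hw : w ∈ weightSpace T A V μ) :
    act (k := k) (x ⊗ₜ[k] a) w ∈ weightSpace T A V (μ + χ) := fun y =>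
  Module.End.mem_eigenspace_iff.mp (act_mem_eigenspace (T.h_le_even y.2) ((T.mem_wt.mp hx).2 y) a
    (Module.End.mem_eigenspace_iff.mpr (hw y)) rfl)

variable (ψ) in
/-- The weight of a highest weight vector with respect to `h`. -/
def restrictWeight : Module.Dual k T.h := ψ ∘ₗ (TensorProduct.mk k T.h A).flip 1

lemma IsPrimitiveVector.mem_weightSpace (hv : IsPrimitiveVector T ψ v) :
    v ∈ weightSpace T A V (restrictWeight ψ) := fun x => hv.h_act x 1

variable (ψ) in
/-- The largest ideal `I` of `A` such that `ψ` vanishes on `x ⊗ I`. -/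
def coeffIdeal (x : T.h) : Ideal A where
  carrier := {b | ∀ a : A, ψ (x ⊗ₜ (a * b)) = 0}
  zero_mem' a := by simp
  add_mem' := by
    intro b c hb hc a
    rw [mul_add, TensorProduct.tmul_add, map_add, hb a, hc a, add_zero]
  smul_mem' := by
    intro c b hb a
    rw [smul_eq_mul, ← mul_assoc]
    exact hb _

lemma mem_coeffIdeal {x : T.h} {b : A} : b ∈ coeffIdeal ψ x ↔ ∀ a : A, ψ (x ⊗ₜ (a * b)) = 0 :=
  Iff.rfl

/-- For `[x, y]` with `x ∈ n⁺` and `y` a weight vector, `b ↦ (y ⊗ b) v` maps into one weight space.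
Since `(x ⊗ a) v = 0`, its kernel lies in the ideal. Such brackets span `h`. -/
lemma finiteDimensional_quotient_coeffIdeal (hT : T.IsSplit) (hv : IsPrimitiveVector T ψ v)
    (hfin : ∀ μ, FiniteDimensional k (weightSpace T A V μ)) (x : T.h) :
    FiniteDimensional k (A ⧸ coeffIdeal ψ x) := by
  have key : ∀ z ∈ span k {z | z ∈ T.h ∧ ∃ x ∈ T.nPlus, ∃ i χ, ∃ y ∈ T.wt i χ,
      br (k := k) x y = z}, ∃ hz : z ∈ T.h, FiniteDimensional k (A ⧸ coeffIdeal ψ ⟨z, hz⟩) := by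
    intro z hz
    induction hz using span_induction with
    | mem z hz =>
      obtain ⟨hz, x, hx, i, χ, y, hy, rfl⟩ := hz
      refine ⟨hz, ?_⟩
      let f : A →ₗ[k] weightSpace T A V (restrictWeight ψ + χ) :=
        ((actMap k g A V y).flip v).codRestrict _ fun b =>
          act_mem_weightSpace hy b hv.mem_weightSpace
      refine Ideal.finiteDimensional_quotient_of_ker_le f fun b hb => mem_coeffIdeal.mpr fun a => ?_
      have hb' : act (k := k) (y ⊗ₜ[k] b) v = 0 := congrArg Subtype.val hb
      -- Both products of `u ⊗ a` and `y ⊗ b` kill `v`, so their supercommutator does too.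
      have h1 : ∀ j, ∀ u ∈ T.nPlus ⊓ LieSuperalgebra.part (k := k) j,
          act (k := k) (br (k := k) u y ⊗ₜ[k] (a * b)) v = 0 := by
        intro j u hu
        have h2 := congrArg (fun f : Module.End k V => f v)
          (actMap_mul (V := V) hu.2 (T.deg_le_part i (T.wt_le_deg i χ hy)) a b)
        simpa [hb', hv.nPlus_act u hu.1 a] using h2.symm
      have h2 : act (k := k) (br (k := k) x y ⊗ₜ[k] (a * b)) v = 0 := by
        obtain ⟨x₀, hx₀, x₁, hx₁, rfl⟩ := mem_sup.mp (isGradedSubspace_nPlus hx)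
        rw [map_add, LinearMap.add_apply, TensorProduct.add_tmul, map_add, LinearMap.add_apply,
          h1 0 x₀ hx₀, h1 1 x₁ hx₁, add_zero]
      rw [hv.h_act ⟨_, hz⟩ (a * b)] at h2
      exact (smul_eq_zero.mp h2).resolve_right hv.ne_zero
    | zero =>
      refine ⟨zero_mem _, Ideal.finiteDimensional_quotient_of_ker_le (0 : A →ₗ[k] k) fun b _ => ?_⟩
      rw [mem_coeffIdeal]
      intro a
      have : (⟨0, zero_mem _⟩ : T.h) = 0 := rfl
      rw [this, TensorProduct.zero_tmul, map_zero]
    | add y z _ _ hy hz =>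
      obtain ⟨hy, h1⟩ := hy
      obtain ⟨hz, h2⟩ := hz
      refine ⟨add_mem hy hz, Ideal.finiteDimensional_quotient_of_ker_le
        ((Ideal.Quotient.mkₐ k (coeffIdeal ψ ⟨y, hy⟩)).toLinearMap.prod
          (Ideal.Quotient.mkₐ k (coeffIdeal ψ ⟨z, hz⟩)).toLinearMap) fun b hb => ?_⟩
      have hb1 := Ideal.Quotient.eq_zero_iff_mem.mp (congrArg Prod.fst hb)
      have hb2 := Ideal.Quotient.eq_zero_iff_mem.mp (congrArg Prod.snd hb)
      rw [mem_coeffIdeal] at *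
      intro a
      have : (⟨y + z, add_mem hy hz⟩ : T.h) = ⟨y, hy⟩ + ⟨z, hz⟩ := rfl
      rw [this, TensorProduct.add_tmul, map_add, hb1 a, hb2 a, add_zero]
    | smul c y _ hy =>
      obtain ⟨hy, h1⟩ := hy
      refine ⟨smul_mem _ c hy, Ideal.finiteDimensional_quotient_of_ker_le
        (Ideal.Quotient.mkₐ k (coeffIdeal ψ ⟨y, hy⟩)).toLinearMap fun b hb => ?_⟩
      have hb1 := Ideal.Quotient.eq_zero_iff_mem.mp hb
      rw [mem_coeffIdeal] at *
      intro a
      have : (⟨c • y, smul_mem _ c hy⟩ : T.h) = c • ⟨y, hy⟩ := rfl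
      rw [this, ← TensorProduct.smul_tmul', map_smul, hb1 a, smul_zero]
  exact (key x (hT.h_le_span_br_nPlus x.2)).2

/-- If the weight spaces are finite dimensional then the highest weight vanishes on `h ⊗ I` for an
ideal `I` of finite codimension. -/
theorem exists_ideal_of_finiteDimensional_weightSpace (hT : T.IsSplit)
    (hv : IsPrimitiveVector T ψ v) (hfin : ∀ μ, FiniteDimensional k (weightSpace T A V μ)) :
    ∃ I : Ideal A, FiniteDimensional k (A ⧸ I) ∧ ∀ x : T.h, ∀ a ∈ I, ψ (x ⊗ₜ[k] a) = 0 := by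
  have := hT.finiteDimensional
  let b := Module.finBasis k T.h
  have := fun i => finiteDimensional_quotient_coeffIdeal hT hv hfin (b i)
  refine ⟨⨅ i, coeffIdeal ψ (b i), Ideal.finiteDimensional_quotient_of_ker_le
    (LinearMap.pi fun i => (Ideal.Quotient.mkₐ k (coeffIdeal ψ (b i))).toLinearMap)
    fun a ha => ?_, fun x a ha => ?_⟩
  · rw [mem_iInf]
    exact fun i => Ideal.Quotient.eq_zero_iff_mem.mp (congrFun ha i)
  · have h0 : ψ ∘ₗ (TensorProduct.mk k T.h A).flip a = 0 := by
      refine b.ext fun i => ?_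
      have := mem_coeffIdeal.mp (mem_iInf _ |>.mp ha i) 1
      simpa using this
    exact LinearMap.congr_fun h0 x

/-- The weight spaces of a highest weight module are a direct sum decomposition. -/
theorem isInternal_weightSpace [DecidableEq (Module.Dual k T.h)] (hT : T.IsSplit)
    (hv : IsHighestWeightVector T ψ v) : DirectSum.IsInternal (weightSpace T A V) := by
  rw [DirectSum.isInternal_submodule_iff_iSupIndep_and_iSup_eq_top]
  constructor
  · let f : T.h → Module.End k V := fun x => actMap k g A V (x : g) 1
    have hcomm : ∀ x y, Commute (f x) (f y) := by
      intro x y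
      have := actMap_mul_of_even (V := V) (T.h_le_even x.2) (y : g) (1 : A) 1
      rw [hT.br_h x x.2 y y.2, map_zero, LinearMap.zero_apply, zero_add] at this
      exact this
    -- Joint generalized eigenspaces of commuting operators are independent, and they contain the
    -- weight spaces.
    have h1 := Module.End.independent_iInf_maxGenEigenspace_of_forall_mapsTo f fun x y c =>
      Module.End.mapsTo_maxGenEigenspace_of_comm (hcomm y x) c
    refine (h1.comp (f := fun μ : Module.Dual k T.h => (μ : T.h → k)) DFunLike.coe_injective).mono
      fun μ w hw => ?_
    simp only [Function.comp_apply, mem_iInf]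
    intro x
    exact (Module.End.mem_maxGenEigenspace _ _ _).mpr ⟨1, by
      simpa [f, sub_eq_zero] using hw x⟩
  · refine hv.generates _ (mem_iSup_of_mem _ hv.isPrimitiveVector.mem_weightSpace) fun x w hw =>
      act_mem_of_ops_smul_le ?_ x hw
    rw [← hT.iSup_wt, ops_iSup_left, iSup_smul]
    refine iSup_le fun p => ?_
    rw [smul_iSup]
    refine iSup_le fun μ => ops_smul_le.mpr fun x hx a _ w hw => ?_
    exact mem_iSup_of_mem (μ + p.2) (act_mem_weightSpace hx a hw)

end LieSupermodule

/-! ### Finite dimensional eigenspaces under finitely many operators -/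

namespace Submodule

variable {k V : Type*} [Field k] [AddCommGroup V] [Module k V]

/-- The subspaces obtained from `S` by applying at most `n` operators from `P`. -/
def opIter (P : Submodule k (Module.End k V)) (S : Submodule k V) : ℕ → Submodule k V
  | 0 => S
  | n + 1 => opIter P S n ⊔ P • opIter P S n

variable {P : Submodule k (Module.End k V)} {S W : Submodule k V}

lemma opIter_mono : Monotone (opIter P S) := monotone_nat_of_le_succ fun _ => le_sup_left

lemma smul_opIter_le (n : ℕ) : P • opIter P S n ≤ opIter P S (n + 1) := le_sup_right

lemma pow_smul_le_opIter (n : ℕ) : P ^ n • S ≤ opIter P S n := by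
  induction n with
  | zero => rw [pow_zero, Submodule.one_smul]; exact le_rfl
  | succ n ih => rw [op_pow_succ_smul]; exact (smul_mono le_rfl ih).trans (smul_opIter_le n)

lemma fg_opIter (hP : P.FG) (hS : S.FG) (n : ℕ) : (opIter P S n).FG := by
  induction n with
  | zero => exact hS
  | succ n ih => exact ih.sup (hP.op_smul ih)

lemma exists_opClosure_le_opIter (hP : IsNilpotent P) : ∃ n, opClosure P S ≤ opIter P S n := by
  obtain ⟨N, hN⟩ := hP
  refine ⟨N, iSup_le fun n => ?_⟩
  rcases le_total n N with h | h
  · exact (pow_smul_le_opIter n).trans (opIter_mono h)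
  · rw [pow_eq_zero_of_le h hN, zero_eq_bot, bot_smul]
    exact bot_le

/-- `W` is contained in a sum of finite dimensional spaces of eigenvectors of `f` for distinct
eigenvalues. -/
def IsEigenFinite (f : Module.End k V) (W : Submodule k V) : Prop :=
  ∃ w : k → Submodule k V, (∀ μ, (w μ).FG) ∧ W ≤ ⨆ μ, w μ ⊓ f.eigenspace μ

variable {f : Module.End k V}

/-- Independence of the eigenspaces confines the intersection to the single piece `w μ`. -/
lemma IsEigenFinite.exists_fg (h : IsEigenFinite f W) (μ : k) :
    ∃ U : Submodule k V, U.FG ∧ W ⊓ f.eigenspace μ ≤ U := by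
  obtain ⟨w, hw, hW⟩ := h
  refine ⟨w μ, hw μ, fun x hx => ?_⟩
  exact ((Module.End.eigenspaces_iSupIndep f).mem_of_mem_iSup
    (S := fun μ => w μ ⊓ f.eigenspace μ) (fun μ => inf_le_right) hx.2 (hW hx.1)).1

lemma IsEigenFinite.sup {U : Submodule k V} (hW : IsEigenFinite f W) (hU : IsEigenFinite f U) :
    IsEigenFinite f (W ⊔ U) := by
  obtain ⟨w, hw, hW⟩ := hW
  obtain ⟨u, hu, hU⟩ := hU
  refine ⟨fun μ => w μ ⊔ u μ, fun μ => (hw μ).sup (hu μ), sup_le (hW.trans ?_) (hU.trans ?_)⟩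
  · exact iSup_mono fun μ => inf_le_inf_right _ le_sup_left
  · exact iSup_mono fun μ => inf_le_inf_right _ le_sup_right

/-- Finitely many operators that shift the eigenvalues preserve the property. -/
lemma IsEigenFinite.smul (hW : IsEigenFinite f W) {s : Finset k}
    {p : k → Submodule k (Module.End k V)} (hp : ∀ ν, (p ν).FG)
    (hshift : ∀ ν μ, ∀ x ∈ p ν, ∀ w ∈ f.eigenspace μ, x w ∈ f.eigenspace (μ + ν)) :
    IsEigenFinite f ((⨆ ν ∈ s, p ν) • W) := by
  obtain ⟨w, hw, hW⟩ := hW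
  -- Eigenvalue `μ` is reached from `μ - ν` by an operator of shift `ν`.
  refine ⟨fun μ => ⨆ ν ∈ s, p ν • w (μ - ν),
    fun μ => fg_biSup _ _ fun ν _ => (hp ν).op_smul (hw _), ?_⟩
  refine (smul_mono le_rfl hW).trans ?_
  rw [iSup_smul]
  refine iSup_le fun ν => ?_
  rw [iSup_smul]
  refine iSup_le fun hν => ?_
  rw [smul_iSup]
  refine iSup_le fun μ => smul_le.mpr fun x hx u hu => mem_iSup_of_mem (μ + ν) ⟨?_, ?_⟩
  · refine (le_iSup₂_of_le (f := fun ν' (_ : ν' ∈ s) => p ν' • w (μ + ν - ν')) ν hν le_rfl) ?_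
    rw [add_sub_cancel_right]
    exact smul_mem_smul hx hu.1
  · exact hshift ν μ x hx u hu.2

lemma IsEigenFinite.opIter (hW : IsEigenFinite f W)
    (hP : ∀ U, IsEigenFinite f U → IsEigenFinite f (P • U)) (n : ℕ) :
    IsEigenFinite f (opIter P W n) := by
  induction n with
  | zero => exact hW
  | succ n ih => exact ih.sup (hP _ ih)

lemma IsEigenFinite.of_le_iSup {w : ℕ → Submodule k V} (hw : ∀ n, (w n).FG) {e : ℕ → k}
    (he : Function.Injective e) (hW : W ≤ ⨆ n, w n ⊓ f.eigenspace (e n)) : IsEigenFinite f W := by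
  -- By injectivity `e n` determines `n`; the arbitrary values of `invFun` outside the range of `e`
  -- play no role.
  refine ⟨fun μ => w (Function.invFun e μ), fun μ => hw _, hW.trans (iSup_le fun n => ?_)⟩
  refine le_iSup_of_le (e n) ?_
  simp only [Function.leftInverse_invFun he n, le_refl]

end Submodule

/-! ### Finite dimensionality of the weight spaces -/

namespace LieSupermodule

open LieSuperalgebra Submodule

variable {k g : Type*} [Field k] [CharZero k] [AddCommGroup g] [Module k g] [LieSuperalgebra k g]
  {T : TriangularDecomposition k g}
  {A V : Type*} [CommRing A] [Algebra k A] [AddCommGroup V] [Module k V]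
  [LieSupermodule k (g ⊗[k] A) V] {ψ : Module.Dual k (T.h ⊗[k] A)} {v : V}

lemma IsHighestWeightVector.fullPart_eq_top (hv : IsHighestWeightVector T ψ v) :
    fullPart T A v = ⊤ :=
  hv.generates _ (topPart_le_fullPart mem_topPart) fun x _ hw =>
    act_mem_of_ops_smul_le (ops_top_smul_fullPart hv.isPrimitiveVector) x hw

omit [CharZero k] in
-- As `I` acts by zero, coefficients from a finite dimensional complement of `I` suffice.
lemma Annihilates.fg_ops [FiniteDimensional k g] {I : Ideal A} [FiniteDimensional k (A ⧸ I)]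
    (hI : Annihilates k g V I) (N : Submodule k g) : (ops V N (⊤ : Submodule k A)).FG := by
  obtain ⟨C, hC⟩ := Submodule.exists_isCompl (I.restrictScalars k)
  have hCfg : C.FG := by
    have e := Submodule.quotientEquivOfIsCompl _ _ hC
    have : FiniteDimensional k (A ⧸ I.restrictScalars k) := ‹FiniteDimensional k (A ⧸ I)›
    have : FiniteDimensional k C := Module.Finite.equiv e
    exact Module.Finite.iff_fg.mp this
  have h0 : ops V N (I.restrictScalars k) = ⊥ := by
    refine eq_bot_iff.mpr (map₂_le.mpr fun x _ a ha => ?_)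
    rw [mem_bot]
    ext w
    exact hI x a ha w
  rw [← hC.sup_eq_top, ops_sup_right, h0, bot_sup_eq]
  exact LieSupermodule.fg_ops N hCfg

/-- Operators of `negZero` lower the eigenvalue of `d` by at least one each, so at most `n` of them
are needed to reach `c - n`. -/
lemma isEigenFinite_topPart (hv : IsPrimitiveVector T ψ v)
    (hfg : ∀ N : Submodule k g, (ops V N (⊤ : Submodule k A)).FG) :
    IsEigenFinite (actMap k g A V (T.d : g) 1) (topPart T A v) := by
  set E := (actMap k g A V (T.d : g) 1).eigenspace
  set c := ψ (T.dh ⊗ₜ 1)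
  set Q := ops V T.negZero (⊤ : Submodule k A) with hQ
  refine IsEigenFinite.of_le_iSup (w := opIter Q (span k {v})) (e := fun n : ℕ => c - n)
    (fun n => fg_opIter (hfg _) (fg_span_singleton v) n)
    (fun m n h => by simpa using h) (opClosure_le ?_ ?_)
  · refine le_iSup_of_le 0 ?_
    rw [span_singleton_le_iff_mem]
    refine ⟨mem_span_singleton_self v, Module.End.mem_eigenspace_iff.mpr ?_⟩
    simp only [Nat.cast_zero, sub_zero]
    exact hv.h_act T.dh 1
  · have hQ' : ops V T.negZero (⊤ : Submodule k A) = ⨆ m : {m : ℤ // m < 0},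
        ops V (T.zeroPart m) (⊤ : Submodule k A) := ops_iSup_left
    rw [hQ', iSup_smul]
    refine iSup_le fun m => ?_
    rw [smul_iSup]
    refine iSup_le fun n => ops_smul_le.mpr fun x hx a _ w hw => ?_
    obtain ⟨j, hj⟩ : ∃ j : ℕ, (m : ℤ) = -(j + 1 : ℕ) := ⟨(-(m : ℤ) - 1).toNat, by have := m.2; omega⟩
    -- The eigenvalue drops by `j + 1` while only one operator is added; monotonicity of `opIter`
    -- covers the difference.
    refine mem_iSup_of_mem (n + j + 1) ⟨?_, ?_⟩
    · exact opIter_mono (by omega) (smul_opIter_le n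
        (act_mem_smul (T.zeroPart_le_negZero m.2 hx) mem_top hw.1))
    · refine act_mem_eigenspace (T.h_le_even T.d_mem_h) (T.mem_zeroPart.mp hx).2 a hw.2 ?_
      rw [hj]
      push_cast
      ring

/-- The eigenvalues of `d` on `negDeg` have no definite sign, but they are finite in number, so the
operators split into finitely many spaces of fixed shift. -/
lemma IsEigenFinite.ops_negDeg_smul (hT : T.IsSplit)
    (hfg : ∀ N : Submodule k g, (ops V N (⊤ : Submodule k A)).FG) {W : Submodule k V}
    (hW : IsEigenFinite (actMap k g A V (T.d : g) 1) W) :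
    IsEigenFinite (actMap k g A V (T.d : g) 1) (ops V T.negDeg (⊤ : Submodule k A) • W) := by
  have := hT.finiteDimensional
  let E := Module.End.eigenspace (br (k := k) (T.d : g))
  have hfin : {ν : k | E ν ≠ ⊥}.Finite := Module.End.finite_hasEigenvalue _
  have heq : ops V T.negDeg (⊤ : Submodule k A) =
      ⨆ ν ∈ hfin.toFinset, ops V (T.negDeg ⊓ E ν) (⊤ : Submodule k A) := by
    refine le_antisymm ?_ (iSup₂_le fun ν _ => ops_mono inf_le_left le_rfl)
    refine (ops_mono hT.negDeg_le_iSup le_rfl).trans ?_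
    rw [ops_iSup_left]
    refine iSup_le fun ν => ?_
    by_cases hν : E ν = ⊥
    · have : T.negDeg ⊓ E ν = ⊥ := by rw [hν, inf_bot_eq]
      rw [this, ops_bot_left]
      exact bot_le
    · exact le_iSup₂_of_le (f := fun ν (_ : ν ∈ hfin.toFinset) =>
        ops V (T.negDeg ⊓ E ν) (⊤ : Submodule k A)) ν (by simpa using hν) le_rfl
  rw [heq]
  refine hW.smul (fun ν => hfg _) fun ν μ x hx w hw => ?_
  have h1 : ops V (T.negDeg ⊓ E ν) (⊤ : Submodule k A) •
      (actMap k g A V (T.d : g) 1).eigenspace μ ≤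
        (actMap k g A V (T.d : g) 1).eigenspace (μ + ν) :=
    ops_smul_le.mpr fun y hy a _ w hw => act_mem_eigenspace (T.h_le_even T.d_mem_h)
      (Module.End.mem_eigenspace_iff.mp hy.2) a hw rfl
  exact h1 (smul_mem_smul hx hw)

/-- Every weight space lies in one of the pieces obtained by applying boundedly many operators of
negative degree to the top part. -/
lemma exists_weightSpace_le_opIter (hT : T.IsSplit) (hv : IsHighestWeightVector T ψ v)
    (hfg : ∀ N : Submodule k g, (ops V N (⊤ : Submodule k A)).FG) (μ : Module.Dual k T.h) :
    ∃ n, weightSpace T A V μ ≤ opIter (ops V T.negDeg (⊤ : Submodule k A)) (topPart T A v) n := by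
  have htop := hv.fullPart_eq_top
  rcases hT.inner with hdeg | ⟨z, hz, hzi⟩
  -- Anticommuting operators: a bounded number of them already produces the whole module.
  · have hnil := isNilpotent_of_fg_of_anticommute (hfg T.negDeg) fun x hx y hy =>
      anticommute_of_mem_ops_negDeg hdeg hx hy
    obtain ⟨n, hn⟩ := exists_opClosure_le_opIter (S := topPart T A v) hnil
    exact ⟨n, le_trans (le_top.trans htop.ge) hn⟩
  · set U := opIter (ops V T.negDeg (⊤ : Submodule k A)) (topPart T A v) with hU
    set E := (actMap k g A V z 1).eigenspace
    set c := ψ (⟨z, hz⟩ ⊗ₜ 1)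
    -- Inner grading: each negative operator lowers the eigenvalue of `z` by at least one, so `c -
    -- n` is reached with at most `n` of them.
    have hle : (⊤ : Submodule k V) ≤ ⨆ n : ℕ, U n ⊓ E (c - n) := by
      rw [← htop]
      refine opClosure_le ?_ ?_
      · refine le_iSup_of_le 0 (le_inf le_rfl ?_)
        rw [Nat.cast_zero, sub_zero]
        exact topPart_le_eigenspace hv.isPrimitiveVector hz fun x hx => by simp [hzi 0 x hx]
      · have hP : ops V T.negDeg (⊤ : Submodule k A) = ⨆ i : {i : ℤ // i < 0},
            ops V (T.deg i) (⊤ : Submodule k A) := ops_iSup_left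
        rw [hP, iSup_smul]
        refine iSup_le fun i => ?_
        rw [smul_iSup]
        refine iSup_le fun n => ops_smul_le.mpr fun x hx a _ w hw => ?_
        obtain ⟨j, hj⟩ : ∃ j : ℕ, (i : ℤ) = -(j + 1 : ℕ) :=
          ⟨(-(i : ℤ) - 1).toNat, by have := i.2; omega⟩
        refine mem_iSup_of_mem (n + j + 1) ⟨?_, ?_⟩
        · exact opIter_mono (by omega) (smul_opIter_le n
            (act_mem_smul (T.deg_le_negDeg i.2 hx) mem_top hw.1))
        · refine act_mem_eigenspace (T.h_le_even hz) (hzi _ x hx) a hw.2 ?_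
          rw [hj]
          push_cast
          ring
    have hmem : ∀ w ∈ weightSpace T A V μ, w ∈ E (μ ⟨z, hz⟩) := fun w hw =>
      Module.End.mem_eigenspace_iff.mpr (hw ⟨z, hz⟩)
    let S : k → Submodule k V := fun ν => ⨆ n : {n : ℕ // c - n = ν}, U n ⊓ E ν
    have hS : (⊤ : Submodule k V) ≤ ⨆ ν, S ν := hle.trans (iSup_le fun n =>
      le_iSup_of_le (c - n) (le_iSup (fun m : {m : ℕ // c - m = c - n} => U m ⊓ E (c - n)) ⟨n, rfl⟩))
    have hwS : ∀ w ∈ weightSpace T A V μ, w ∈ S (μ ⟨z, hz⟩) := fun w hw =>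
      (Module.End.eigenspaces_iSupIndep (actMap k g A V z 1)).mem_of_mem_iSup
        (S := S) (fun ν => iSup_le fun n => inf_le_right) (hmem w hw) (hS trivial)
    by_cases hn : ∃ n : ℕ, c - n = μ ⟨z, hz⟩
    · obtain ⟨n, hn⟩ := hn
      refine ⟨n, fun w hw => (iSup_le fun m => ?_ : S (μ ⟨z, hz⟩) ≤ U n) (hwS w hw)⟩
      have : (m : ℕ) = n := by
        have := m.2.trans hn.symm
        simpa using this
      rw [this]
      exact inf_le_left
    -- The eigenvalue does not occur, so the weight space is zero and any index would do.
    · refine ⟨0, fun w hw => (iSup_le fun m => ?_ : S (μ ⟨z, hz⟩) ≤ U 0) (hwS w hw)⟩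
      exact absurd ⟨m.1, m.2⟩ hn

/-- If an ideal of finite codimension annihilates a highest weight module then the weight spaces
are finite dimensional. -/
theorem finiteDimensional_weightSpace (hT : T.IsSplit) (hv : IsHighestWeightVector T ψ v)
    {I : Ideal A} [FiniteDimensional k (A ⧸ I)] (hI : Annihilates k g V I)
    (μ : Module.Dual k T.h) : FiniteDimensional k (weightSpace T A V μ) := by
  have := hT.finiteDimensional
  have hfg := fun N => hI.fg_ops N
  obtain ⟨n, hn⟩ := exists_weightSpace_le_opIter hT hv hfg μ
  have h := (isEigenFinite_topPart hv.isPrimitiveVector hfg).opIter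
    (fun U hU => IsEigenFinite.ops_negDeg_smul hT hfg hU) n
  -- Within the bounded piece, the eigenvalue of `d` alone cuts out a finite dimensional space.
  obtain ⟨U, hU, hle⟩ := h.exists_fg (μ T.dh)
  have : FiniteDimensional k U := Module.Finite.iff_fg.mpr hU
  refine Submodule.finiteDimensional_of_le (le_trans (le_inf hn fun w hw => ?_) hle)
  exact Module.End.mem_eigenspace_iff.mpr (hw T.dh)

end LieSupermodule

/-! ### Finite codimension and finitely many maximal ideals -/

namespace Ideal

variable {k A : Type*} [Field k] [CommRing A] [Algebra k A]

/-- An ideal of finite codimension lies in finitely many maximal ideals. -/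
lemma finite_maximalSpectrum_of_finiteDimensional_quotient (I : Ideal A)
    [FiniteDimensional k (A ⧸ I)] : {m : MaximalSpectrum A | I ≤ m.asIdeal}.Finite := by
  have : IsArtinianRing (A ⧸ I) := IsArtinianRing.of_finite k _
  have hr : (Set.range fun m : MaximalSpectrum (A ⧸ I) =>
      m.asIdeal.comap (Ideal.Quotient.mk I)).Finite := Set.finite_range _
  refine Set.Finite.of_finite_image (f := MaximalSpectrum.asIdeal) (hr.subset ?_)
    fun _ _ _ _ h => MaximalSpectrum.ext h
  rintro _ ⟨m, hm, rfl⟩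
  have hcomap : (m.asIdeal.map (Ideal.Quotient.mk I)).comap (Ideal.Quotient.mk I) = m.asIdeal := by
    rw [comap_map_of_surjective' _ Ideal.Quotient.mk_surjective, mk_ker]
    exact sup_eq_left.mpr hm
  have hmax : (m.asIdeal.map (Ideal.Quotient.mk I)).IsMaximal := by
    have := m.isMaximal
    refine (map_eq_top_or_isMaximal_of_surjective _ Ideal.Quotient.mk_surjective
      m.isMaximal).resolve_left fun h => m.isMaximal.ne_top ?_
    rw [← hcomap, h, comap_top]
  exact ⟨⟨_, hmax⟩, hcomap⟩

/-- In a finitely generated algebra, an ideal that lies in finitely many maximal ideals has finite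
codimension. -/
lemma finiteDimensional_quotient_of_finite_maximalSpectrum [Algebra.FiniteType k A] {I : Ideal A}
    (hI : {m : MaximalSpectrum A | I ≤ m.asIdeal}.Finite) : FiniteDimensional k (A ⧸ I) := by
  have hJ : IsJacobsonRing A := isJacobsonRing_of_finiteType (A := k)
  -- In a Jacobson ring a prime is the intersection of the maximal ideals above it. For `P ⊇ I`
  -- these are finite in number, so primality makes one of them equal to `P`.
  have hprime : ∀ P : Ideal A, P.IsPrime → I ≤ P → P.IsMaximal := by
    intro P hP hIP
    have h1 : P.jacobson = P := hJ.out hP.isRadical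
    have h2 : hI.toFinset.inf (fun m => m.asIdeal ⊔ P) ≤ P := by
      conv_rhs => rw [← h1]
      refine le_sInf fun m hm => ?_
      have := Finset.inf_le (f := fun m : MaximalSpectrum A => m.asIdeal ⊔ P)
        (hI.mem_toFinset.mpr (hIP.trans hm.1 : I ≤ (⟨m, hm.2⟩ : MaximalSpectrum A).asIdeal))
      exact this.trans (sup_le le_rfl hm.1)
    obtain ⟨m, -, hm⟩ := (hP.inf_le').mp h2
    have hmP : m.asIdeal = P := m.isMaximal.eq_of_le hP.ne_top (le_sup_left.trans hm)
    exact hmP ▸ m.isMaximal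
  have hnoeth : IsNoetherianRing (A ⧸ I) := Algebra.FiniteType.isNoetherianRing k _
  have hdim : Ring.KrullDimLE 0 (A ⧸ I) := by
    refine Ring.KrullDimLE.mk₀ fun P hP => ?_
    have hmap := map_comap_of_surjective (Ideal.Quotient.mk I) Ideal.Quotient.mk_surjective P
    have hmax := hprime (P.comap (Ideal.Quotient.mk I)) inferInstance (by
      conv_lhs => rw [← mk_ker (I := I)]
      exact comap_mono bot_le)
    rw [← hmap]
    refine (map_eq_top_or_isMaximal_of_surjective _ Ideal.Quotient.mk_surjective
      hmax).resolve_left fun h => hP.ne_top ?_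
    rw [← hmap, h]
  -- Noetherian of dimension zero means Artinian, which for a finitely generated algebra means
  -- finite dimensional.
  have : IsArtinianRing (A ⧸ I) :=
    isArtinianRing_iff_isNoetherianRing_krullDimLE_zero.mpr ⟨hnoeth, hdim⟩
  exact (Module.finite_iff_isArtinianRing k _).mpr this

end Ideal

/-! ### The support, and the theorem -/

namespace LieSupermodule

open LieSuperalgebra

section

variable {k g : Type*} {A : Type*} {V : Type*} [Field k] [AddCommGroup g] [Module k g]
  [LieSuperalgebra k g] [CommRing A] [Algebra k A] [AddCommGroup V] [Module k V]
  [LieSupermodule k (g ⊗[k] A) V]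

lemma Annihilates.le_annihilator {I : Ideal A} (h : Annihilates k g V I) :
    I ≤ annihilator k g A V := le_sSup h

variable (k g A V) in
lemma annihilates_annihilator : Annihilates k g V (annihilator k g A V) := by
  intro x a ha v
  rw [annihilator, sSup_eq_iSup'] at ha
  induction ha using Submodule.iSup_induction' with
  | mem I a ha => exact I.2 x a ha v
  | zero => simp
  | add a b _ _ ha hb => rw [TensorProduct.tmul_add, map_add, LinearMap.add_apply, ha, hb, add_zero]

/-- Over a finitely generated algebra, finite support means that an ideal of finite codimension
annihilates the module. -/
lemma finite_support_iff [Algebra.FiniteType k A] : (support k g A V).Finite ↔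
    ∃ I : Ideal A, FiniteDimensional k (A ⧸ I) ∧ Annihilates k g V I := by
  constructor
  · intro h
    exact ⟨_, Ideal.finiteDimensional_quotient_of_finite_maximalSpectrum h,
      annihilates_annihilator k g A V⟩
  · rintro ⟨I, hI, h⟩
    exact (I.finite_maximalSpectrum_of_finiteDimensional_quotient (k := k)).subset
      fun m hm => h.le_annihilator.trans hm

end

end LieSupermodule

theorem mainTheorem4 {k : Type*} [Field k] [IsAlgClosed k] [CharZero k]
    {g : Type*} [AddCommGroup g] [Module k g] [LieSuperalgebra k g]
    (hg : LieSuperalgebra.IsBasicClassical k g ∨ ∃ n : ℕ, 1 ≤ n ∧ LieSuperalgebra.IsSL k n g)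
    (T : LieSuperalgebra.TriangularDecomposition k g)
    {A : Type*} [CommRing A] [Algebra k A]
    {V : Type*} [AddCommGroup V] [Module k V] [LieSupermodule k (g ⊗[k] A) V]
    (ψ : Module.Dual k (T.h ⊗[k] A))
    (hV : LieSupermodule.IsIrreducibleHighestWeight T V ψ) :
    List.TFAE
      [LieSupermodule.IsQuasifinite T A V,
       ∃ I : Ideal A, FiniteDimensional k (A ⧸ I) ∧ LieSupermodule.Annihilates k g V I,
       ∃ I : Ideal A, FiniteDimensional k (A ⧸ I) ∧
         ∀ (x : T.h), ∀ a ∈ I, ψ (x ⊗ₜ[k] a) = 0] ∧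
    (Algebra.FiniteType k A →
      (LieSupermodule.IsQuasifinite T A V ↔ (LieSupermodule.support k g A V).Finite)) := by
  have hT : T.IsSplit := by
    rcases hg with hg | ⟨n, hn, hg⟩
    · exact LieSuperalgebra.TriangularDecomposition.isSplit_of_isBasicClassical T hg
    · exact LieSuperalgebra.TriangularDecomposition.isSplit_of_isSL T hn hg
  obtain ⟨hirr, v, hv⟩ := hV
  have h13 : LieSupermodule.IsQuasifinite T A V → ∃ I : Ideal A, FiniteDimensional k (A ⧸ I) ∧
      ∀ (x : T.h), ∀ a ∈ I, ψ (x ⊗ₜ[k] a) = 0 := fun h =>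
    LieSupermodule.exists_ideal_of_finiteDimensional_weightSpace hT hv.isPrimitiveVector h.2
  have h32 : (∃ I : Ideal A, FiniteDimensional k (A ⧸ I) ∧
      ∀ (x : T.h), ∀ a ∈ I, ψ (x ⊗ₜ[k] a) = 0) →
      ∃ I : Ideal A, FiniteDimensional k (A ⧸ I) ∧ LieSupermodule.Annihilates k g V I :=
    fun ⟨I, hI, h⟩ => ⟨I, hI, LieSupermodule.annihilates_of_forall_eq_zero hT hirr hv h⟩
  have h21 : (∃ I : Ideal A, FiniteDimensional k (A ⧸ I) ∧ LieSupermodule.Annihilates k g V I) →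
      LieSupermodule.IsQuasifinite T A V := fun ⟨I, hI, h⟩ => by
    classical
    exact ⟨by convert LieSupermodule.isInternal_weightSpace hT hv,
      fun μ => LieSupermodule.finiteDimensional_weightSpace hT hv h μ⟩
  refine ⟨?_, fun hA => ?_⟩
  · tfae_have 1 → 3 := h13
    tfae_have 3 → 2 := h32
    tfae_have 2 → 1 := h21
    tfae_finish
  · rw [LieSupermodule.finite_support_iff]
    exact ⟨fun h => h32 (h13 h), h21⟩
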